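/- Let $\mathbb H$ be the quaternions and $\mathbb S=\{q\in\mathbb H: q^2=-1\}$. Let $\mathsf H\neq\{0\}$ be a quaternionic right Hilbert space, with scalar product $\langle u|v\rangle$ that is right $\mathbb H$-linear in $v$ and satisfies $\langle v|u\rangle=\overline{\langle u|v\rangle}$. Let $\mathfrak B(\mathsf H)$ be the bounded right $\mathbb H$-linear operators on $\mathsf H$; $S\ge 0$ means $\langle u|Su\rangle\in[0,\infty)$ for all $u$, and $|S|$ is the positive square root of $S^*S$. Fix $\imath\in\mathbb S$, and put $\mathbb C_\imath=\{\alpha+\imath\beta:\alpha,\beta\in\mathbb R\}$, $\mathbb C_\imath^+=\{\alpha+\imath\beta:\alpha,\beta\in\mathbb R,\ \beta\ge0\}$, and $\mathbb S_q=\{\alpha+\kappa\beta:\kappa\in\mathbb S\}$ for $q=\alpha+\jmath\beta$ with $\alpha,\beta\in\mathbb R$, $\jmath\in\mathbb S$. Definitions. - A *left scalar multiplication* of $\mathsf H$ is a map $\mathcal L:\mathbb H\to\mathfrak B(\mathsf H)$, $q\mapsto L_q$, of the form $L_qu=\sum_{z\in N}zq\langle z|u\rangle$ for some Hilbert basis $N$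 of $\mathsf H$. - A *qPVM* over $\mathbb C_\imath^+$ is a map $P$ from the Borel sets of $\mathbb C^+_\imath$ to the positive operators in $\mathfrak B(\mathsf H)$ such that $P(\mathbb C_\imath^+)=\mathrm I$, $P(E)P(E')=P(E\cap E')$, and $P(\bigcup_nE_n)u=\sum_nP(E_n)u$ for all $u\in\mathsf H$ and all sequences of pairwise disjoint Borel sets $E_n$. Its support $\operatorname{supp}P$ is the complement in $\mathbb C_\imath^+$ of the union of all open $O\subset\mathbb C_\imath^+$ with $P(O)=0$; $P$ is *bounded* if $\operatorname{supp}P$ is bounded. - An *iqPVM* over $\mathbb C_\imath^+$ is a pair $\mathcal P=(P,\mathcal L)$ of a qPVM and a left scalar multiplication with $P(E)L_q=L_qP(E)$ for all Borel $E$ and all $q\in\mathbb H$; it is *bounded* if $P$ is. - For a simple function, $\int\sum_\ell S_\ell\chi_{E_\ell}\,d\mathcal P=\sum_\ell L_{S_\ell}P(E_\ell)$ (the $E_\ell$ being pairwise disjoint Borel sets and $S_\ell\in\mathbb H$). If $\psi:\mathbb C^+_\imath\to\mathbb H$ is bounded and Borel measurable on $\operatorname{supp}P$, then $\int\psi\,d\mathcal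 P$ is the operator-norm limit of the integrals of simple functions converging uniformly to $\psi\chi_{\operatorname{supp}P}$. - For $T\in\mathfrak B(\mathsf H)$ and $q\in\mathbb H$ let $\Delta_q(T)=T^2-2\operatorname{Re}(q)T+|q|^2\mathrm I$. The spherical resolvent set consists of the $q$ for which $\Delta_q(T)$ is injective with dense range and bounded inverse on that range; $\sigma_S(T)$ is its complement. Further, $\sigma_{pS}(T)$ is the set of $q$ with $\Delta_q(T)$ not injective; $\sigma_{rS}(T)$ is the set of $q$ with $\Delta_q(T)$ injective but without dense range; $\sigma_{cS}(T)$ is the set of $q$ with $\Delta_q(T)$ injective, with dense range, and with unbounded inverse. **Theorem.** Let $T\in\mathfrak B(\mathsf H)$ be normal. There is a bounded iqPVM $\mathcal P=(P,\mathcal L)$ over $\mathbb C_\imath^+$ in $\mathsf H$ with $$T=\int_{\mathbb C_\imath^+}\mathrm{id}\,d\mathcal P ,$$ where $\mathrm{id}:\mathbb C^+_\imath\hookrightarrow\mathbb H$ is the inclusion. Moreover: (a) If $\mathcal P'=(P',\mathcal L')$ is any bounded iqPVM over $\mathbb C_\imath^+$ in $\mathsf H$ with $T=\int\mathrm{id}\,d\mathcal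 P'$, then $P'=P$, and $L'_qu=L_qu$ for all $q\in\mathbb C_\imath$ and $u\in\operatorname{Ker}(T-T^*)^\perp$. Furthermore $L'_\imath T=TL'_\imath$ and $L'_\imath T^*=T^*L'_\imath$; $L'_\jmath T=T^*L'_\jmath$ for every $\jmath\in\mathbb S$ with $\imath\jmath=-\jmath\imath$; and $-L'_\imath(T-T^*)=|T-T^*|=\int2\beta\,d\mathcal P'$, where $2\beta$ denotes the function $\alpha+\imath\beta\mapsto2\beta$. (b) For a left scalar multiplication $\mathcal L'$ of $\mathsf H$, the pair $(P,\mathcal L')$ is an iqPVM with $T=\int\mathrm{id}\,d(P,\mathcal L')$ if and only if $L'_\imath T=TL'_\imath$, $L'_\jmath T=T^*L'_\jmath$ for some $\jmath\in\mathbb S$ with $\imath\jmath=-\jmath\imath$, and $-L'_\imath(T-T^*)\ge0$. (c) $\operatorname{supp}P=\sigma_S(T)\cap\mathbb C_\imath^+$. (d) $P(\mathbb R)(\mathsf H)=\operatorname{Ker}(T-T^*)$ and $P(\mathbb C_\imath^+\setminus\mathbb R)(\mathsf H)=\operatorname{Ker}(T-T^*)^\perp$. (e) For $q\in\mathbb H$: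 $q\in\sigma_{pS}(T)$ if and only if $P(\mathbb S_q\cap\mathbb C_\imath^+)\ne0$; in particular, for $q\in\mathbb C_\imath^+$, $q\in\sigma_{pS}(T)$ if and only if $P(\{q\})\neq0$. Every isolated point of $\sigma_S(T)\cap\mathbb C_\imath^+$ belongs to $\sigma_{pS}(T)$. (f) $\sigma_{rS}(T)=\emptyset$. (g) For $q\in\mathbb H$: $q\in\sigma_{cS}(T)$ if and only if $P(\mathbb S_q\cap\mathbb C_\imath^+)=0$ and $P(U)\neq0$ for every open subset $U$ of $\mathbb C_\imath^+$ containing $\mathbb S_q\cap\mathbb C_\imath^+$; in particular, for $q\in\mathbb C_\imath^+$, $q\in\sigma_{cS}(T)$ if and only if $P(\{q\})=0$ and $P(U)\ne0$ for every open neighbourhood $U$ of $q$ in $\mathbb C_\imath^+$. If $q\in\sigma_{cS}(T)$, then for every $\epsilon>0$ there is $u\in\mathsf H$ with $\|u\|=1$ and $\|Tu-uq\|<\epsilon$. -/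

import Mathlib

open scoped Quaternion
open MulOpposite Filter Topology MeasureTheory

noncomputable section

/-! ### Quaternions -/

instance : MeasurableSpace ℍ := borel ℍ

instance : BorelSpace ℍ := ⟨rfl⟩

/-- The sphere of imaginary units. -/
def imUnits : Set ℍ := {q | q * q = -1}

/-- The complex plane `ℂ_ι = {α + ι β}`. -/
def slicePlane (ι : ℍ) : Set ℍ := {q | ∃ α β : ℝ, q = (α : ℍ) + ι * (β : ℍ)}

/-- The slice half-plane `ℂ⁺_ι = {α + ι β | β ≥ 0}`; as a type it carries the topology and the
Borel σ-algebra induced from `ℍ`. -/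
def sliceHalfPlane (ι : ℍ) : Set ℍ := {q | ∃ α β : ℝ, 0 ≤ β ∧ q = (α : ℍ) + ι * (β : ℍ)}

/-- The sphere `𝕊_q = α + β 𝕊`, where `q = α + j β` with `j` an imaginary unit. -/
def qSphere (q : ℍ) : Set ℍ :=
  {x | ∃ α β : ℝ, ∃ j ∈ imUnits, ∃ κ ∈ imUnits,
    q = (α : ℍ) + j * (β : ℍ) ∧ x = (α : ℍ) + κ * (β : ℍ)}

/-! ### Quaternionic Hilbert spaces -/

/-- A Hermitian quaternionic scalar product `⟨u|v⟩` on a right `ℍ`-module, inducing the norm. The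
right multiplication `u q` is `op q • u`. Together with `CompleteSpace H` this is a quaternionic
(right) Hilbert space. -/
class QuaternionicInner (H : Type*) [NormedAddCommGroup H] [Module ℍᵐᵒᵖ H] where
  qinner : H → H → ℍ
  qinner_add_right : ∀ u v w, qinner u (v + w) = qinner u v + qinner u w
  qinner_smul_right : ∀ u v (p : ℍ), qinner u (op p • v) = qinner u v * p
  star_qinner : ∀ u v, star (qinner v u) = qinner u v
  qinner_self : ∀ u, qinner u u = ((‖u‖ ^ 2 : ℝ) : ℍ)

open QuaternionicInner

section Hilbert

variable {H : Type*} [NormedAddCommGroup H] [Module ℍᵐᵒᵖ H] [QuaternionicInner H]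

theorem norm_op_smul (p : ℍ) (u : H) : ‖op p • u‖ = ‖p‖ * ‖u‖ := by
  have h := qinner_self (op p • u)
  rw [qinner_smul_right, ← star_qinner, qinner_smul_right, star_mul, star_qinner, qinner_self,
    mul_assoc, (Quaternion.coe_commutes _ _ : _ * p = _), ← mul_assoc, Quaternion.star_mul_self,
    ← Quaternion.coe_mul, Quaternion.coe_inj, Quaternion.normSq_eq_norm_mul_self] at h
  have h2 : (‖p‖ * ‖u‖) ^ 2 = ‖op p • u‖ ^ 2 := by rw [← h]; ring
  exact ((pow_left_inj₀ (by positivity) (by positivity) two_ne_zero).1 h2).symm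

theorem qinner_add_left (u v w : H) : qinner (u + v) w = qinner u w + qinner v w := by
  rw [← star_qinner, qinner_add_right, star_add, star_qinner, star_qinner]

theorem qinner_smul_left (u v : H) (p : ℍ) : qinner (op p • u) v = star p * qinner u v := by
  rw [← star_qinner, qinner_smul_right, star_mul, star_qinner]

/-- The underlying real inner product space, used only to obtain adjoints. -/
abbrev realInnerSpace (H : Type*) [NormedAddCommGroup H] [Module ℍᵐᵒᵖ H] [QuaternionicInner H] :
    InnerProductSpace ℝ H :=
  { Module.compHom H (algebraMap ℝ ℍᵐᵒᵖ) with
    norm_smul_le := fun r u => by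
      have := norm_op_smul (r : ℍ) u
      rw [Quaternion.norm_coe] at this
      exact this.le
    inner := fun u v => (qinner u v).re
    norm_sq_eq_re_inner := fun u => by
      change _ = (qinner u u).re
      rw [qinner_self, Quaternion.re_coe]
    conj_inner_symm := fun u v => by simp [← star_qinner u v]
    add_left := fun u v w => by simp [qinner_add_left]
    smul_left := fun u v r => by
      have : qinner (op (r : ℍ) • u) v = star (r : ℍ) * qinner u v := qinner_smul_left u v r
      change (qinner (op (r : ℍ) • u) v).re = _
      rw [this]; simp }

theorem qinner_ext {x y : H} (h : ∀ v, qinner x v = qinner y v) : x = y := by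
  have h1 : qinner (x - y) (x - y) = 0 := by
    have h2 : ∀ v, qinner (x - y) v + qinner y v = qinner x v := fun v => by
      rw [← qinner_add_left, sub_add_cancel]
    have h3 := h2 (x - y)
    rw [h] at h3
    simpa using h3
  rw [qinner_self] at h1
  have h4 : ‖x - y‖ ^ 2 = 0 := by
    rw [← Quaternion.coe_zero] at h1
    exact Quaternion.coe_injective h1
  exact sub_eq_zero.1 (norm_eq_zero.1 (pow_eq_zero_iff two_ne_zero |>.1 h4))

theorem exists_adjoint [CompleteSpace H] (T : H →L[ℍᵐᵒᵖ] H) :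
    ∃ S : H →L[ℍᵐᵒᵖ] H, ∀ u v, qinner (S u) v = qinner u (T v) := by
  let _ : InnerProductSpace ℝ H := realInnerSpace H
  let TR : H →L[ℝ] H :=
    { toFun := T, map_add' := map_add T, map_smul' := fun r u => T.map_smul (op (r : ℍ)) u,
      cont := T.continuous }
  let S := ContinuousLinearMap.adjoint TR
  have hre : ∀ u v, (qinner (S u) v).re = (qinner u (T v)).re :=
    fun u v => ContinuousLinearMap.adjoint_inner_left TR v u
  have hS : ∀ u v, qinner (S u) v = qinner u (T v) := fun u v => by
    have key : ∀ p : ℍ, (qinner (S u) v * p).re = (qinner u (T v) * p).re := fun p => by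
      rw [← qinner_smul_right, ← qinner_smul_right, hre, T.map_smul]
    simp only [Quaternion.re_mul] at key
    ext
    · simpa using key 1
    · simpa using key (⟨0, 1, 0, 0⟩ : ℍ[ℝ])
    · simpa using key (⟨0, 0, 1, 0⟩ : ℍ[ℝ])
    · simpa using key (⟨0, 0, 0, 1⟩ : ℍ[ℝ])
  refine ⟨{ toFun := S, map_add' := map_add S, map_smul' := fun p u => ?_,
            cont := S.continuous }, hS⟩
  refine qinner_ext fun v => ?_
  obtain ⟨p, rfl⟩ := op_surjective p
  simp only [RingHom.id_apply, hS, qinner_smul_left]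

/-- The adjoint `T*`, characterised by `⟨T* u|v⟩ = ⟨u|T v⟩`. -/
def qadjoint [CompleteSpace H] (T : H →L[ℍᵐᵒᵖ] H) : H →L[ℍᵐᵒᵖ] H :=
  Classical.choose (exists_adjoint T)

theorem qinner_qadjoint [CompleteSpace H] (T : H →L[ℍᵐᵒᵖ] H) (u v : H) :
    qinner (qadjoint T u) v = qinner u (T v) :=
  Classical.choose_spec (exists_adjoint T) u v

def IsNormalOp [CompleteSpace H] (T : H →L[ℍᵐᵒᵖ] H) : Prop :=
  T * qadjoint T = qadjoint T * T

/-- `T ≥ 0`: every `⟨u|T u⟩` is a non-negative real number. -/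
def IsPositiveOp (T : H →L[ℍᵐᵒᵖ] H) : Prop :=
  ∀ u, ∃ r : ℝ, 0 ≤ r ∧ qinner u (T u) = (r : ℍ)

/-- `A = |S|`, i.e. `A` is the positive square root of `S* S`. -/
def IsAbsOp [CompleteSpace H] (S A : H →L[ℍᵐᵒᵖ] H) : Prop :=
  IsPositiveOp A ∧ A * A = qadjoint S * S

def opKer (T : H →L[ℍᵐᵒᵖ] H) : Set H := {u | T u = 0}

def qperp (N : Set H) : Set H := {u | ∀ z ∈ N, qinner u z = 0}

structure IsHilbertBasis (N : Set H) : Prop where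
  norm_one : ∀ z ∈ N, ‖z‖ = 1
  orthogonal : ∀ z ∈ N, ∀ z' ∈ N, z ≠ z' → qinner z z' = 0
  perp : qperp N = {0}

/-- `L` is the left scalar multiplication induced by some Hilbert basis `N`:
`L_q u = ∑_{z ∈ N} z q ⟨z|u⟩`. -/
def IsLeftScalarMul (L : ℍ → H →L[ℍᵐᵒᵖ] H) : Prop :=
  ∃ N : Set H, IsHilbertBasis N ∧
    ∀ (q : ℍ) (u : H), HasSum (fun z : N => op (q * qinner (z : H) u) • (z : H)) (L q u)

/-! ### Spherical spectrum -/

/-- `Δ_q(T) = T² - T (2 Re q) + 1 |q|²`. -/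
def sphDelta (T : H →L[ℍᵐᵒᵖ] H) (q : ℍ) (u : H) : H :=
  T (T u) - op ((2 * q.re : ℝ) : ℍ) • T u + op ((‖q‖ ^ 2 : ℝ) : ℍ) • u

/-- Boundedness of `Δ_q(T)⁻¹ : Ran Δ_q(T) → H` (for injective `Δ_q(T)`). -/
def sphInvBounded (T : H →L[ℍᵐᵒᵖ] H) (q : ℍ) : Prop :=
  ∃ C : ℝ, ∀ u, ‖u‖ ≤ C * ‖sphDelta T q u‖

def sphResolvent (T : H →L[ℍᵐᵒᵖ] H) : Set ℍ :=
  {q | {u | sphDelta T q u = 0} = {0} ∧ Dense (Set.range (sphDelta T q)) ∧ sphInvBounded T q}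

def sphSpectrum (T : H →L[ℍᵐᵒᵖ] H) : Set ℍ := (sphResolvent T)ᶜ

def sphPointSpectrum (T : H →L[ℍᵐᵒᵖ] H) : Set ℍ :=
  {q | {u | sphDelta T q u = 0} ≠ {0}}

def sphResidualSpectrum (T : H →L[ℍᵐᵒᵖ] H) : Set ℍ :=
  {q | {u | sphDelta T q u = 0} = {0} ∧ closure (Set.range (sphDelta T q)) ≠ Set.univ}

def sphContinuousSpectrum (T : H →L[ℍᵐᵒᵖ] H) : Set ℍ :=
  {q | {u | sphDelta T q u = 0} = {0} ∧ closure (Set.range (sphDelta T q)) = Set.univ ∧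
    ¬ sphInvBounded T q}

end Hilbert

/-! ### Quaternionic projection-valued measures -/

/-- A qPVM over `ℂ⁺_ι` in `H`. Only the values on Borel sets are meaningful. -/
structure QPVM (ι : ℍ) (H : Type*) [NormedAddCommGroup H] [Module ℍᵐᵒᵖ H]
    [QuaternionicInner H] where
  toFun : Set (sliceHalfPlane ι) → H →L[ℍᵐᵒᵖ] H
  map_univ : toFun Set.univ = 1
  map_inter : ∀ E E', MeasurableSet E → MeasurableSet E' → toFun E * toFun E' = toFun (E ∩ E')
  map_iUnion : ∀ E : ℕ → Set (sliceHalfPlane ι), (∀ n, MeasurableSet (E n)) →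
    Pairwise (fun m n => Disjoint (E m) (E n)) →
    ∀ u, HasSum (fun n => toFun (E n) u) (toFun (⋃ n, E n) u)
  nonneg : ∀ E, MeasurableSet E → IsPositiveOp (toFun E)

section Measure

variable {ι : ℍ} {H : Type*} [NormedAddCommGroup H] [Module ℍᵐᵒᵖ H] [QuaternionicInner H]

instance : CoeFun (QPVM ι H) (fun _ => Set (sliceHalfPlane ι) → H →L[ℍᵐᵒᵖ] H) := ⟨QPVM.toFun⟩

def QPVM.supp (P : QPVM ι H) : Set (sliceHalfPlane ι) :=
  (⋃₀ {O | IsOpen O ∧ P O = 0})ᶜ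

/-- The pair `(P, L)` is an iqPVM. -/
structure IsIQPVM (P : QPVM ι H) (L : ℍ → H →L[ℍᵐᵒᵖ] H) : Prop where
  leftMul : IsLeftScalarMul L
  commute : ∀ E, MeasurableSet E → ∀ q, P E * L q = L q * P E

/-- The integral `∑ L_{S_ℓ} P(E_ℓ)` of a simple function `s = ∑ S_ℓ χ_{E_ℓ}`. -/
def simpleIntegral (P : QPVM ι H) (L : ℍ → H →L[ℍᵐᵒᵖ] H)
    (s : SimpleFunc (sliceHalfPlane ι) ℍ) : H →L[ℍᵐᵒᵖ] H :=
  ∑ q ∈ s.range, L q * P (s ⁻¹' {q})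

/-- Convergence of a sequence of operators in the operator norm. -/
def OpTendsto (S : ℕ → H →L[ℍᵐᵒᵖ] H) (T : H →L[ℍᵐᵒᵖ] H) : Prop :=
  ∀ ε : ℝ, 0 < ε → ∀ᶠ n in atTop, ∀ u, ‖S n u - T u‖ ≤ ε * ‖u‖

/-- `T = ∫ ψ d(P, L)`: the restriction of `ψ` to `supp P` is bounded and measurable, and `T` is the
operator-norm limit of the integrals of any sequence of simple functions converging uniformly to
the extension by `0` of that restriction (such sequences exist). -/
structure HasIQIntegral (P : QPVM ι H) (L : ℍ → H →L[ℍᵐᵒᵖ] H) (ψ : sliceHalfPlane ι → ℍ)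
    (T : H →L[ℍᵐᵒᵖ] H) : Prop where
  bounded : ∃ C : ℝ, ∀ z ∈ P.supp, ‖ψ z‖ ≤ C
  measurable : Measurable (P.supp.indicator ψ)
  exists_approx : ∃ s : ℕ → SimpleFunc (sliceHalfPlane ι) ℍ,
    TendstoUniformly (fun n => ⇑(s n)) (P.supp.indicator ψ) atTop
  tendsto : ∀ s : ℕ → SimpleFunc (sliceHalfPlane ι) ℍ,
    TendstoUniformly (fun n => ⇑(s n)) (P.supp.indicator ψ) atTop →
    OpTendsto (fun n => simpleIntegral P L (s n)) T

end Measure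

end

/-!
Right multiplication by `ℂ ⊆ ℍ` makes `H` a complex Hilbert space, on which `T` is normal. For real
functions `f` of the coordinates `α` and `|β|` of the spectrum, `f(T)` is a limit of polynomials in
`T + T*` and `(T - T*)²`, hence commutes with every right multiplication by a quaternion; its
spectral projections form the qPVM `P`, with `∫ 2α dP = T + T*` and `∫ 2β dP = |T - T*|`.

The left multiplication comes from vectors `u` with `(T - T*) u = |T - T*| u ι`. A maximal set of
such vectors on which all matrix entries `⟨u|f(T) v⟩` are real is a real form of `H` that is
invariant under the calculus. An orthonormal basis of it is a Hilbert basis of `H`, whose left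
multiplication commutes with `P` and satisfies `L_ι |T - T*| = T - T*`, so that
`2T = ∫ 2 id d(P, L)`.

The measures `⟨u|P u⟩` of any representing pair have the moments prescribed by `T + T*` and
`(T - T*)²`, so Stone–Weierstrass gives uniqueness. All spectral assertions are read off from
`‖Δ_q(T) u‖² = ∫ |z² - 2 Re(q) z + |q|²|² d⟨u|P u⟩`, in which the integrand vanishes exactly on
`𝕊_q`.
-/

open QuaternionicInner

noncomputable section

theorem norm_of_mem_imUnits {q : ℍ} (hq : q ∈ imUnits) : ‖q‖ = 1 := by
  have h : ‖q‖ * ‖q‖ = 1 := by rw [← norm_mul, show q * q = -1 from hq, norm_neg, norm_one]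
  nlinarith [norm_nonneg q]

theorem star_of_mem_imUnits {q : ℍ} (hq : q ∈ imUnits) : star q = -q := by
  have h0 : q ≠ 0 := fun h => by simpa [h] using norm_of_mem_imUnits hq
  have h1 : q * star q = 1 := by
    rw [Quaternion.self_mul_star, Quaternion.normSq_eq_norm_mul_self, norm_of_mem_imUnits hq]
    simp
  have h2 : q * -q = 1 := by rw [mul_neg, show q * q = -1 from hq, neg_neg]
  exact mul_left_cancel₀ h0 (h1.trans h2.symm)

theorem re_of_mem_imUnits {q : ℍ} (hq : q ∈ imUnits) : q.re = 0 := by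
  have h := congrArg QuaternionAlgebra.re (star_of_mem_imUnits hq)
  simp only [Quaternion.re_star, Quaternion.re_neg] at h
  linarith

section HalfPlane

variable {ι : ℍ}

/-- The coordinate `α` of `α + ι β`. -/
def hpRe (z : sliceHalfPlane ι) : ℝ := (z : ℍ).re

/-- The coordinate `β` of `α + ι β`. -/
def hpIm (z : sliceHalfPlane ι) : ℝ := ‖(z : ℍ).im‖

theorem continuous_hpRe : Continuous (hpRe : sliceHalfPlane ι → ℝ) :=
  Quaternion.continuous_re.comp continuous_subtype_val

theorem continuous_hpIm : Continuous (hpIm : sliceHalfPlane ι → ℝ) :=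
  (Quaternion.continuous_im.comp continuous_subtype_val).norm

theorem hpIm_nonneg (z : sliceHalfPlane ι) : 0 ≤ hpIm z := norm_nonneg _

theorem im_coe_add_mul (hι : ι ∈ imUnits) (α β : ℝ) :
    ((α : ℍ) + ι * (β : ℍ)).im = ι * (β : ℍ) := by
  ext <;> simp [re_of_mem_imUnits hι]

theorem re_coe_add_mul (hι : ι ∈ imUnits) (α β : ℝ) :
    ((α : ℍ) + ι * (β : ℍ)).re = α := by
  simp [re_of_mem_imUnits hι]

theorem norm_im_coe_add_mul (hι : ι ∈ imUnits) (α β : ℝ) :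
    ‖((α : ℍ) + ι * (β : ℍ)).im‖ = |β| := by
  rw [im_coe_add_mul hι, norm_mul, norm_of_mem_imUnits hι, Quaternion.norm_coe, one_mul,
    Real.norm_eq_abs]

/-- The point `α + ι |β|` of the half-plane. -/
def hpMk (ι : ℍ) (α β : ℝ) : sliceHalfPlane ι :=
  ⟨(α : ℍ) + ι * ((|β| : ℝ) : ℍ), α, |β|, abs_nonneg β, rfl⟩

theorem hpRe_hpMk (hι : ι ∈ imUnits) (α β : ℝ) : hpRe (hpMk ι α β) = α :=
  re_coe_add_mul hι α |β|

theorem hpIm_hpMk (hι : ι ∈ imUnits) (α β : ℝ) : hpIm (hpMk ι α β) = |β| :=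
  (norm_im_coe_add_mul hι α |β|).trans (abs_abs β)

theorem coe_eq_hpRe_add (hι : ι ∈ imUnits) (z : sliceHalfPlane ι) :
    (z : ℍ) = (hpRe z : ℍ) + ι * (hpIm z : ℍ) := by
  obtain ⟨z, α, β, hβ, rfl⟩ := z
  simp only [hpRe, hpIm, re_coe_add_mul hι, norm_im_coe_add_mul hι, abs_of_nonneg hβ]

theorem hp_ext (hι : ι ∈ imUnits) {z w : sliceHalfPlane ι} (h1 : hpRe z = hpRe w)
    (h2 : hpIm z = hpIm w) : z = w := by
  apply Subtype.ext
  rw [coe_eq_hpRe_add hι z, coe_eq_hpRe_add hι w, h1, h2]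

theorem hpMk_hpRe_hpIm (hι : ι ∈ imUnits) (z : sliceHalfPlane ι) :
    hpMk ι (hpRe z) (hpIm z) = z :=
  hp_ext hι (hpRe_hpMk hι _ _) ((hpIm_hpMk hι _ _).trans (abs_of_nonneg (hpIm_nonneg z)))

theorem continuous_hpMk : Continuous fun z : ℂ => hpMk ι z.re z.im := by
  refine Continuous.subtype_mk ?_ _
  have h1 : Continuous fun z : ℂ => ((z.re : ℝ) : ℍ) :=
    Quaternion.continuous_coe.comp Complex.continuous_re
  have h2 : Continuous fun z : ℂ => ((|z.im| : ℝ) : ℍ) :=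
    Quaternion.continuous_coe.comp Complex.continuous_im.abs
  exact h1.add (continuous_const.mul h2)

end HalfPlane

section Inner

variable {H : Type*} [NormedAddCommGroup H] [Module ℍᵐᵒᵖ H] [QuaternionicInner H]

@[simp] theorem qinner_zero_right (u : H) : qinner u (0 : H) = 0 := by
  simpa using qinner_add_right u 0 0

@[simp] theorem qinner_zero_left (u : H) : qinner (0 : H) u = 0 := by
  rw [← star_qinner, qinner_zero_right, star_zero]

theorem qinner_neg_right (u v : H) : qinner u (-v) = -qinner u v := by
  have := qinner_add_right u v (-v)
  rw [add_neg_cancel, qinner_zero_right] at this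
  exact (neg_eq_of_add_eq_zero_right this.symm).symm

theorem qinner_neg_left (u v : H) : qinner (-u) v = -qinner u v := by
  rw [← star_qinner, qinner_neg_right, star_neg, star_qinner]

theorem qinner_sub_right (u v w : H) : qinner u (v - w) = qinner u v - qinner u w := by
  rw [sub_eq_add_neg, qinner_add_right, qinner_neg_right, sub_eq_add_neg]

theorem qinner_sub_left (u v w : H) : qinner (u - v) w = qinner u w - qinner v w := by
  rw [sub_eq_add_neg, qinner_add_left, qinner_neg_left, sub_eq_add_neg]

theorem eq_zero_of_qinner_self_eq_zero {u : H} (h : qinner u u = 0) : u = 0 := by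
  rw [qinner_self, ← Quaternion.coe_zero] at h
  exact norm_eq_zero.1 (pow_eq_zero_iff two_ne_zero |>.1 (Quaternion.coe_injective h))

theorem norm_coeComplex (z : ℂ) : ‖(z : ℍ)‖ = ‖z‖ := by
  have h : ‖(z : ℍ)‖ ^ 2 = ‖z‖ ^ 2 := by
    rw [sq, ← Quaternion.normSq_eq_norm_mul_self, Quaternion.normSq_def', Complex.sq_norm,
      Complex.normSq_apply]
    simp only [Quaternion.re_coeComplex, Quaternion.imI_coeComplex, Quaternion.imJ_coeComplex,
      Quaternion.imK_coeComplex]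
    ring
  exact (pow_left_inj₀ (norm_nonneg _) (norm_nonneg _) two_ne_zero).1 h

/-- The embedding of `ℂ` into `ℍᵐᵒᵖ`. -/
def complexToQuaternionOp : ℂ →+* ℍᵐᵒᵖ where
  toFun z := op (z : ℍ)
  map_one' := by simp
  map_zero' := by simp
  map_add' z w := by simp
  map_mul' z w := by rw [mul_comm, Quaternion.coeComplex_mul, op_mul]

variable (H) in
/-- The complex Hilbert space structure given by right multiplication with `ℂ ⊆ ℍ`. -/
@[reducible] def complexInnerSpace : InnerProductSpace ℂ H :=
  { Module.compHom H complexToQuaternionOp with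
    norm_smul_le := fun c u => by
      have := norm_op_smul (c : ℍ) u
      rw [norm_coeComplex] at this
      exact this.le
    inner := fun u v => ⟨(qinner u v).re, (qinner u v).imI⟩
    norm_sq_eq_re_inner := fun u => by
      change _ = (qinner u u).re
      rw [qinner_self, Quaternion.re_coe]
    conj_inner_symm := fun u v => by
      rw [← star_qinner u v]; apply Complex.ext <;> simp
    add_left := fun u v w => by apply Complex.ext <;> simp [qinner_add_left]
    smul_left := fun u v c => by
      have : qinner (op (c : ℍ) • u) v = star (c : ℍ) * qinner u v := qinner_smul_left u v c
      change (⟨(qinner (op (c : ℍ) • u) v).re, (qinner (op (c : ℍ) • u) v).imI⟩ : ℂ) = _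
      rw [this]; apply Complex.ext <;> simp }

attribute [local instance] complexInnerSpace InnerProductSpace.complexToReal

theorem complex_smul_def (c : ℂ) (u : H) : c • u = op (c : ℍ) • u := rfl

theorem real_smul_def (c : ℝ) (u : H) : c • u = op (c : ℍ) • u := by
  change ((c : ℂ) • u : H) = _
  rw [complex_smul_def, Quaternion.coeComplex_coe]

theorem complex_inner_def (u v : H) : inner ℂ u v = ⟨(qinner u v).re, (qinner u v).imI⟩ := rfl

theorem real_inner_def (u v : H) : inner ℝ u v = (qinner u v).re := rfl

theorem real_smul_op_smul (c : ℝ) (p : ℍ) (u : H) : c • op p • u = op p • c • u := by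
  rw [real_smul_def, real_smul_def, smul_smul, smul_smul, ← op_mul, ← op_mul,
    Quaternion.coe_commutes]

theorem qinner_real_smul_right (c : ℝ) (u v : H) : qinner u (c • v) = c * qinner u v := by
  rw [real_smul_def, qinner_smul_right, Quaternion.coe_commutes]

theorem norm_qinner_le (u v : H) : ‖qinner u v‖ ≤ ‖u‖ * ‖v‖ := by
  set a := qinner u v with ha
  have h1 : qinner u (op (star a) • v) = ((‖a‖ * ‖a‖ : ℝ) : ℍ) := by
    rw [qinner_smul_right, ← ha, Quaternion.self_mul_star, Quaternion.normSq_eq_norm_mul_self]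
  have h2 := real_inner_le_norm u (op (star a) • v)
  rw [real_inner_def, h1, norm_op_smul, Quaternion.norm_star, Quaternion.re_coe] at h2
  rcases (norm_nonneg a).eq_or_lt with h | h
  · rw [← h]; positivity
  · nlinarith

theorem continuous_qinner_right (u : H) : Continuous (qinner u) := by
  have h : LipschitzWith ‖u‖₊ (qinner u) := LipschitzWith.of_dist_le_mul fun v w => by
    rw [dist_eq_norm, dist_eq_norm, ← qinner_sub_right]
    exact norm_qinner_le u (v - w)
  exact h.continuous

theorem continuous_op_smul (p : ℍ) : Continuous fun u : H => op p • u := by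
  have h : LipschitzWith ‖p‖₊ (fun u : H => op p • u) := .of_dist_le_mul fun u v => by
    rw [dist_eq_norm, dist_eq_norm, ← smul_sub, norm_op_smul, coe_nnnorm]
  exact h.continuous

theorem quaternion_eq_zero_of_mul_eq_star_mul {a : ℍ} (h : ∀ p : ℍ, a * p = star p * a) :
    a = 0 := by
  simp only [Quaternion.ext_iff, Quaternion.re_mul, Quaternion.imI_mul, Quaternion.imJ_mul,
    Quaternion.imK_mul, Quaternion.re_star, Quaternion.imI_star, Quaternion.imJ_star,
    Quaternion.imK_star] at h
  obtain ⟨h1, h2, -⟩ := h (⟨0, 1, 0, 0⟩ : ℍ[ℝ])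
  obtain ⟨h3, -⟩ := h (⟨0, 0, 1, 0⟩ : ℍ[ℝ])
  obtain ⟨h4, -⟩ := h (⟨0, 0, 0, 1⟩ : ℍ[ℝ])
  simp only [mul_zero, mul_one, zero_mul, neg_zero, add_zero, zero_add, sub_zero, zero_sub,
    neg_mul, one_mul] at h1 h2 h3 h4
  ext <;> simp only [Quaternion.re_zero, Quaternion.imI_zero, Quaternion.imJ_zero,
    Quaternion.imK_zero] <;> linarith

theorem quaternion_eq_coe_re {a : ℍ} (h : star a = a) : a = (a.re : ℍ) := by
  obtain ⟨-, hi, hj, hk⟩ := Quaternion.ext_iff.1 h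
  simp only [Quaternion.imI_star, Quaternion.imJ_star, Quaternion.imK_star] at hi hj hk
  ext <;> simp only [Quaternion.re_coe, Quaternion.imI_coe, Quaternion.imJ_coe,
    Quaternion.imK_coe] <;> linarith

theorem ext_of_qform {S S' : H →L[ℍᵐᵒᵖ] H} (h : ∀ u, qinner u (S u) = qinner u (S' u)) :
    S = S' := by
  set D := S - S'
  have hdiag : ∀ u, qinner u (D u) = 0 := fun u => by
    simp [D, qinner_sub_right, h]
  have hpolar : ∀ u v, qinner u (D v) + qinner v (D u) = 0 := fun u v => by
    simpa [qinner_add_left, qinner_add_right, hdiag, add_comm] using hdiag (u + v)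
  have hzero : ∀ u v, qinner u (D v) = 0 := fun u v => by
    refine quaternion_eq_zero_of_mul_eq_star_mul fun p => ?_
    have hp := hpolar u (op p • v)
    rw [map_smul, qinner_smul_right, qinner_smul_left, ← eq_neg_iff_add_eq_zero] at hp
    rw [hp, eq_neg_of_add_eq_zero_right (hpolar u v), mul_neg, neg_neg]
  refine sub_eq_zero.1 (ContinuousLinearMap.ext fun u => qinner_ext fun v => ?_)
  rw [← star_qinner, hzero, star_zero, zero_apply, qinner_zero_left]

section Adjoint

variable [CompleteSpace H]

theorem qinner_qadjoint_right (T : H →L[ℍᵐᵒᵖ] H) (u v : H) :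
    qinner u (qadjoint T v) = qinner (T u) v := by
  rw [← star_qinner, qinner_qadjoint, star_qinner]

theorem eq_qadjoint_of {S T : H →L[ℍᵐᵒᵖ] H} (h : ∀ u v, qinner (S u) v = qinner u (T v)) :
    S = qadjoint T := by
  ext u
  exact qinner_ext fun v => by rw [h, qinner_qadjoint]

theorem qadjoint_qadjoint (T : H →L[ℍᵐᵒᵖ] H) : qadjoint (qadjoint T) = T :=
  (eq_qadjoint_of fun u v => (qinner_qadjoint_right T u v).symm).symm

theorem qadjoint_mul (S T : H →L[ℍᵐᵒᵖ] H) : qadjoint (S * T) = qadjoint T * qadjoint S :=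
  (eq_qadjoint_of fun u v => by
    simp only [mul_apply_eq_comp, qinner_qadjoint]).symm

theorem qadjoint_add (S T : H →L[ℍᵐᵒᵖ] H) : qadjoint (S + T) = qadjoint S + qadjoint T :=
  (eq_qadjoint_of fun u v => by
    simp only [add_apply, qinner_qadjoint, qinner_add_left,
      qinner_add_right]).symm

theorem qadjoint_neg (S : H →L[ℍᵐᵒᵖ] H) : qadjoint (-S) = -qadjoint S :=
  (eq_qadjoint_of fun u v => by
    simp only [neg_apply, qinner_qadjoint, qinner_neg_left,
      qinner_neg_right]).symm

theorem qadjoint_sub (S T : H →L[ℍᵐᵒᵖ] H) : qadjoint (S - T) = qadjoint S - qadjoint T := by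
  rw [sub_eq_add_neg, qadjoint_add, qadjoint_neg, sub_eq_add_neg]

theorem qadjoint_sub_qadjoint (T : H →L[ℍᵐᵒᵖ] H) :
    qadjoint (T - qadjoint T) = -(T - qadjoint T) := by
  rw [qadjoint_sub, qadjoint_qadjoint, neg_sub]

theorem IsPositiveOp.qadjoint_eq {S : H →L[ℍᵐᵒᵖ] H} (hS : IsPositiveOp S) : qadjoint S = S :=
  ext_of_qform fun u => by
    obtain ⟨r, -, hr⟩ := hS u
    rw [qinner_qadjoint_right, ← star_qinner, hr, Quaternion.star_coe]

end Adjoint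

/-- A quaternionic operator as a complex-linear operator. -/
def toComplexOp (T : H →L[ℍᵐᵒᵖ] H) : H →L[ℂ] H :=
  { toFun := T, map_add' := map_add T, map_smul' := fun c u => T.map_smul (op (c : ℍ)) u,
    cont := T.continuous }

@[simp] theorem toComplexOp_apply (T : H →L[ℍᵐᵒᵖ] H) (u : H) : toComplexOp T u = T u := rfl

theorem qop_map_real_smul (T : H →L[ℍᵐᵒᵖ] H) (c : ℝ) (u : H) : T (c • u) = c • T u := by
  rw [real_smul_def, map_smul, real_smul_def]

theorem adjoint_toComplexOp [CompleteSpace H] (T : H →L[ℍᵐᵒᵖ] H) :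
    ContinuousLinearMap.adjoint (toComplexOp T) = toComplexOp (qadjoint T) := by
  symm
  rw [ContinuousLinearMap.eq_adjoint_iff]
  intro u v
  simp [complex_inner_def, qinner_qadjoint]

end Inner

section LeftMul

variable {H : Type*} [NormedAddCommGroup H] [Module ℍᵐᵒᵖ H] [QuaternionicInner H]

attribute [local instance] complexInnerSpace InnerProductSpace.complexToReal

theorem hasSum_op_smul {X : Type*} (p : ℍ) {f : X → H} {u : H} (h : HasSum f u) :
    HasSum (fun x => op p • f x) (op p • u) :=
  h.map (DistribSMul.toAddMonoidHom H (op p)) (continuous_op_smul p)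

theorem hasSum_qinner_right {X : Type*} (v : H) {f : X → H} {u : H} (h : HasSum f u) :
    HasSum (fun x => qinner v (f x)) (qinner v u) :=
  h.map (AddMonoidHom.mk' (qinner v) (qinner_add_right v)) (continuous_qinner_right v)

/-- The isometry `p ↦ z p` of `ℍ` onto the quaternionic line through a unit vector `z`. -/
def unitLine (z : H) (hz : ‖z‖ = 1) : ℍ →ₗᵢ[ℝ] H where
  toFun p := op p • z
  map_add' p q := by rw [op_add, add_smul]
  map_smul' c p := by
    rw [RingHom.id_apply, real_smul_def, smul_smul, ← op_mul, ← Quaternion.coe_mul_eq_smul,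
      Quaternion.coe_commutes]
  norm_map' p := by simp [norm_op_smul, hz]

namespace IsHilbertBasis

variable {N : Set H}

theorem orthogonalFamily (hN : IsHilbertBasis N) :
    OrthogonalFamily ℝ (fun _ : N => ℍ) fun z => unitLine (z : H) (hN.norm_one z z.2) := by
  intro z z' hzz p q
  change inner ℝ (op p • (z : H)) (op q • (z' : H)) = 0
  rw [real_inner_def, qinner_smul_right, qinner_smul_left,
    hN.orthogonal z z.2 z' z'.2 fun h => hzz (Subtype.ext h)]
  simp

theorem norm_sum_sq (hN : IsHilbertBasis N) (f : N → ℍ) (s : Finset N) :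
    ‖∑ z ∈ s, op (f z) • (z : H)‖ ^ 2 = ∑ z ∈ s, ‖f z‖ ^ 2 :=
  hN.orthogonalFamily.norm_sum f s

theorem summable_iff (hN : IsHilbertBasis N) [CompleteSpace H] (f : N → ℍ) :
    Summable (fun z : N => op (f z) • (z : H)) ↔ Summable fun z => ‖f z‖ ^ 2 :=
  hN.orthogonalFamily.summable_iff_norm_sq_summable f

theorem sum_norm_qinner_sq_le (hN : IsHilbertBasis N) (u : H) (s : Finset N) :
    ∑ z ∈ s, ‖qinner (z : H) u‖ ^ 2 ≤ ‖u‖ ^ 2 := by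
  set v := ∑ z ∈ s, op (qinner (z : H) u) • (z : H) with hv
  have hnorm : ‖v‖ ^ 2 = ∑ z ∈ s, ‖qinner (z : H) u‖ ^ 2 := hN.norm_sum_sq _ s
  have hinner : inner ℝ u v = ∑ z ∈ s, ‖qinner (z : H) u‖ ^ 2 := by
    rw [hv, inner_sum]
    refine Finset.sum_congr rfl fun z _ => ?_
    rw [real_inner_def, qinner_smul_right, ← star_qinner, Quaternion.star_mul_self,
      Quaternion.normSq_eq_norm_mul_self, Quaternion.re_coe, sq]
  linarith [norm_sub_sq_real u v, sq_nonneg ‖u - v‖]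

theorem sum_norm_mul_qinner_sq_le (hN : IsHilbertBasis N) (q : ℍ) (u : H) (s : Finset N) :
    ∑ z ∈ s, ‖q * qinner (z : H) u‖ ^ 2 ≤ (‖q‖ * ‖u‖) ^ 2 := by
  simp only [norm_mul, mul_pow, ← Finset.mul_sum]
  exact mul_le_mul_of_nonneg_left (hN.sum_norm_qinner_sq_le u s) (sq_nonneg _)

theorem summable_op_smul (hN : IsHilbertBasis N) [CompleteSpace H] (q : ℍ) (u : H) :
    Summable fun z : N => op (q * qinner (z : H) u) • (z : H) := by
  rw [hN.summable_iff]
  exact summable_of_sum_le (fun _ => sq_nonneg _) (hN.sum_norm_mul_qinner_sq_le q u)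

theorem norm_tsum_op_smul_le (hN : IsHilbertBasis N) [CompleteSpace H] (q : ℍ) (u : H) :
    ‖∑' z : N, op (q * qinner (z : H) u) • (z : H)‖ ≤ ‖q‖ * ‖u‖ := by
  refine le_of_tendsto (hN.summable_op_smul q u).hasSum.norm (Eventually.of_forall fun s => ?_)
  refine (sq_le_sq₀ (norm_nonneg _) (by positivity)).1 ?_
  rw [hN.norm_sum_sq]
  exact hN.sum_norm_mul_qinner_sq_le q u s

/-- The left multiplication by `q` defined by a Hilbert basis. -/
def leftMul (hN : IsHilbertBasis N) [CompleteSpace H] (q : ℍ) : H →L[ℍᵐᵒᵖ] H :=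
  have hadd : ∀ u v : H, ∑' z : N, op (q * qinner (z : H) (u + v)) • (z : H) =
      ∑' z : N, op (q * qinner (z : H) u) • (z : H) +
        ∑' z : N, op (q * qinner (z : H) v) • (z : H) := fun u v => by
    rw [← (hN.summable_op_smul q u).tsum_add (hN.summable_op_smul q v)]
    simp only [qinner_add_right, mul_add, op_add, add_smul]
  { toFun := fun u => ∑' z : N, op (q * qinner (z : H) u) • (z : H)
    map_add' := hadd
    map_smul' := fun p u => by
      obtain ⟨p, rfl⟩ := op_surjective p
      rw [RingHom.id_apply, ← (hasSum_op_smul p (hN.summable_op_smul q u).hasSum).tsum_eq]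
      simp only [qinner_smul_right, ← mul_assoc, smul_smul]
      simp only [← op_mul, mul_assoc]
    cont := AddMonoidHomClass.continuous_of_bound
      (AddMonoidHom.mk' (fun u => ∑' z : N, op (q * qinner (z : H) u) • (z : H)) hadd) ‖q‖
      (hN.norm_tsum_op_smul_le q) }

theorem hasSum_leftMul (hN : IsHilbertBasis N) [CompleteSpace H] (q : ℍ) (u : H) :
    HasSum (fun z : N => op (q * qinner (z : H) u) • (z : H)) (hN.leftMul q u) :=
  (hN.summable_op_smul q u).hasSum

theorem isLeftScalarMul (hN : IsHilbertBasis N) [CompleteSpace H] :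
    IsLeftScalarMul hN.leftMul :=
  ⟨N, hN, hN.hasSum_leftMul⟩

theorem ext_of_qinner (hN : IsHilbertBasis N) {u v : H} (h : ∀ z ∈ N, qinner z u = qinner z v) :
    u = v := by
  have hperp : u - v ∈ qperp N := fun z hz => by
    rw [← star_qinner, qinner_sub_right, h z hz, sub_self, star_zero]
  rw [hN.perp] at hperp
  exact sub_eq_zero.1 hperp

theorem qinner_eq_of_hasSum (hN : IsHilbertBasis N) {q : ℍ} {u w : H}
    (h : HasSum (fun z : N => op (q * qinner (z : H) u) • (z : H)) w) {z : H} (hz : z ∈ N) :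
    qinner z w = q * qinner z u := by
  have hterm := hasSum_single (f := fun z' : N => qinner z (op (q * qinner (z' : H) u) • (z' : H)))
    (⟨z, hz⟩ : N) fun z' hz' => by
      rw [qinner_smul_right, hN.orthogonal z hz z' z'.2 fun h => hz' (Subtype.ext h.symm),
        zero_mul]
  rw [(hasSum_qinner_right z h).unique hterm, qinner_smul_right, qinner_self, hN.norm_one z hz,
    one_pow, Quaternion.coe_one, one_mul]

theorem hasSum_qinner_smul (hN : IsHilbertBasis N) [CompleteSpace H] (u : H) :
    HasSum (fun z : N => op (qinner (z : H) u) • (z : H)) u := by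
  have h := hN.hasSum_leftMul 1 u
  have : hN.leftMul 1 u = u :=
    hN.ext_of_qinner fun z hz => by rw [hN.qinner_eq_of_hasSum h hz, one_mul]
  simpa [this] using h

theorem hasSum_qinner (hN : IsHilbertBasis N) [CompleteSpace H] (u v : H) :
    HasSum (fun z : N => star (qinner (z : H) u) * qinner (z : H) v) (qinner u v) := by
  refine (hasSum_qinner_right u (hN.hasSum_qinner_smul v)).congr_fun fun z => ?_
  rw [qinner_smul_right, star_qinner]

theorem eq_of_eqOn (hN : IsHilbertBasis N) [CompleteSpace H] {S S' : H →L[ℍᵐᵒᵖ] H}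
    (h : Set.EqOn S S' N) : S = S' := by
  ext u
  have h1 := (hN.hasSum_qinner_smul u).mapL S
  have h2 := (hN.hasSum_qinner_smul u).mapL S'
  refine h1.unique (h2.congr_fun fun z => ?_)
  rw [map_smul, map_smul, h z.2]

end IsHilbertBasis

namespace IsLeftScalarMul

variable {L : ℍ → H →L[ℍᵐᵒᵖ] H}

theorem exists_basis (hL : IsLeftScalarMul L) : ∃ N : Set H, IsHilbertBasis N ∧
    (∀ z ∈ N, ∀ q u, qinner z (L q u) = q * qinner z u) ∧ ∀ z ∈ N, ∀ q, L q z = op q • z := by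
  obtain ⟨N, hN, h⟩ := hL
  have hcoord : ∀ z ∈ N, ∀ q u, qinner z (L q u) = q * qinner z u :=
    fun z hz q u => hN.qinner_eq_of_hasSum (h q u) hz
  refine ⟨N, hN, hcoord, fun z hz q => hN.ext_of_qinner fun w hw => ?_⟩
  rw [hcoord w hw, qinner_smul_right]
  by_cases hwz : w = z
  · rw [hwz, qinner_self, Quaternion.coe_commutes]
  · rw [hN.orthogonal w hw z hz hwz]; simp

theorem map_add (hL : IsLeftScalarMul L) (p q : ℍ) : L (p + q) = L p + L q := by
  obtain ⟨N, hN, h, -⟩ := hL.exists_basis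
  ext u
  refine hN.ext_of_qinner fun z hz => ?_
  rw [add_apply, qinner_add_right, h z hz, h z hz, h z hz, add_mul]

theorem map_mul (hL : IsLeftScalarMul L) (p q : ℍ) : L (p * q) = L p * L q := by
  obtain ⟨N, hN, h, -⟩ := hL.exists_basis
  ext u
  refine hN.ext_of_qinner fun z hz => ?_
  rw [mul_apply_eq_comp, h z hz, h z hz, h z hz, mul_assoc]

theorem map_coe (hL : IsLeftScalarMul L) (r : ℝ) (u : H) : L (r : ℍ) u = r • u := by
  obtain ⟨N, hN, h, -⟩ := hL.exists_basis
  refine hN.ext_of_qinner fun z hz => ?_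
  rw [h z hz, qinner_real_smul_right]

theorem map_one (hL : IsLeftScalarMul L) : L 1 = 1 := by
  ext u
  simpa using hL.map_coe 1 u

theorem map_zero (hL : IsLeftScalarMul L) : L 0 = 0 := by
  ext u
  simpa using hL.map_coe 0 u

theorem map_neg (hL : IsLeftScalarMul L) (p : ℍ) : L (-p) = -L p := by
  refine eq_neg_of_add_eq_zero_left ?_
  rw [← hL.map_add, neg_add_cancel, hL.map_zero]

theorem qadjoint_eq_map_star (hL : IsLeftScalarMul L) [CompleteSpace H] (q : ℍ) :
    qadjoint (L q) = L (star q) := by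
  obtain ⟨N, hN, h, -⟩ := hL.exists_basis
  refine (eq_qadjoint_of fun u v => ?_).symm
  refine (hN.hasSum_qinner _ v).unique ((hN.hasSum_qinner u _).congr_fun fun z => ?_)
  rw [h z z.2, h z z.2, star_mul, star_star, mul_assoc]

end IsLeftScalarMul

end LeftMul

section SpectralMeasure

theorem sum_mul_measureReal_eq_zero {X κ : Type*} [TopologicalSpace X] [MeasurableSpace X]
    [BorelSpace X] [HasOuterApproxClosed X] [Fintype κ] (c : κ → ℝ) (μ : κ → Measure X)
    [∀ i, IsFiniteMeasure (μ i)]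
    (h : ∀ f : BoundedContinuousFunction X ℝ, ∑ i, c i * ∫ x, f x ∂μ i = 0) (E : Set X) :
    ∑ i, c i * (μ i).real E = 0 := by
  -- Separating the positive from the negative coefficients turns the relation into an equality of
  -- two positive measures.
  let α : Measure X := ∑ i, (c i).toNNReal • μ i
  let β : Measure X := ∑ i, (-c i).toNNReal • μ i
  have hint : ∀ (f : BoundedContinuousFunction X ℝ) (d : κ → NNReal),
      ∫ x, f x ∂(∑ i, d i • μ i) = ∑ i, (d i : ℝ) * ∫ x, f x ∂μ i := fun f d => by
    rw [integral_finsetSum_measure fun i _ => f.integrable _]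
    exact Finset.sum_congr rfl fun i _ => integral_smul_nnreal_measure _ _
  have hreal : ∀ d : κ → NNReal, (∑ i, d i • μ i : Measure X).real E =
      ∑ i, (d i : ℝ) * (μ i).real E := fun d => by
    rw [measureReal_def, Measure.finsetSum_apply,
      ENNReal.toReal_sum (fun i _ => measure_ne_top _ _)]
    refine Finset.sum_congr rfl fun i _ => ?_
    rw [Measure.smul_apply, ENNReal.toReal_smul, measureReal_def, NNReal.smul_def, smul_eq_mul]
  have hsub : ∀ i, c i = ((c i).toNNReal : ℝ) - ((-c i).toNNReal : ℝ) := fun i => by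
    rw [Real.coe_toNNReal', Real.coe_toNNReal', max_zero_sub_max_neg_zero_eq_self]
  have hαβ : α = β := by
    refine ext_of_forall_integral_eq_of_IsFiniteMeasure fun f => ?_
    rw [hint, hint, ← sub_eq_zero, ← Finset.sum_sub_distrib, ← h f]
    exact Finset.sum_congr rfl fun i _ => by rw [← sub_mul, ← hsub]
  calc ∑ i, c i * (μ i).real E = α.real E - β.real E := by
        rw [hreal, hreal, ← Finset.sum_sub_distrib]
        exact Finset.sum_congr rfl fun i _ => by rw [← sub_mul, ← hsub]
    _ = 0 := by rw [hαβ, sub_self]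

variable {K V : Type*} [TopologicalSpace K] [NormedAddCommGroup V] [InnerProductSpace ℝ V]
  [CompleteSpace V]

theorem isSelfAdjoint_starAlgHom_apply (Φ : C(K, ℝ) →⋆ₐ[ℝ] (V →L[ℝ] V)) (f : C(K, ℝ)) :
    IsSelfAdjoint (Φ f) := by
  rw [IsSelfAdjoint, ← map_star, star_trivial]

theorem inner_map_symm (Φ : C(K, ℝ) →⋆ₐ[ℝ] (V →L[ℝ] V)) (f : C(K, ℝ)) (u v : V) :
    inner ℝ (Φ f u) v = inner ℝ u (Φ f v) :=
  (isSelfAdjoint_starAlgHom_apply Φ f).isSymmetric u v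

theorem inner_map_nonneg (Φ : C(K, ℝ) →⋆ₐ[ℝ] (V →L[ℝ] V)) {f : C(K, ℝ)} (hf : 0 ≤ f)
    (u : V) : 0 ≤ inner ℝ u (Φ f u) := by
  let g : C(K, ℝ) := ⟨fun x => √(f x), f.continuous.sqrt⟩
  have hg : f = g * g := by
    ext x
    exact (Real.mul_self_sqrt (hf x)).symm
  rw [hg, map_mul, mul_apply_eq_comp, ← inner_map_symm]
  exact real_inner_self_nonneg

theorem inner_map_add_self (Φ : C(K, ℝ) →⋆ₐ[ℝ] (V →L[ℝ] V)) (f : C(K, ℝ)) (u v : V) :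
    inner ℝ (u + v) (Φ f (u + v)) =
      inner ℝ u (Φ f u) + inner ℝ v (Φ f v) + 2 * inner ℝ u (Φ f v) := by
  rw [map_add, inner_add_left, inner_add_right, inner_add_right, ← inner_map_symm Φ f v u,
    real_inner_comm u (Φ f v)]
  ring

/-- The positive functional `f ↦ ⟨u, Φ(f) u⟩` attached to a vector by a representation `Φ` of the
real continuous functions on `K`. -/
def spectralFunctional (Φ : C(K, ℝ) →⋆ₐ[ℝ] (V →L[ℝ] V)) (u : V) :
    CompactlySupportedContinuousMap K ℝ →ₚ[ℝ] ℝ :=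
  PositiveLinearMap.mk₀
    { toFun := fun f => inner ℝ u (Φ f.toContinuousMap u)
      map_add' := fun f g => by
        rw [← inner_add_right, ← add_apply, ← map_add]; rfl
      map_smul' := fun c f => by
        rw [RingHom.id_apply, smul_eq_mul, ← real_inner_smul_right, ← smul_apply, ← map_smul]; rfl }
    fun _ hf => inner_map_nonneg Φ hf u

variable [CompactSpace K] [T2Space K] [MeasurableSpace K] [BorelSpace K]

/-- The spectral measure of a vector, characterised by `∫ f = ⟨u, Φ(f) u⟩`. -/
def spectralMeasure (Φ : C(K, ℝ) →⋆ₐ[ℝ] (V →L[ℝ] V)) (u : V) : Measure K :=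
  RealRMK.rieszMeasure (spectralFunctional Φ u)

variable (Φ : C(K, ℝ) →⋆ₐ[ℝ] (V →L[ℝ] V))

instance isFiniteMeasure_spectralMeasure (u : V) : IsFiniteMeasure (spectralMeasure Φ u) := by
  rw [spectralMeasure]
  infer_instance

theorem integral_spectralMeasure (u : V) (f : C(K, ℝ)) :
    ∫ x, f x ∂spectralMeasure Φ u = inner ℝ u (Φ f u) :=
  RealRMK.integral_rieszMeasure (spectralFunctional Φ u)
    ⟨f, HasCompactSupport.of_compactSpace f⟩

theorem measureReal_spectralMeasure_univ (u : V) :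
    (spectralMeasure Φ u).real Set.univ = ‖u‖ ^ 2 := by
  have h := integral_spectralMeasure Φ u 1
  rw [map_one, one_apply_eq_self, real_inner_self_eq_norm_sq] at h
  simpa using h

theorem measureReal_spectralMeasure_le (E : Set K) (u : V) :
    (spectralMeasure Φ u).real E ≤ ‖u‖ ^ 2 := by
  rw [← measureReal_spectralMeasure_univ Φ]
  exact measureReal_mono (Set.subset_univ E)

theorem integrable_spectralMeasure (u : V) (f : C(K, ℝ)) : Integrable f (spectralMeasure Φ u) :=
  (BoundedContinuousFunction.mkOfCompact f).integrable _

/-- The polarisation of the quadratic form `u ↦ μ_u(E)`. -/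
def spectralPolar (E : Set K) (u v : V) : ℝ :=
  ((spectralMeasure Φ (u + v)).real E - (spectralMeasure Φ u).real E -
    (spectralMeasure Φ v).real E) / 2

theorem spectralPolar_comm (E : Set K) (u v : V) :
    spectralPolar Φ E u v = spectralPolar Φ E v u := by
  rw [spectralPolar, spectralPolar, add_comm u v]
  ring

variable [HasOuterApproxClosed K]

theorem sum_mul_spectralPolar_eq_zero {κ : Type*} [Fintype κ] (c : κ → ℝ) (u v : κ → V)
    (h : ∀ f, ∑ i, c i * inner ℝ (u i) (Φ f (v i)) = 0) (E : Set K) :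
    ∑ i, c i * spectralPolar Φ E (u i) (v i) = 0 := by
  have key := sum_mul_measureReal_eq_zero (κ := κ ⊕ κ ⊕ κ)
    (Sum.elim (fun i => c i / 2) (Sum.elim (fun i => -(c i / 2)) fun i => -(c i / 2)))
    (fun x => spectralMeasure Φ ((Sum.elim (fun i => u i + v i) (Sum.elim u v) : κ ⊕ κ ⊕ κ → V) x))
    (fun f => ?_) E
  · rw [← key]
    simp only [Fintype.sum_sum_type, Sum.elim_inl, Sum.elim_inr, ← Finset.sum_add_distrib,
      spectralPolar]
    exact Finset.sum_congr rfl fun i _ => by ring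
  · have hf : ∀ w, ∫ x, f x ∂spectralMeasure Φ w = inner ℝ w (Φ f.toContinuousMap w) :=
      fun w => integral_spectralMeasure Φ w f.toContinuousMap
    simp only [Fintype.sum_sum_type, Sum.elim_inl, Sum.elim_inr, ← Finset.sum_add_distrib, hf]
    rw [← h f.toContinuousMap]
    refine Finset.sum_congr rfl fun i _ => ?_
    rw [inner_map_add_self]
    ring

theorem spectralPolar_add_left (E : Set K) (u u' v : V) :
    spectralPolar Φ E (u + u') v = spectralPolar Φ E u v + spectralPolar Φ E u' v := by
  have h := sum_mul_spectralPolar_eq_zero Φ ![1, -1, -1] ![u + u', u, u'] ![v, v, v] (fun f => by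
    simp [Fin.sum_univ_three, inner_add_left]) E
  simp only [Fin.sum_univ_three, Matrix.cons_val] at h
  linarith

theorem spectralPolar_smul_left (E : Set K) (c : ℝ) (u v : V) :
    spectralPolar Φ E (c • u) v = c * spectralPolar Φ E u v := by
  have h := sum_mul_spectralPolar_eq_zero Φ ![1, -c] ![c • u, u] ![v, v] (fun f => by
    simp [Fin.sum_univ_two, real_inner_smul_left]) E
  simp only [Fin.sum_univ_two, Matrix.cons_val] at h
  linarith

theorem spectralPolar_self (E : Set K) (u : V) :
    spectralPolar Φ E u u = (spectralMeasure Φ u).real E := by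
  have h := sum_mul_measureReal_eq_zero ![1, -4] (fun i => spectralMeasure Φ (![u + u, u] i))
    (fun f => by
      have hf : ∀ w, ∫ x, f x ∂spectralMeasure Φ w = inner ℝ w (Φ f.toContinuousMap w) :=
        fun w => integral_spectralMeasure Φ w f.toContinuousMap
      simp only [Fin.sum_univ_two, Matrix.cons_val, hf, inner_map_add_self]
      ring) E
  simp only [Fin.sum_univ_two, Matrix.cons_val] at h
  rw [spectralPolar]
  linarith

theorem spectralPolar_map_comm {S S' : V →L[ℝ] V}
    (h : ∀ f u v, inner ℝ (S u) (Φ f v) = inner ℝ u (Φ f (S' v))) (E : Set K) (u v : V) :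
    spectralPolar Φ E (S u) v = spectralPolar Φ E u (S' v) := by
  have h := sum_mul_spectralPolar_eq_zero Φ ![1, -1] ![S u, u] ![v, S' v] (fun f => by
    simp [Fin.sum_univ_two, h]) E
  simp only [Fin.sum_univ_two, Matrix.cons_val] at h
  linarith

/-- The bilinear form `(u, v) ↦ ⟨P(E) u, v⟩` of the spectral projection `P(E)`. -/
def spectralForm (E : Set K) : LinearMap.BilinForm ℝ V :=
  LinearMap.mk₂ ℝ (spectralPolar Φ E) (spectralPolar_add_left Φ E) (spectralPolar_smul_left Φ E)
    (fun u v w => by simp only [spectralPolar_comm Φ E u, spectralPolar_add_left])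
    (fun c u v => by simp only [spectralPolar_comm Φ E u, spectralPolar_smul_left, smul_eq_mul])

theorem spectralForm_apply (E : Set K) (u v : V) : spectralForm Φ E u v = spectralPolar Φ E u v :=
  rfl

theorem abs_spectralForm_le (E : Set K) (u v : V) : |spectralForm Φ E u v| ≤ 1 * ‖u‖ * ‖v‖ := by
  have hcs := LinearMap.BilinForm.apply_sq_le_of_symm (spectralForm Φ E)
    (fun w => by rw [spectralForm_apply, spectralPolar_self]; exact measureReal_nonneg)
    ⟨fun u v => spectralPolar_comm Φ E u v⟩ u v
  refine abs_le_of_sq_le_sq ?_ (by positivity)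
  calc spectralForm Φ E u v ^ 2 ≤ spectralForm Φ E u u * spectralForm Φ E v v := hcs
    _ = (spectralMeasure Φ u).real E * (spectralMeasure Φ v).real E := by
      rw [spectralForm_apply, spectralForm_apply, spectralPolar_self, spectralPolar_self]
    _ ≤ ‖u‖ ^ 2 * ‖v‖ ^ 2 := by
      gcongr <;> exact measureReal_spectralMeasure_le Φ E _
    _ = (1 * ‖u‖ * ‖v‖) ^ 2 := by ring

/-- The spectral projection `P(E)` of a set `E`, given by the Riesz representation of its form. -/
def spectralProj (E : Set K) : V →L[ℝ] V :=
  InnerProductSpace.continuousLinearMapOfBilin (𝕜 := ℝ)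
    ((spectralForm Φ E).mkContinuous₂ 1 (abs_spectralForm_le Φ E))

theorem inner_spectralProj (E : Set K) (u v : V) :
    inner ℝ (spectralProj Φ E u) v = spectralPolar Φ E u v :=
  InnerProductSpace.continuousLinearMapOfBilin_apply _ u v

theorem inner_spectralProj_symm (E : Set K) (u v : V) :
    inner ℝ (spectralProj Φ E u) v = inner ℝ u (spectralProj Φ E v) := by
  rw [real_inner_comm _ u, inner_spectralProj, inner_spectralProj, spectralPolar_comm]

theorem inner_spectralProj_self (E : Set K) (u : V) :
    inner ℝ (spectralProj Φ E u) u = (spectralMeasure Φ u).real E := by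
  rw [inner_spectralProj, spectralPolar_self]

theorem spectralProj_commute {S : V →L[ℝ] V} (hS : ∀ f, Commute (Φ f) S) (E : Set K) :
    Commute (spectralProj Φ E) S := by
  have hadj : ∀ f, Commute (Φ f) (star S) := fun f => by
    simpa only [(isSelfAdjoint_starAlgHom_apply Φ f).star_eq] using (hS f).star_star
  ext u
  refine ext_inner_right ℝ fun v => ?_
  change inner ℝ (spectralProj Φ E (S u)) v = inner ℝ (S (spectralProj Φ E u)) v
  rw [← ContinuousLinearMap.adjoint_inner_right S, inner_spectralProj, inner_spectralProj]
  refine spectralPolar_map_comm Φ (S' := star S) (fun f x y => ?_) E u v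
  rw [← ContinuousLinearMap.adjoint_inner_right S]
  exact congrArg _ (DFunLike.congr_fun (hadj f) y).symm

theorem spectralProj_commute_map (E : Set K) (f : C(K, ℝ)) :
    Commute (spectralProj Φ E) (Φ f) :=
  spectralProj_commute Φ (fun g => (Commute.all g f).map Φ) E

theorem spectralMeasure_map (u : V) (f : C(K, ℝ)) :
    spectralMeasure Φ (Φ f u) =
      (spectralMeasure Φ u).withDensity fun x => ENNReal.ofReal (f x * f x) := by
  have hfin : IsFiniteMeasure
      ((spectralMeasure Φ u).withDensity fun x => ENNReal.ofReal (f x * f x)) :=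
    isFiniteMeasure_withDensity_ofReal (integrable_spectralMeasure Φ u (f * f)).2
  refine ext_of_forall_integral_eq_of_IsFiniteMeasure fun g => ?_
  have hcomm : f * g.toContinuousMap * f = f * f * g.toContinuousMap := by ring
  calc ∫ x, g x ∂spectralMeasure Φ (Φ f u)
      = inner ℝ (Φ f u) (Φ g.toContinuousMap (Φ f u)) :=
        integral_spectralMeasure Φ (Φ f u) g.toContinuousMap
    _ = inner ℝ u (Φ (f * f * g.toContinuousMap) u) := by
        rw [inner_map_symm, ← mul_apply_eq_comp, ← mul_apply_eq_comp, ← map_mul, ← map_mul, hcomm]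
    _ = ∫ x, f x * f x * g x ∂spectralMeasure Φ u :=
        (integral_spectralMeasure Φ u (f * f * g.toContinuousMap)).symm
    _ = _ := by
        rw [integral_withDensity_eq_integral_toReal_smul
          (by fun_prop) (Eventually.of_forall fun _ => ENNReal.ofReal_lt_top)]
        simp only [ENNReal.toReal_ofReal (mul_self_nonneg _), smul_eq_mul]

theorem measureReal_spectralMeasure_map (u : V) (f : C(K, ℝ)) {E : Set K} (hE : MeasurableSet E) :
    (spectralMeasure Φ (Φ f u)).real E = ∫ x in E, f x * f x ∂spectralMeasure Φ u := by
  rw [spectralMeasure_map, measureReal_def, withDensity_apply _ hE,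
    integral_eq_lintegral_of_nonneg_ae (Eventually.of_forall fun x => mul_self_nonneg (f x))
      (f.continuous.mul f.continuous).aestronglyMeasurable]

theorem inner_spectralProj_map_map (u : V) (f : C(K, ℝ)) {E : Set K} (hE : MeasurableSet E) :
    inner ℝ (spectralProj Φ E u) (Φ (f * f) u) = ∫ x in E, f x * f x ∂spectralMeasure Φ u := by
  rw [← measureReal_spectralMeasure_map Φ u f hE, ← inner_spectralProj_self, map_mul,
    mul_apply_eq_comp, ← inner_map_symm]
  exact congrArg (inner ℝ · _) (DFunLike.congr_fun (spectralProj_commute_map Φ E f) u).symm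

theorem inner_spectralProj_map (u : V) (g : C(K, ℝ)) {E : Set K} (hE : MeasurableSet E) :
    inner ℝ (spectralProj Φ E u) (Φ g u) = ∫ x in E, g x ∂spectralMeasure Φ u := by
  have hg : (4 : ℝ) • g = (1 + g) * (1 + g) - (1 - g) * (1 - g) := by
    ext x
    simp only [ContinuousMap.smul_apply, ContinuousMap.sub_apply, ContinuousMap.mul_apply,
      ContinuousMap.add_apply, ContinuousMap.one_apply, smul_eq_mul]
    ring
  have hint : ∀ f : C(K, ℝ), IntegrableOn (fun x => f x * f x) E (spectralMeasure Φ u) :=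
    fun f => (integrable_spectralMeasure Φ u (f * f)).integrableOn
  have key : 4 * inner ℝ (spectralProj Φ E u) (Φ g u) =
      4 * ∫ x in E, g x ∂spectralMeasure Φ u := by
    rw [← real_inner_smul_right, ← smul_apply, ← map_smul, hg, map_sub, sub_apply, inner_sub_right,
      inner_spectralProj_map_map Φ u _ hE, inner_spectralProj_map_map Φ u _ hE,
      ← integral_sub (hint _) (hint _), ← integral_const_mul]
    exact integral_congr_ae (Eventually.of_forall fun x => (DFunLike.congr_fun hg x).symm)
  linarith

theorem spectralMeasure_spectralProj_add (u : V) {E : Set K} (hE : MeasurableSet E) :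
    spectralMeasure Φ (spectralProj Φ E u + u) = spectralMeasure Φ (spectralProj Φ E u) +
      spectralMeasure Φ u + (2 : NNReal) • (spectralMeasure Φ u).restrict E := by
  refine ext_of_forall_integral_eq_of_IsFiniteMeasure fun f => ?_
  have hf : ∀ w, ∫ x, f x ∂spectralMeasure Φ w = inner ℝ w (Φ f.toContinuousMap w) :=
    fun w => integral_spectralMeasure Φ w f.toContinuousMap
  rw [integral_add_measure (f.integrable _) (f.integrable _),
    integral_add_measure (f.integrable _) (f.integrable _), integral_smul_nnreal_measure,
    hf, hf, hf, inner_map_add_self, inner_spectralProj_map Φ u _ hE]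
  rfl

theorem inner_spectralProj_spectralProj_self {E F : Set K} (hE : MeasurableSet E)
    (hF : MeasurableSet F) (u : V) :
    inner ℝ (spectralProj Φ F (spectralProj Φ E u)) u = (spectralMeasure Φ u).real (F ∩ E) := by
  rw [inner_spectralProj, spectralPolar, spectralMeasure_spectralProj_add Φ u hE,
    measureReal_add_apply, measureReal_add_apply, measureReal_nnreal_smul_apply,
    measureReal_restrict_apply hF]
  simp only [NNReal.coe_ofNat]
  ring

theorem spectralProj_mul {E F : Set K} (hE : MeasurableSet E) (hF : MeasurableSet F) :
    spectralProj Φ E * spectralProj Φ F = spectralProj Φ (E ∩ F) := by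
  have hcomm := spectralProj_commute Φ (fun f => (spectralProj_commute_map Φ E f).symm) F
  have hsymm : (spectralProj Φ E * spectralProj Φ F - spectralProj Φ (E ∩ F)).IsSymmetric :=
    fun u v => by
      change inner ℝ (spectralProj Φ E (spectralProj Φ F u) - spectralProj Φ (E ∩ F) u) v =
        inner ℝ u (spectralProj Φ E (spectralProj Φ F v) - spectralProj Φ (E ∩ F) v)
      rw [inner_sub_left, inner_sub_right, inner_spectralProj_symm, inner_spectralProj_symm,
        inner_spectralProj_symm]
      exact congrArg (fun w => inner ℝ u w - _) (DFunLike.congr_fun hcomm v)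
  refine sub_eq_zero.1 (ContinuousLinearMap.coe_inj.1 (hsymm.inner_map_self_eq_zero.1 fun u => ?_))
  change inner ℝ (spectralProj Φ E (spectralProj Φ F u) - spectralProj Φ (E ∩ F) u) u = 0
  rw [inner_sub_left, inner_spectralProj_spectralProj_self Φ hF hE, inner_spectralProj_self,
    sub_self]

theorem norm_spectralProj_sq {E : Set K} (hE : MeasurableSet E) (u : V) :
    ‖spectralProj Φ E u‖ ^ 2 = (spectralMeasure Φ u).real E := by
  rw [← real_inner_self_eq_norm_sq, ← inner_spectralProj_symm, ← mul_apply_eq_comp,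
    spectralProj_mul Φ hE hE, Set.inter_self, inner_spectralProj_self]

theorem spectralProj_univ : spectralProj Φ Set.univ = 1 := by
  have hsymm : (spectralProj Φ Set.univ - 1).IsSymmetric := fun u v => by
    change inner ℝ (spectralProj Φ Set.univ u - u) v = inner ℝ u (spectralProj Φ Set.univ v - v)
    rw [inner_sub_left, inner_sub_right, inner_spectralProj_symm]
  refine sub_eq_zero.1 (ContinuousLinearMap.coe_inj.1 (hsymm.inner_map_self_eq_zero.1 fun u => ?_))
  change inner ℝ (spectralProj Φ Set.univ u - u) u = 0
  rw [inner_sub_left, inner_spectralProj_self, measureReal_spectralMeasure_univ,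
    real_inner_self_eq_norm_sq, sub_self]

theorem spectralProj_union {E F : Set K} (hF : MeasurableSet F) (h : Disjoint E F) :
    spectralProj Φ (E ∪ F) = spectralProj Φ E + spectralProj Φ F := by
  ext u
  refine ext_inner_right ℝ fun v => ?_
  rw [add_apply, inner_add_left, inner_spectralProj, inner_spectralProj, inner_spectralProj,
    spectralPolar, spectralPolar, spectralPolar, measureReal_union h hF, measureReal_union h hF,
    measureReal_union h hF]
  ring

theorem spectralProj_empty : spectralProj Φ ∅ = 0 := by
  have h := spectralProj_union Φ MeasurableSet.empty (Set.disjoint_empty ∅)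
  rwa [Set.union_empty, left_eq_add] at h

theorem spectralProj_biUnion_finset {κ : Type*} {G : κ → Set K} (hG : ∀ n, MeasurableSet (G n))
    (hd : Pairwise fun m n => Disjoint (G m) (G n)) (s : Finset κ) :
    spectralProj Φ (⋃ n ∈ s, G n) = ∑ n ∈ s, spectralProj Φ (G n) := by
  classical
  induction s using Finset.induction_on with
  | empty => simp only [Finset.notMem_empty, Set.iUnion_of_empty, Set.iUnion_empty,
      spectralProj_empty, Finset.sum_empty]
  | insert a s ha ih =>
    rw [Finset.sum_insert ha, ← ih, Finset.set_biUnion_insert,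
      spectralProj_union Φ (Finset.measurableSet_biUnion _ fun n _ => hG n)]
    exact Set.disjoint_iUnion₂_right.2 fun n hn => hd fun h => ha (h ▸ hn)

theorem norm_spectralProj_sub_sq {E F : Set K} (hE : MeasurableSet E) (hF : MeasurableSet F)
    (h : F ⊆ E) (u : V) : ‖spectralProj Φ F u - spectralProj Φ E u‖ ^ 2 =
      (spectralMeasure Φ u).real E - (spectralMeasure Φ u).real F := by
  have hsplit : spectralProj Φ E = spectralProj Φ (E \ F) + spectralProj Φ F := by
    rw [← spectralProj_union Φ hF Set.disjoint_sdiff_left, Set.sdiff_union_of_subset h]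
  rw [hsplit, add_apply, sub_add_cancel_right, norm_neg, norm_spectralProj_sq Φ (hE.diff hF),
    measureReal_sdiff h hF]

theorem hasSum_spectralProj {G : ℕ → Set K} (hG : ∀ n, MeasurableSet (G n))
    (hd : Pairwise fun m n => Disjoint (G m) (G n)) (u : V) :
    HasSum (fun n => spectralProj Φ (G n) u) (spectralProj Φ (⋃ n, G n) u) := by
  have hmeasure : HasSum (fun n => (spectralMeasure Φ u).real (G n))
      ((spectralMeasure Φ u).real (⋃ n, G n)) := by
    have hsum := measure_iUnion (μ := spectralMeasure Φ u) hd hG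
    rw [measureReal_def, hsum, ENNReal.tsum_toReal_eq fun n => measure_ne_top _ _]
    exact ENNReal.hasSum_toReal (hsum ▸ measure_ne_top _ _)
  have hdist : ∀ s : Finset ℕ,
      ‖∑ n ∈ s, spectralProj Φ (G n) u - spectralProj Φ (⋃ n, G n) u‖ ^ 2 =
        (spectralMeasure Φ u).real (⋃ n, G n) - ∑ n ∈ s, (spectralMeasure Φ u).real (G n) :=
    fun s => by
      rw [← measureReal_biUnion_finset (fun i _ j _ hij => hd hij) fun n _ => hG n,
        ← norm_spectralProj_sub_sq Φ (.iUnion hG) (Finset.measurableSet_biUnion _ fun n _ => hG n)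
          (Set.iUnion₂_subset fun n _ => Set.subset_iUnion G n),
        spectralProj_biUnion_finset Φ hG hd, sum_apply]
  have hlim := ((hmeasure.const_sub ((spectralMeasure Φ u).real (⋃ n, G n))).sqrt)
  simp only [← hdist, Real.sqrt_sq (norm_nonneg _), sub_self, Real.sqrt_zero] at hlim
  exact tendsto_iff_norm_sub_tendsto_zero.2 hlim

end SpectralMeasure

section Representation

variable {K V : Type*} [TopologicalSpace K] [CompactSpace K] [NormedAddCommGroup V]
  [InnerProductSpace ℝ V] [CompleteSpace V]

theorem norm_starAlgHom_apply_le (Φ : C(K, ℝ) →⋆ₐ[ℝ] (V →L[ℝ] V)) (f : C(K, ℝ)) :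
    ‖Φ f‖ ≤ ‖f‖ := by
  refine ContinuousLinearMap.opNorm_le_bound _ (norm_nonneg f) fun u => ?_
  refine (sq_le_sq₀ (norm_nonneg _) (by positivity)).1 ?_
  have hf : 0 ≤ ‖f‖ ^ 2 • (1 : C(K, ℝ)) - f * f := fun x => by
    have hx := sq_le_sq' (neg_le_of_abs_le (f.norm_coe_le_norm x)) (le_of_abs_le
      (f.norm_coe_le_norm x))
    change 0 ≤ ‖f‖ ^ 2 * 1 - f x * f x
    linarith [sq (f x)]
  have h := inner_map_nonneg Φ hf u
  rw [map_sub, map_smul, map_one, map_mul, sub_apply, inner_sub_right, mul_apply_eq_comp,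
    ← inner_map_symm, real_inner_self_eq_norm_sq, smul_apply,
    one_apply_eq_self, real_inner_smul_right, real_inner_self_eq_norm_sq] at h
  linarith [mul_pow ‖f‖ ‖u‖ 2]

theorem commute_starAlgHom_apply (Φ : C(K, ℝ) →⋆ₐ[ℝ] (V →L[ℝ] V)) {s : Set C(K, ℝ)}
    (hs : (Algebra.adjoin ℝ s).SeparatesPoints) {S : V →L[ℝ] V}
    (h : ∀ g ∈ s, Commute S (Φ g)) (f : C(K, ℝ)) : Commute S (Φ f) := by
  have hcont : Continuous Φ :=
    AddMonoidHomClass.continuous_of_bound Φ 1 fun g => by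
      rw [one_mul]
      exact norm_starAlgHom_apply_le Φ g
  have hclosed : IsClosed {g | Commute S (Φ g)} :=
    isClosed_eq (continuous_const.mul hcont) (hcont.mul continuous_const)
  have hadjoin : ∀ g ∈ Algebra.adjoin ℝ s, Commute S (Φ g) := fun g hg => by
    induction hg using Algebra.adjoin_induction with
    | mem g hg => exact h g hg
    | algebraMap r =>
      rw [AlgHomClass.commutes]
      exact Algebra.commute_algebraMap_right r S
    | add g g' _ _ hg hg' =>
      rw [map_add]
      exact hg.add_right hg'
    | mul g g' _ _ hg hg' =>
      rw [map_mul]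
      exact hg.mul_right hg'
  have hf : f ∈ (Algebra.adjoin ℝ s).topologicalClosure := by
    rw [ContinuousMap.subalgebra_topologicalClosure_eq_top_of_separatesPoints _ hs]
    exact Algebra.mem_top
  exact closure_minimal hadjoin hclosed hf

end Representation

section Calculus

variable {ι : ℍ} {H : Type*} [NormedAddCommGroup H] [Module ℍᵐᵒᵖ H] [QuaternionicInner H]

attribute [local instance] complexInnerSpace InnerProductSpace.complexToReal

/-- A quaternionic operator as a real-linear operator. -/
def toRealOp (T : H →L[ℍᵐᵒᵖ] H) : H →L[ℝ] H := (toComplexOp T).restrictScalars ℝ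

theorem commute_toRealOp {S T : H →L[ℍᵐᵒᵖ] H} (h : Commute S T) :
    Commute (toRealOp S) (toRealOp T) :=
  ContinuousLinearMap.ext fun u => DFunLike.congr_fun h u

/-- Right multiplication by a quaternion, which is only real-linear. -/
def rightMul (p : ℍ) : H →L[ℝ] H where
  toFun u := op p • u
  map_add' u v := smul_add _ u v
  map_smul' c u := (real_smul_op_smul c p u).symm
  cont := continuous_op_smul p

theorem commute_rightMul_toRealOp (p : ℍ) (T : H →L[ℍᵐᵒᵖ] H) :
    Commute (rightMul p) (toRealOp T) :=
  ContinuousLinearMap.ext fun u => (T.map_smul (op p) u).symm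

variable (ι) in
/-- The function `α + ι β ↦ 2 α`, of which `T + T*` is the integral. -/
def twoRe : C(sliceHalfPlane ι, ℝ) := ⟨fun z => 2 * hpRe z, continuous_const.mul continuous_hpRe⟩

variable (ι) in
/-- The function `α + ι β ↦ 2 β`, of which `|T - T*|` is the integral. -/
def twoIm : C(sliceHalfPlane ι, ℝ) := ⟨fun z => 2 * hpIm z, continuous_const.mul continuous_hpIm⟩

theorem eq_of_twoRe_eq_of_twoIm_sq_eq (hι : ι ∈ imUnits) {z w : sliceHalfPlane ι}
    (hre : twoRe ι z = twoRe ι w) (him : (twoIm ι * twoIm ι) z = (twoIm ι * twoIm ι) w) :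
    z = w := by
  have hnonneg : ∀ z : sliceHalfPlane ι, 0 ≤ twoIm ι z := fun z =>
    mul_nonneg zero_le_two (hpIm_nonneg z)
  have him' := (mul_self_inj (hnonneg z) (hnonneg w)).1 him
  exact hp_ext hι (mul_left_cancel₀ two_ne_zero hre) (mul_left_cancel₀ two_ne_zero him')

theorem separatesPoints_adjoin_restrict_twoRe_twoIm_sq (hι : ι ∈ imUnits)
    (s : Set (sliceHalfPlane ι)) :
    (Algebra.adjoin ℝ {(twoRe ι).restrict s,
      (twoIm ι * twoIm ι).restrict s}).SeparatesPoints := by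
  intro z w hzw
  by_contra! hcon
  exact hzw (Subtype.ext (eq_of_twoRe_eq_of_twoIm_sq_eq hι
    (hcon _ ⟨(twoRe ι).restrict s, Algebra.subset_adjoin (Or.inl rfl), rfl⟩)
    (hcon _ ⟨(twoIm ι * twoIm ι).restrict s, Algebra.subset_adjoin (Or.inr rfl), rfl⟩)))

theorem separatesPoints_adjoin_twoRe_twoIm_sq (hι : ι ∈ imUnits) :
    (Algebra.adjoin ℝ {twoRe ι, twoIm ι * twoIm ι}).SeparatesPoints := by
  intro z w hzw
  by_contra! hcon
  exact hzw (eq_of_twoRe_eq_of_twoIm_sq_eq hι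
    (hcon _ ⟨twoRe ι, Algebra.subset_adjoin (Or.inl rfl), rfl⟩)
    (hcon _ ⟨twoIm ι * twoIm ι, Algebra.subset_adjoin (Or.inr rfl), rfl⟩))

/-- A continuous functional calculus for `T` with real functions on a compact part of the
half-plane. A real function of `T` is quaternionic linear, unlike a complex function of the
complex-linear operator underlying `T`. -/
structure SliceCalculus (ι : ℍ) [CompleteSpace H] (T : H →L[ℍᵐᵒᵖ] H) where
  carrier : Set (sliceHalfPlane ι)
  isCompact : IsCompact carrier
  toHom : C(carrier, ℝ) →⋆ₐ[ℝ] (H →L[ℝ] H)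
  map_op_smul : ∀ f (p : ℍ) u, toHom f (op p • u) = op p • toHom f u
  map_twoRe : toHom ((twoRe ι).restrict carrier) = toRealOp (T + qadjoint T)
  map_twoIm_sq : toHom ((twoIm ι * twoIm ι).restrict carrier) =
    -toRealOp ((T - qadjoint T) * (T - qadjoint T))

theorem isStarNormal_toComplexOp [CompleteSpace H] {T : H →L[ℍᵐᵒᵖ] H} (hT : IsNormalOp T) :
    IsStarNormal (toComplexOp T) := by
  refine ⟨?_⟩
  rw [ContinuousLinearMap.star_eq_adjoint, adjoint_toComplexOp]
  exact ContinuousLinearMap.ext fun u => (DFunLike.congr_fun hT u).symm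

/-- Complex-linear operators as real-linear ones. -/
def restrictScalarsHom [CompleteSpace H] : (H →L[ℂ] H) →⋆ₐ[ℝ] (H →L[ℝ] H) where
  toFun S := S.restrictScalars ℝ
  map_one' := rfl
  map_mul' _ _ := rfl
  map_zero' := rfl
  map_add' _ _ := rfl
  commutes' _ := rfl
  map_star' S := by
    refine (ContinuousLinearMap.eq_adjoint_iff _ _).2 fun u v => ?_
    exact congrArg Complex.re (ContinuousLinearMap.adjoint_inner_left S v u)

/-- The image of the spectrum of `a` under `α + i β ↦ α + ι |β|`. -/
def foldedSpectrum (ι : ℍ) (a : H →L[ℂ] H) : Set (sliceHalfPlane ι) :=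
  (fun z : ℂ => hpMk ι z.re z.im) '' spectrum ℂ a

/-- The map `α + i β ↦ α + ι |β|` on the spectrum. -/
def foldSpectrum (ι : ℍ) (a : H →L[ℂ] H) : C(spectrum ℂ a, foldedSpectrum ι a) where
  toFun z := ⟨hpMk ι z.1.re z.1.im, z.1, z.2, rfl⟩
  continuous_toFun := (continuous_hpMk.comp continuous_subtype_val).subtype_mk _

/-- Real functions on the folded spectrum, pulled back to the spectrum. -/
def unfoldHom (ι : ℍ) (a : H →L[ℂ] H) :
    C(foldedSpectrum ι a, ℝ) →⋆ₐ[ℝ] C(spectrum ℂ a, ℂ) :=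
  (ContinuousMap.realToRCLikeStarAlgHom _ ℂ).comp
    (ContinuousMap.compStarAlgHom' ℝ ℝ (foldSpectrum ι a))

theorem unfoldHom_twoRe (hι : ι ∈ imUnits) (a : H →L[ℂ] H) :
    unfoldHom ι a ((twoRe ι).restrict _) =
      (ContinuousMap.id ℂ).restrict _ + star ((ContinuousMap.id ℂ).restrict _) := by
  ext z
  change ((2 * hpRe (hpMk ι z.1.re z.1.im) : ℝ) : ℂ) = z.1 + (starRingEnd ℂ) z.1
  rw [hpRe_hpMk hι, Complex.add_conj]

theorem unfoldHom_twoIm_sq (hι : ι ∈ imUnits) (a : H →L[ℂ] H) :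
    unfoldHom ι a ((twoIm ι * twoIm ι).restrict _) =
      -(((ContinuousMap.id ℂ).restrict _ - star ((ContinuousMap.id ℂ).restrict _)) *
        ((ContinuousMap.id ℂ).restrict _ - star ((ContinuousMap.id ℂ).restrict _))) := by
  ext z
  change ((2 * hpIm (hpMk ι z.1.re z.1.im) * (2 * hpIm (hpMk ι z.1.re z.1.im)) : ℝ) : ℂ) =
    -((z.1 - (starRingEnd ℂ) z.1) * (z.1 - (starRingEnd ℂ) z.1))
  rw [hpIm_hpMk hι, Complex.sub_conj, mul_mul_mul_comm, abs_mul_abs_self]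
  push_cast
  linear_combination 4 * (z.1.im : ℂ) * z.1.im * Complex.I_mul_I

variable [CompleteSpace H]

/-- The real functional calculus of a normal complex operator on its folded spectrum. -/
def foldedHom (ι : ℍ) {a : H →L[ℂ] H} (ha : IsStarNormal a) :
    C(foldedSpectrum ι a, ℝ) →⋆ₐ[ℝ] (H →L[ℝ] H) :=
  restrictScalarsHom.comp (((cfcHom (R := ℂ) ha).restrictScalars ℝ).comp (unfoldHom ι a))

theorem exists_sliceCalculus (hι : ι ∈ imUnits) {T : H →L[ℍᵐᵒᵖ] H} (hT : IsNormalOp T) :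
    Nonempty (SliceCalculus ι T) := by
  have ha := isStarNormal_toComplexOp hT
  have hcompact : IsCompact (foldedSpectrum ι (toComplexOp T)) :=
    (spectrum.isCompact _).image continuous_hpMk
  have : CompactSpace (foldedSpectrum ι (toComplexOp T)) := isCompact_iff_compactSpace.1 hcompact
  have hid : cfcHom (R := ℂ) ha ((ContinuousMap.id ℂ).restrict _) = toComplexOp T := cfcHom_id ha
  have hstar : star (toComplexOp T) = toComplexOp (qadjoint T) := adjoint_toComplexOp T
  have hre : foldedHom ι ha ((twoRe ι).restrict _) = toRealOp (T + qadjoint T) := by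
    change restrictScalarsHom (cfcHom ha (unfoldHom ι _ ((twoRe ι).restrict _))) = _
    rw [unfoldHom_twoRe hι, map_add (cfcHom ha), map_star, hid, hstar]
    rfl
  have him : foldedHom ι ha ((twoIm ι * twoIm ι).restrict _) =
      -toRealOp ((T - qadjoint T) * (T - qadjoint T)) := by
    change restrictScalarsHom (cfcHom ha (unfoldHom ι _ ((twoIm ι * twoIm ι).restrict _))) = _
    rw [unfoldHom_twoIm_sq hι, map_neg (cfcHom ha), map_mul (cfcHom ha), map_sub (cfcHom ha),
      map_star, hid, hstar]
    rfl
  refine ⟨_, hcompact, foldedHom ι ha, fun f p u => ?_, hre, him⟩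
  refine (DFunLike.congr_fun (commute_starAlgHom_apply (foldedHom ι ha)
    (separatesPoints_adjoin_restrict_twoRe_twoIm_sq hι _) (S := rightMul p) ?_ f) u).symm
  rintro g (rfl | rfl)
  · rw [hre]
    exact commute_rightMul_toRealOp p _
  · rw [him]
    exact (commute_rightMul_toRealOp p _).neg_right

namespace SliceCalculus

variable {T : H →L[ℍᵐᵒᵖ] H}

instance (Φ : SliceCalculus ι T) : CompactSpace Φ.carrier :=
  isCompact_iff_compactSpace.1 Φ.isCompact

/-- The function `f(T)`. -/
def qop (Φ : SliceCalculus ι T) : C(sliceHalfPlane ι, ℝ) →+* (H →L[ℍᵐᵒᵖ] H) where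
  toFun f :=
    { toFun := Φ.toHom (f.restrict Φ.carrier)
      map_add' := map_add _
      map_smul' := fun p => Φ.map_op_smul _ p.unop
      cont := (Φ.toHom (f.restrict Φ.carrier)).continuous }
  map_one' := ContinuousLinearMap.ext fun u => DFunLike.congr_fun (map_one Φ.toHom) u
  map_mul' f g := ContinuousLinearMap.ext fun u =>
    DFunLike.congr_fun (map_mul Φ.toHom (f.restrict _) (g.restrict _)) u
  map_zero' := ContinuousLinearMap.ext fun u => DFunLike.congr_fun (map_zero Φ.toHom) u
  map_add' f g := ContinuousLinearMap.ext fun u =>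
    DFunLike.congr_fun (map_add Φ.toHom (f.restrict _) (g.restrict _)) u

theorem qop_twoRe (Φ : SliceCalculus ι T) : Φ.qop (twoRe ι) = T + qadjoint T :=
  ContinuousLinearMap.ext fun u => DFunLike.congr_fun Φ.map_twoRe u

theorem qop_twoIm_sq (Φ : SliceCalculus ι T) :
    Φ.qop (twoIm ι * twoIm ι) = -((T - qadjoint T) * (T - qadjoint T)) :=
  ContinuousLinearMap.ext fun u => DFunLike.congr_fun Φ.map_twoIm_sq u

theorem commute_toHom (hι : ι ∈ imUnits) (Φ : SliceCalculus ι T) {S : H →L[ℍᵐᵒᵖ] H}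
    (h1 : Commute S (T + qadjoint T)) (h2 : Commute S ((T - qadjoint T) * (T - qadjoint T)))
    (f : C(Φ.carrier, ℝ)) : Commute (toRealOp S) (Φ.toHom f) := by
  refine commute_starAlgHom_apply Φ.toHom (separatesPoints_adjoin_restrict_twoRe_twoIm_sq hι _)
    ?_ f
  rintro g (rfl | rfl)
  · rw [Φ.map_twoRe]
    exact commute_toRealOp h1
  · rw [Φ.map_twoIm_sq]
    exact (commute_toRealOp h2).neg_right

theorem commute_qop (hι : ι ∈ imUnits) (Φ : SliceCalculus ι T) {S : H →L[ℍᵐᵒᵖ] H}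
    (h1 : Commute S (T + qadjoint T)) (h2 : Commute S ((T - qadjoint T) * (T - qadjoint T)))
    (f : C(sliceHalfPlane ι, ℝ)) : Commute S (Φ.qop f) :=
  ContinuousLinearMap.ext fun u => DFunLike.congr_fun (Φ.commute_toHom hι h1 h2 (f.restrict _)) u

end SliceCalculus

end Calculus

section QPVMBasic

variable {ι : ℍ} {H : Type*} [NormedAddCommGroup H] [Module ℍᵐᵒᵖ H] [QuaternionicInner H]

attribute [local instance] complexInnerSpace InnerProductSpace.complexToReal

namespace QPVM

variable (P : QPVM ι H) {E F : Set (sliceHalfPlane ι)}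

theorem map_empty : P ∅ = 0 := by
  ext u
  have h := (P.map_iUnion (fun _ => ∅) (fun _ => MeasurableSet.empty)
    (fun _ _ _ => disjoint_bot_left) u).summable
  exact (summable_const_iff _).1 h

theorem map_inter_apply (hE : MeasurableSet E) (hF : MeasurableSet F) (u : H) :
    P E (P F u) = P (E ∩ F) u := by
  rw [← P.map_inter E F hE hF, mul_apply_eq_comp]

theorem map_idem (hE : MeasurableSet E) (u : H) : P E (P E u) = P E u := by
  rw [P.map_inter_apply hE hE, Set.inter_self]

open Classical in
/-- The vector measure `E ↦ P(E) u`. -/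
def vectorMeasure (u : H) : VectorMeasure (sliceHalfPlane ι) H where
  measureOf' E := if MeasurableSet E then P E u else 0
  empty' := by rw [if_pos MeasurableSet.empty, P.map_empty, zero_apply]
  not_measurable' _ hE := if_neg hE
  m_iUnion' G hG hd := by
    simp only [hG, MeasurableSet.iUnion hG, if_true]
    exact P.map_iUnion G hG hd u

theorem vectorMeasure_apply (hE : MeasurableSet E) (u : H) : P.vectorMeasure u E = P E u :=
  if_pos hE

theorem map_union (hE : MeasurableSet E) (hF : MeasurableSet F) (h : Disjoint E F) :
    P (E ∪ F) = P E + P F := by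
  ext u
  rw [add_apply, ← P.vectorMeasure_apply hE, ← P.vectorMeasure_apply hF,
    ← P.vectorMeasure_apply (hE.union hF), VectorMeasure.of_union h hE hF]

theorem map_compl (hE : MeasurableSet E) : P Eᶜ = 1 - P E := by
  rw [eq_sub_iff_add_eq', ← P.map_union hE hE.compl disjoint_compl_right, Set.union_compl_self,
    P.map_univ]

theorem isClosed_supp : IsClosed P.supp :=
  (isOpen_sUnion fun _ hO => hO.1).isClosed_compl

variable [CompleteSpace H]

theorem symm (hE : MeasurableSet E) (u v : H) : qinner (P E u) v = qinner u (P E v) := by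
  conv_lhs => rw [← (P.nonneg E hE).qadjoint_eq]
  rw [qinner_qadjoint]

theorem qinner_apply_self (hE : MeasurableSet E) (u : H) :
    qinner u (P E u) = ((‖P E u‖ ^ 2 : ℝ) : ℍ) := by
  rw [← qinner_self, P.symm hE, P.map_idem hE]

theorem inner_symm (hE : MeasurableSet E) (u v : H) :
    inner ℝ (P E u) v = inner ℝ u (P E v) := by
  rw [real_inner_def, P.symm hE, real_inner_def]

theorem inner_apply_self (hE : MeasurableSet E) (u : H) : inner ℝ u (P E u) = ‖P E u‖ ^ 2 := by
  rw [real_inner_def, P.qinner_apply_self hE, Quaternion.re_coe]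

theorem hasSum_norm_sq {G : ℕ → Set (sliceHalfPlane ι)} (hG : ∀ n, MeasurableSet (G n))
    (hd : Pairwise fun m n => Disjoint (G m) (G n)) (u : H) :
    HasSum (fun n => ‖P (G n) u‖ ^ 2) (‖P (⋃ n, G n) u‖ ^ 2) := by
  have h := (P.map_iUnion G hG hd u).mapL (innerSL ℝ u)
  simp only [innerSL_apply_apply, P.inner_apply_self (hG _),
    P.inner_apply_self (MeasurableSet.iUnion hG)] at h
  exact h

/-- The measure `E ↦ ⟨u|P(E) u⟩`. -/
def measure (u : H) : Measure (sliceHalfPlane ι) :=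
  Measure.ofMeasurable (fun E _ => ENNReal.ofReal (‖P E u‖ ^ 2))
    (by rw [P.map_empty, zero_apply, norm_zero, zero_pow two_ne_zero, ENNReal.ofReal_zero])
    fun G hG hd => by
      rw [← (P.hasSum_norm_sq hG hd u).tsum_eq,
        ENNReal.ofReal_tsum_of_nonneg (fun _ => sq_nonneg _) (P.hasSum_norm_sq hG hd u).summable]

theorem measure_apply (hE : MeasurableSet E) (u : H) :
    P.measure u E = ENNReal.ofReal (‖P E u‖ ^ 2) :=
  Measure.ofMeasurable_apply E hE

theorem measureReal_apply (hE : MeasurableSet E) (u : H) :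
    (P.measure u).real E = ‖P E u‖ ^ 2 := by
  rw [measureReal_def, P.measure_apply hE, ENNReal.toReal_ofReal (sq_nonneg _)]

instance (u : H) : IsFiniteMeasure (P.measure u) :=
  ⟨by rw [P.measure_apply MeasurableSet.univ]; exact ENNReal.ofReal_lt_top⟩

theorem measureReal_univ (u : H) : (P.measure u).real Set.univ = ‖u‖ ^ 2 := by
  rw [P.measureReal_apply MeasurableSet.univ, P.map_univ, one_apply_eq_self]

theorem measure_eq_zero_iff (hE : MeasurableSet E) (u : H) : P.measure u E = 0 ↔ P E u = 0 := by
  rw [P.measure_apply hE, ENNReal.ofReal_eq_zero, sq_nonpos_iff, norm_eq_zero]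

theorem map_compl_supp : P P.suppᶜ = 0 := by
  ext u
  rw [zero_apply, ← P.measure_eq_zero_iff P.isClosed_supp.measurableSet.compl]
  obtain ⟨S, hS, hSc, hSU⟩ := TopologicalSpace.isOpen_sUnion_countable
    {O : Set (sliceHalfPlane ι) | IsOpen O ∧ P O = 0} fun _ hO => hO.1
  rw [supp, compl_compl, ← hSU, measure_sUnion_null_iff hS]
  intro O hO
  rw [P.measure_eq_zero_iff (hSc hO).1.measurableSet, (hSc hO).2, zero_apply]

theorem map_supp : P P.supp = 1 := by
  have hcompl := P.map_compl P.isClosed_supp.measurableSet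
  rw [P.map_compl_supp] at hcompl
  exact (sub_eq_zero.1 hcompl.symm).symm

theorem ae_mem_supp (u : H) : ∀ᵐ x ∂P.measure u, x ∈ P.supp := by
  rw [ae_iff]
  exact (P.measure_eq_zero_iff P.isClosed_supp.measurableSet.compl u).2 (by
    rw [P.map_compl_supp, zero_apply])

theorem map_inter_supp (hE : MeasurableSet E) : P (E ∩ P.supp) = P E := by
  rw [← P.map_inter E _ hE P.isClosed_supp.measurableSet, P.map_supp, mul_one]

theorem ext_of_measure {P P' : QPVM ι H} (h : ∀ u, P.measure u = P'.measure u)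
    (hE : MeasurableSet E) : P E = P' E :=
  ext_of_qform fun u => by
    rw [P.qinner_apply_self hE, P'.qinner_apply_self hE, ← P.measureReal_apply hE,
      ← P'.measureReal_apply hE, h]

end QPVM

end QPVMBasic

section CalculusMeasure

variable {ι : ℍ} {H : Type*} [NormedAddCommGroup H] [Module ℍᵐᵒᵖ H] [QuaternionicInner H]

attribute [local instance] complexInnerSpace InnerProductSpace.complexToReal

theorem qinner_eq_of_inner_eq {x y : H} {S S' : H → H}
    (h : ∀ p : ℍ, inner ℝ x (op p • S y) = inner ℝ (S' x) (op p • y)) :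
    qinner x (S y) = qinner (S' x) y := by
  have hre : ∀ p : ℍ, (qinner x (S y) * p).re = (qinner (S' x) y * p).re := fun p => by
    rw [← qinner_smul_right, ← qinner_smul_right]
    exact h p
  simp only [Quaternion.re_mul] at hre
  ext
  · simpa using hre 1
  · simpa using hre (⟨0, 1, 0, 0⟩ : ℍ[ℝ])
  · simpa using hre (⟨0, 0, 1, 0⟩ : ℍ[ℝ])
  · simpa using hre (⟨0, 0, 0, 1⟩ : ℍ[ℝ])

namespace SliceCalculus

variable [CompleteSpace H] {T : H →L[ℍᵐᵒᵖ] H} (Φ : SliceCalculus ι T)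

theorem spectralProj_op_smul (E : Set Φ.carrier) (p : ℍ) (u : H) :
    spectralProj Φ.toHom E (op p • u) = op p • spectralProj Φ.toHom E u := by
  have hcomm : Commute (spectralProj Φ.toHom E) (rightMul p) :=
    spectralProj_commute Φ.toHom (fun f => ContinuousLinearMap.ext (Φ.map_op_smul f p)) E
  exact DFunLike.congr_fun hcomm u

/-- The spectral projections of the calculus, which are again quaternionic linear. -/
def proj (E : Set (sliceHalfPlane ι)) : H →L[ℍᵐᵒᵖ] H where
  toFun := spectralProj Φ.toHom (Subtype.val ⁻¹' E)
  map_add' := map_add _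
  map_smul' p := Φ.spectralProj_op_smul _ p.unop
  cont := (spectralProj Φ.toHom (Subtype.val ⁻¹' E)).continuous

theorem proj_mul {E F : Set (sliceHalfPlane ι)} (hE : MeasurableSet E) (hF : MeasurableSet F) :
    Φ.proj E * Φ.proj F = Φ.proj (E ∩ F) :=
  ContinuousLinearMap.ext fun u => DFunLike.congr_fun (spectralProj_mul Φ.toHom
    (measurable_subtype_coe hE) (measurable_subtype_coe hF)) u

theorem qinner_proj_comm (E : Set (sliceHalfPlane ι)) (u v : H) :
    qinner u (Φ.proj E v) = qinner (Φ.proj E u) v :=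
  qinner_eq_of_inner_eq fun p => by
    rw [← map_smul]
    exact (inner_spectralProj_symm Φ.toHom _ u (op p • v)).symm

theorem isPositiveOp_proj {E : Set (sliceHalfPlane ι)} (hE : MeasurableSet E) :
    IsPositiveOp (Φ.proj E) := fun u => ⟨‖Φ.proj E u‖ ^ 2, sq_nonneg _, by
  rw [← qinner_self, ← qinner_proj_comm, ← mul_apply_eq_comp (Φ.proj E), Φ.proj_mul hE hE,
    Set.inter_self]⟩

/-- The projection-valued measure of the calculus. -/
def qpvm : QPVM ι H where
  toFun := Φ.proj
  map_univ := ContinuousLinearMap.ext fun u => DFunLike.congr_fun (spectralProj_univ Φ.toHom) u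
  map_inter _ _ := Φ.proj_mul
  map_iUnion G hG hd u := by
    have h := hasSum_spectralProj Φ.toHom (fun n => measurable_subtype_coe (hG n))
      (fun _ _ hmn => (hd hmn).preimage _) u
    rwa [← Set.preimage_iUnion] at h
  nonneg _ := Φ.isPositiveOp_proj

theorem commute_qpvm (hι : ι ∈ imUnits) {S : H →L[ℍᵐᵒᵖ] H}
    (h1 : Commute S (T + qadjoint T)) (h2 : Commute S ((T - qadjoint T) * (T - qadjoint T)))
    (E : Set (sliceHalfPlane ι)) : Commute (Φ.qpvm E) S :=
  ContinuousLinearMap.ext fun u => DFunLike.congr_fun (spectralProj_commute Φ.toHom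
    (fun f => (Φ.commute_toHom hι h1 h2 f).symm) _) u

theorem measure_qpvm (u : H) :
    Φ.qpvm.measure u = (spectralMeasure Φ.toHom u).map Subtype.val := by
  ext E hE
  rw [QPVM.measure_apply _ hE, Measure.map_apply measurable_subtype_coe hE, ← ofReal_measureReal,
    ← norm_spectralProj_sq Φ.toHom (measurable_subtype_coe hE)]
  rfl

theorem ae_mem_carrier (u : H) : ∀ᵐ x ∂Φ.qpvm.measure u, x ∈ Φ.carrier := by
  rw [measure_qpvm]
  exact (ae_map_iff measurable_subtype_coe.aemeasurable
    Φ.isCompact.isClosed.measurableSet).2 (Eventually.of_forall Subtype.prop)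

theorem supp_qpvm_subset : Φ.qpvm.supp ⊆ Φ.carrier := by
  intro x hx
  by_contra hxK
  refine hx ⟨Φ.carrierᶜ, ⟨Φ.isCompact.isClosed.isOpen_compl, ?_⟩, hxK⟩
  ext u
  rw [zero_apply, ← QPVM.measure_eq_zero_iff _ Φ.isCompact.isClosed.measurableSet.compl]
  exact Φ.ae_mem_carrier u

theorem integral_measure_qpvm (u : H) (f : C(sliceHalfPlane ι, ℝ)) :
    ∫ x, f x ∂Φ.qpvm.measure u = inner ℝ u (Φ.qop f u) := by
  rw [measure_qpvm, integral_map measurable_subtype_coe.aemeasurable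
    f.continuous.aestronglyMeasurable]
  exact integral_spectralMeasure Φ.toHom u (f.restrict Φ.carrier)

theorem integrable_measure_qpvm (u : H) (f : C(sliceHalfPlane ι, ℝ)) :
    Integrable f (Φ.qpvm.measure u) := by
  rw [measure_qpvm, integrable_map_measure f.continuous.aestronglyMeasurable
    measurable_subtype_coe.aemeasurable]
  exact integrable_spectralMeasure Φ.toHom u (f.restrict Φ.carrier)

theorem inner_qpvm_qop (u : H) (f : C(sliceHalfPlane ι, ℝ)) {E : Set (sliceHalfPlane ι)}
    (hE : MeasurableSet E) :
    inner ℝ (Φ.qpvm E u) (Φ.qop f u) = ∫ x in E, f x ∂Φ.qpvm.measure u := by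
  rw [measure_qpvm, setIntegral_map hE f.continuous.aestronglyMeasurable
    measurable_subtype_coe.aemeasurable]
  exact inner_spectralProj_map Φ.toHom u (f.restrict Φ.carrier) (measurable_subtype_coe hE)

theorem qinner_qop (f : C(sliceHalfPlane ι, ℝ)) (u v : H) :
    qinner u (Φ.qop f v) = qinner (Φ.qop f u) v :=
  qinner_eq_of_inner_eq fun p => by
    rw [← map_smul]
    exact (inner_map_symm Φ.toHom (f.restrict _) u (op p • v)).symm

theorem inner_qop_symm (f : C(sliceHalfPlane ι, ℝ)) (u v : H) :
    inner ℝ (Φ.qop f u) v = inner ℝ u (Φ.qop f v) :=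
  inner_map_symm Φ.toHom (f.restrict _) u v

end SliceCalculus

end CalculusMeasure

theorem tendstoUniformlyOn_mul_of_norm_le {A X κ : Type*} [SeminormedRing A] {l : Filter κ}
    {F G : κ → X → A} {f g : X → A} {s : Set X} {C D : ℝ} (hF : TendstoUniformlyOn F f l s)
    (hG : TendstoUniformlyOn G g l s) (hf : ∀ x ∈ s, ‖f x‖ ≤ C) (hg : ∀ x ∈ s, ‖g x‖ ≤ D) :
    TendstoUniformlyOn (fun n x => F n x * G n x) (fun x => f x * g x) l s := by
  rw [tendstoUniformlyOn_iff_tendsto, uniformity_eq_comap_nhds_zero, tendsto_comap_iff] at *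
  have hfb : IsBoundedUnder (· ≤ ·) (l ×ˢ 𝓟 s) (norm ∘ fun q : κ × X => f q.2) :=
    isBoundedUnder_of_eventually_le ((eventually_principal.2 hf).prod_inr l)
  have hgb : IsBoundedUnder (· ≤ ·) (l ×ˢ 𝓟 s) (norm ∘ fun q : κ × X => g q.2) :=
    isBoundedUnder_of_eventually_le ((eventually_principal.2 hg).prod_inr l)
  have hlim := ((hF.mul hG).add (by simpa using hF.zero_mul_isBoundedUnder_le hgb)).add
    (isBoundedUnder_le_mul_tendsto_zero hfb hG)
  refine (by simpa using hlim : Tendsto _ _ (𝓝 (0 : A))).congr fun q => ?_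
  simp only [Function.comp_apply]
  noncomm_ring

theorem tendsto_integral_of_tendstoUniformlyOn {X : Type*} [MeasurableSpace X] {μ : Measure X}
    [IsFiniteMeasure μ] {F : ℕ → X → ℝ} {f : X → ℝ} {K : Set X} {C : ℝ}
    (hF : ∀ n, AEStronglyMeasurable (F n) μ) (hFf : TendstoUniformlyOn F f atTop K)
    (hf : ∀ x ∈ K, ‖f x‖ ≤ C) (hμ : ∀ᵐ x ∂μ, x ∈ K) :
    Tendsto (fun n => ∫ x, F n x ∂μ) atTop (𝓝 (∫ x, f x ∂μ)) := by
  refine tendsto_integral_filter_of_norm_le_const (Eventually.of_forall hF) ⟨C + 1, ?_⟩ ?_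
  · filter_upwards [Metric.tendstoUniformlyOn_iff.1 hFf 1 one_pos] with n hn
    filter_upwards [hμ] with x hx
    have hdist := hn x hx
    rw [dist_eq_norm, norm_sub_rev] at hdist
    linarith [norm_le_norm_add_norm_sub' (F n x) (f x), hf x hx]
  · filter_upwards [hμ] with x hx using hFf.tendsto_at hx

theorem quaternion_norm_re_le (q : ℍ) : ‖q.re‖ ≤ ‖q‖ := by
  refine abs_le_of_sq_le_sq ?_ (norm_nonneg _)
  rw [sq ‖q‖, ← Quaternion.normSq_eq_norm_mul_self, Quaternion.normSq_def']
  nlinarith [sq_nonneg q.imI, sq_nonneg q.imJ, sq_nonneg q.imK]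

theorem OpTendsto.tendsto {H : Type*} [NormedAddCommGroup H] [Module ℍᵐᵒᵖ H]
    {S : ℕ → H →L[ℍᵐᵒᵖ] H} {T : H →L[ℍᵐᵒᵖ] H} (h : OpTendsto S T) (u : H) :
    Tendsto (fun n => S n u) atTop (𝓝 (T u)) := by
  refine tendsto_iff_norm_sub_tendsto_zero.2 (Metric.tendsto_atTop'.2 fun ε hε => ?_)
  obtain ⟨N, hN⟩ := eventually_atTop.1 (h (ε / (‖u‖ + 1)) (by positivity))
  refine ⟨N, fun n hn => ?_⟩
  rw [dist_zero_right, norm_norm]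
  calc ‖S n u - T u‖ ≤ ε / (‖u‖ + 1) * ‖u‖ := hN n hn.le u
    _ < ε / (‖u‖ + 1) * (‖u‖ + 1) := by gcongr; exact lt_add_one _
    _ = ε := div_mul_cancel₀ _ (by positivity)

section SimpleIntegral

variable {ι : ℍ} {H : Type*} [NormedAddCommGroup H] [Module ℍᵐᵒᵖ H] [QuaternionicInner H]

attribute [local instance] complexInnerSpace InnerProductSpace.complexToReal

theorem norm_qadjoint_le [CompleteSpace H] {D : H →L[ℍᵐᵒᵖ] H} {c : ℝ}
    (hD : ∀ u, ‖D u‖ ≤ c * ‖u‖) (u : H) : ‖qadjoint D u‖ ≤ c * ‖u‖ := by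
  have hsq : ‖qadjoint D u‖ ^ 2 = inner ℝ u (D (qadjoint D u)) := by
    rw [real_inner_def, ← qinner_qadjoint, qinner_self, Quaternion.re_coe]
  rcases (norm_nonneg (qadjoint D u)).eq_or_lt with hzero | hpos
  · exact hzero ▸ (norm_nonneg _).trans (hD u)
  · refine le_of_mul_le_mul_right ?_ hpos
    calc ‖qadjoint D u‖ * ‖qadjoint D u‖ = inner ℝ u (D (qadjoint D u)) := by rw [← hsq, sq]
      _ ≤ ‖u‖ * (c * ‖qadjoint D u‖) :=
        (real_inner_le_norm _ _).trans (mul_le_mul_of_nonneg_left (hD _) (norm_nonneg u))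
      _ = c * ‖u‖ * ‖qadjoint D u‖ := by ring

theorem OpTendsto.qadjoint [CompleteSpace H] {S : ℕ → H →L[ℍᵐᵒᵖ] H} {T : H →L[ℍᵐᵒᵖ] H}
    (h : OpTendsto S T) : OpTendsto (fun n => qadjoint (S n)) (qadjoint T) := fun ε hε => by
  filter_upwards [h ε hε] with n hn u
  rw [← sub_apply, ← qadjoint_sub]
  exact norm_qadjoint_le hn u

instance : Nonempty (sliceHalfPlane ι) := ⟨hpMk ι 0 0⟩

theorem QPVM.map_preimage_finset (P : QPVM ι H) {α : Type*} (t : SimpleFunc (sliceHalfPlane ι) α)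
    (s : Finset α) : P (t ⁻¹' (s : Set α)) = ∑ a ∈ s, P (t ⁻¹' {a}) := by
  classical
  induction s using Finset.induction_on with
  | empty => simp [P.map_empty]
  | insert a s ha ih =>
    rw [Finset.sum_insert ha, ← ih, Finset.coe_insert, Set.insert_eq, Set.preimage_union,
      P.map_union (t.measurableSet_preimage _) (t.measurableSet_preimage _)]
    refine Disjoint.preimage _ ?_
    simpa using ha

theorem simpleIntegral_map (P : QPVM ι H) (L : ℍ → H →L[ℍᵐᵒᵖ] H) {α : Type*}
    (t : SimpleFunc (sliceHalfPlane ι) α) (g : α → ℍ) :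
    simpleIntegral P L (t.map g) = ∑ a ∈ t.range, L (g a) * P (t ⁻¹' {a}) := by
  classical
  rw [simpleIntegral, SimpleFunc.range_map,
    ← Finset.sum_fiberwise_of_maps_to (t := t.range.image g) (g := g)
      fun a ha => Finset.mem_image_of_mem g ha]
  refine Finset.sum_congr rfl fun q _ => ?_
  rw [SimpleFunc.map_preimage_singleton, P.map_preimage_finset, Finset.mul_sum]
  refine Finset.sum_congr (Finset.filter_congr fun _ _ => Iff.rfl) fun a ha => ?_
  rw [(Finset.mem_filter.1 ha).2]

theorem simpleIntegral_const (P : QPVM ι H) (L : ℍ → H →L[ℍᵐᵒᵖ] H) (q : ℍ) :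
    simpleIntegral P L (SimpleFunc.const _ q) = L q := by
  rw [simpleIntegral, SimpleFunc.range_const, Finset.sum_singleton]
  have hpre : (SimpleFunc.const (sliceHalfPlane ι) q) ⁻¹' {q} = Set.univ := by
    ext x; simp
  rw [hpre, P.map_univ, mul_one]

namespace IsIQPVM

variable {P : QPVM ι H} {L : ℍ → H →L[ℍᵐᵒᵖ] H}

theorem simpleIntegral_add (h : IsIQPVM P L) (s t : SimpleFunc (sliceHalfPlane ι) ℍ) :
    simpleIntegral P L (s + t) = simpleIntegral P L s + simpleIntegral P L t := by
  have hs := simpleIntegral_map P L (s.pair t) Prod.fst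
  have ht := simpleIntegral_map P L (s.pair t) Prod.snd
  have hst := simpleIntegral_map P L (s.pair t) fun x => x.1 + x.2
  rw [SimpleFunc.map_fst_pair] at hs
  rw [SimpleFunc.map_snd_pair] at ht
  rw [hs, ht, ← Finset.sum_add_distrib]
  refine hst.trans (Finset.sum_congr rfl fun a _ => ?_)
  rw [h.leftMul.map_add, add_mul]

theorem simpleIntegral_neg (h : IsIQPVM P L) (s : SimpleFunc (sliceHalfPlane ι) ℍ) :
    simpleIntegral P L (-s) = -simpleIntegral P L s := by
  rw [show -s = s.map fun q => -q from rfl, simpleIntegral_map, simpleIntegral,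
    ← Finset.sum_neg_distrib]
  exact Finset.sum_congr rfl fun a _ => by rw [h.leftMul.map_neg]; rfl

theorem simpleIntegral_sub (h : IsIQPVM P L) (s t : SimpleFunc (sliceHalfPlane ι) ℍ) :
    simpleIntegral P L (s - t) = simpleIntegral P L s - simpleIntegral P L t := by
  rw [sub_eq_add_neg, sub_eq_add_neg, h.simpleIntegral_add, h.simpleIntegral_neg]

theorem simpleIntegral_mul (h : IsIQPVM P L) (s t : SimpleFunc (sliceHalfPlane ι) ℍ) :
    simpleIntegral P L (s * t) = simpleIntegral P L s * simpleIntegral P L t := by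
  have hs := simpleIntegral_map P L (s.pair t) Prod.fst
  have ht := simpleIntegral_map P L (s.pair t) Prod.snd
  have hst := simpleIntegral_map P L (s.pair t) fun x => x.1 * x.2
  rw [SimpleFunc.map_fst_pair] at hs
  rw [SimpleFunc.map_snd_pair] at ht
  rw [hs, ht, Finset.sum_mul]
  refine hst.trans (Finset.sum_congr rfl fun a ha => ?_)
  rw [Finset.mul_sum, Finset.sum_eq_single_of_mem a ha]
  · rw [mul_assoc (L a.1), ← mul_assoc (P _), h.commute _ ((s.pair t).measurableSet_preimage _),
      mul_assoc (L a.2), P.map_inter _ _ ((s.pair t).measurableSet_preimage _)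
        ((s.pair t).measurableSet_preimage _), Set.inter_self, h.leftMul.map_mul, mul_assoc]
  · intro b _ hb
    rw [mul_assoc (L a.1), ← mul_assoc (P _), h.commute _ ((s.pair t).measurableSet_preimage _),
      mul_assoc (L b.2), P.map_inter _ _ ((s.pair t).measurableSet_preimage _)
        ((s.pair t).measurableSet_preimage _), ← Set.preimage_inter,
      Set.singleton_inter_eq_empty.2 (by simpa using hb.symm), Set.preimage_empty, P.map_empty,
      mul_zero, mul_zero]

variable [CompleteSpace H]

theorem qadjoint_simpleIntegral (h : IsIQPVM P L) (s : SimpleFunc (sliceHalfPlane ι) ℍ) :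
    qadjoint (simpleIntegral P L s) = simpleIntegral P L (s.map star) := by
  rw [simpleIntegral_map, simpleIntegral]
  have := map_sum (AddMonoidHom.mk' (qadjoint : (H →L[ℍᵐᵒᵖ] H) → _) qadjoint_add)
    (fun q => L q * P (s ⁻¹' {q})) s.range
  refine this.trans (Finset.sum_congr rfl fun q _ => ?_)
  change qadjoint (L q * P (s ⁻¹' {q})) = _
  rw [qadjoint_mul, h.leftMul.qadjoint_eq_map_star,
    (P.nonneg _ (s.measurableSet_preimage _)).qadjoint_eq, h.commute _ (s.measurableSet_preimage _)]

theorem inner_leftMul_proj (h : IsIQPVM P L) (q : ℍ) {E : Set (sliceHalfPlane ι)}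
    (hE : MeasurableSet E) (u : H) : inner ℝ u (L q (P E u)) = q.re * ‖P E u‖ ^ 2 := by
  have hquad : ∀ w : H, inner ℝ w (L q w) = q.re * ‖w‖ ^ 2 := fun w => by
    have hstar : inner ℝ w (L (star q) w) = inner ℝ w (L q w) := by
      rw [← h.leftMul.qadjoint_eq_map_star, real_inner_def, qinner_qadjoint_right, ← real_inner_def,
        real_inner_comm]
    have hreal : inner ℝ w (L (q + star q) w) = (2 * q.re) * ‖w‖ ^ 2 := by
      rw [Quaternion.self_add_star', h.leftMul.map_coe, real_inner_smul_right,
        real_inner_self_eq_norm_sq]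
    rw [h.leftMul.map_add, add_apply, inner_add_right, hstar] at hreal
    linarith
  rw [← hquad, P.inner_symm hE]
  have hfix : P E (L q (P E u)) = L q (P E u) := by
    rw [← mul_apply_eq_comp (P E), h.commute E hE, mul_apply_eq_comp, P.map_idem hE]
  rw [hfix]

theorem inner_simpleIntegral (h : IsIQPVM P L) (s : SimpleFunc (sliceHalfPlane ι) ℍ) (u : H) :
    inner ℝ u (simpleIntegral P L s u) = ∫ x, (s x).re ∂P.measure u := by
  have hI : Integrable (s.map fun q => q.re) (P.measure u) :=
    SimpleFunc.integrable_of_isFiniteMeasure _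
  have hint : ∫ x, (s x).re ∂P.measure u = (s.map fun q => q.re).integral (P.measure u) := by
    rw [SimpleFunc.integral_eq_integral _ hI]; rfl
  have hIs : Integrable s (P.measure u) := SimpleFunc.integrable_of_isFiniteMeasure _
  rw [hint, SimpleFunc.map_integral _ _ hIs (by simp), simpleIntegral, sum_apply, inner_sum]
  refine Finset.sum_congr rfl fun q _ => ?_
  rw [mul_apply_eq_comp, h.inner_leftMul_proj q (s.measurableSet_preimage _),
    P.measureReal_apply (s.measurableSet_preimage _), smul_eq_mul, mul_comm]

theorem norm_simpleIntegral_sq (h : IsIQPVM P L) (s : SimpleFunc (sliceHalfPlane ι) ℍ) (u : H) :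
    ‖simpleIntegral P L s u‖ ^ 2 = ∫ x, ‖s x‖ ^ 2 ∂P.measure u := by
  have hmul := h.inner_simpleIntegral (s.map star * s) u
  rw [h.simpleIntegral_mul, mul_apply_eq_comp, ← h.qadjoint_simpleIntegral, real_inner_def,
    qinner_qadjoint_right, qinner_self, Quaternion.re_coe] at hmul
  rw [hmul]
  refine integral_congr_ae (Eventually.of_forall fun x => ?_)
  simp only [SimpleFunc.coe_mul, SimpleFunc.coe_map, Pi.mul_apply, Function.comp_apply,
    Quaternion.star_mul_self, Quaternion.re_coe, Quaternion.normSq_eq_norm_mul_self, sq]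

theorem norm_simpleIntegral_le (h : IsIQPVM P L) {s : SimpleFunc (sliceHalfPlane ι) ℍ} {c : ℝ}
    (hc : 0 ≤ c) (hs : ∀ x ∈ P.supp, ‖s x‖ ≤ c) (u : H) :
    ‖simpleIntegral P L s u‖ ≤ c * ‖u‖ := by
  refine (sq_le_sq₀ (norm_nonneg _) (by positivity)).1 ?_
  rw [h.norm_simpleIntegral_sq, mul_pow, ← P.measureReal_univ]
  have hI : Integrable (s.map fun q => ‖q‖ ^ 2) (P.measure u) :=
    SimpleFunc.integrable_of_isFiniteMeasure _
  calc ∫ x, ‖s x‖ ^ 2 ∂P.measure u ≤ ∫ _x, c ^ 2 ∂P.measure u := by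
        refine integral_mono_ae hI (integrable_const _) ?_
        filter_upwards [P.ae_mem_supp u] with x hx
        exact pow_le_pow_left₀ (norm_nonneg _) (hs x hx) 2
    _ = _ := by simp [mul_comm]

end IsIQPVM

/-- `S` is the integral of `ψ` in the sense of some approximating sequence of simple functions. In
contrast to `HasIQIntegral`, nothing is asked of `ψ` outside the support, and the integrals are
only required to converge strongly. -/
def IsSliceIntegral (P : QPVM ι H) (L : ℍ → H →L[ℍᵐᵒᵖ] H) (ψ : sliceHalfPlane ι → ℍ)
    (S : H →L[ℍᵐᵒᵖ] H) : Prop :=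
  ∃ s : ℕ → SimpleFunc (sliceHalfPlane ι) ℍ,
    TendstoUniformlyOn (fun n => ⇑(s n)) ψ atTop P.supp ∧
      ∀ u, Tendsto (fun n => simpleIntegral P L (s n) u) atTop (𝓝 (S u))

namespace IsSliceIntegral

variable {P : QPVM ι H} {L : ℍ → H →L[ℍᵐᵒᵖ] H} {ψ φ : sliceHalfPlane ι → ℍ}
  {S R : H →L[ℍᵐᵒᵖ] H}

theorem exists_bound (hS : IsSliceIntegral P L ψ S) : ∃ C : ℝ, ∀ x ∈ P.supp, ‖ψ x‖ ≤ C := by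
  obtain ⟨s, hs, -⟩ := hS
  obtain ⟨n, hn⟩ := (Metric.tendstoUniformlyOn_iff.1 hs 1 one_pos).exists
  obtain ⟨C, hC⟩ := (s n).exists_forall_norm_le
  refine ⟨1 + C, fun x hx => ?_⟩
  rw [← dist_zero_right]
  exact (dist_triangle _ (s n x) _).trans
    (add_le_add (hn x hx).le ((dist_zero_right _).trans_le (hC x)))

theorem congr (hS : IsSliceIntegral P L ψ S) (h : Set.EqOn ψ φ P.supp) :
    IsSliceIntegral P L φ S := by
  obtain ⟨s, hs, hlim⟩ := hS
  exact ⟨s, hs.congr_right h, hlim⟩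

theorem const (P : QPVM ι H) (L : ℍ → H →L[ℍᵐᵒᵖ] H) (q : ℍ) :
    IsSliceIntegral P L (fun _ => q) (L q) := by
  refine ⟨fun _ => SimpleFunc.const _ q, ?_, fun u => ?_⟩
  · exact Metric.tendstoUniformlyOn_iff.2 fun ε hε => Eventually.of_forall fun _ _ _ => by
      simpa using hε
  · simp only [simpleIntegral_const, tendsto_const_nhds]

theorem add (h : IsIQPVM P L) (hS : IsSliceIntegral P L ψ S) (hR : IsSliceIntegral P L φ R) :
    IsSliceIntegral P L (fun x => ψ x + φ x) (S + R) := by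
  obtain ⟨s, hs, hslim⟩ := hS
  obtain ⟨t, ht, htlim⟩ := hR
  refine ⟨fun n => s n + t n, hs.add ht, fun u => ?_⟩
  simp only [h.simpleIntegral_add, add_apply]
  exact (hslim u).add (htlim u)

theorem neg (h : IsIQPVM P L) (hS : IsSliceIntegral P L ψ S) :
    IsSliceIntegral P L (fun x => -ψ x) (-S) := by
  obtain ⟨s, hs, hlim⟩ := hS
  refine ⟨fun n => -s n, hs.neg, fun u => ?_⟩
  simp only [h.simpleIntegral_neg, neg_apply]
  exact (hlim u).neg

theorem sub (h : IsIQPVM P L) (hS : IsSliceIntegral P L ψ S) (hR : IsSliceIntegral P L φ R) :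
    IsSliceIntegral P L (fun x => ψ x - φ x) (S - R) := by
  simp only [sub_eq_add_neg]
  exact hS.add h (hR.neg h)

variable [CompleteSpace H]

theorem mul (h : IsIQPVM P L) (hS : IsSliceIntegral P L ψ S) (hR : IsSliceIntegral P L φ R) :
    IsSliceIntegral P L (fun x => ψ x * φ x) (S * R) := by
  obtain ⟨C, hC⟩ := hS.exists_bound
  obtain ⟨D, hD⟩ := hR.exists_bound
  obtain ⟨s, hs, hslim⟩ := hS
  obtain ⟨t, ht, htlim⟩ := hR
  refine ⟨fun n => s n * t n, tendstoUniformlyOn_mul_of_norm_le hs ht hC hD, fun u => ?_⟩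
  simp only [h.simpleIntegral_mul, mul_apply_eq_comp]
  have hbound : ∀ᶠ n in atTop, ∀ v, ‖simpleIntegral P L (s n) v‖ ≤ (|C| + 1) * ‖v‖ := by
    filter_upwards [Metric.tendstoUniformlyOn_iff.1 hs 1 one_pos] with n hn
    refine h.norm_simpleIntegral_le (by positivity) fun x hx => ?_
    have hdist := hn x hx
    rw [dist_eq_norm, norm_sub_rev] at hdist
    linarith [norm_le_norm_add_norm_sub' (s n x) (ψ x), hC x hx, le_abs_self C]
  have hzero : Tendsto (fun n => simpleIntegral P L (s n) (simpleIntegral P L (t n) u - R u)) atTop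
      (𝓝 0) := by
    refine squeeze_zero_norm' (hbound.mono fun n hn => hn _) ?_
    simpa using (tendsto_iff_norm_sub_tendsto_zero.1 (htlim u)).const_mul (|C| + 1)
  simpa using hzero.add (hslim (R u))

theorem norm_simpleIntegral_sub_le (h : IsIQPVM P L) (hS : IsSliceIntegral P L ψ S)
    {t : SimpleFunc (sliceHalfPlane ι) ℍ} {c : ℝ} (hc : 0 ≤ c)
    (ht : ∀ x ∈ P.supp, ‖t x - ψ x‖ ≤ c) (u : H) :
    ‖simpleIntegral P L t u - S u‖ ≤ c * ‖u‖ := by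
  obtain ⟨s, hs, hlim⟩ := hS
  have hδ : ∀ δ > 0, ‖simpleIntegral P L t u - S u‖ ≤ (c + δ) * ‖u‖ := fun δ hδ => by
    refine le_of_tendsto (tendsto_const_nhds.sub (hlim u)).norm ?_
    filter_upwards [Metric.tendstoUniformlyOn_iff.1 hs δ hδ] with n hn
    rw [← sub_apply, ← h.simpleIntegral_sub]
    refine h.norm_simpleIntegral_le (by positivity) (fun x hx => ?_) u
    have hdist := hn x hx
    rw [dist_eq_norm] at hdist
    rw [SimpleFunc.coe_sub, Pi.sub_apply, ← sub_add_sub_cancel _ (ψ x)]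
    exact (norm_add_le _ _).trans (add_le_add (ht x hx) hdist.le)
  have hcont : Tendsto (fun δ : ℝ => (c + δ) * ‖u‖) (𝓝[>] 0) (𝓝 (c * ‖u‖)) :=
    (Continuous.tendsto' (by fun_prop) _ _ (by simp)).mono_left nhdsWithin_le_nhds
  exact ge_of_tendsto hcont (eventually_mem_nhdsWithin.mono hδ)

theorem opTendsto (h : IsIQPVM P L) (hS : IsSliceIntegral P L ψ S)
    {s : ℕ → SimpleFunc (sliceHalfPlane ι) ℍ}
    (hs : TendstoUniformlyOn (fun n => ⇑(s n)) ψ atTop P.supp) :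
    OpTendsto (fun n => simpleIntegral P L (s n)) S := fun ε hε => by
  filter_upwards [Metric.tendstoUniformlyOn_iff.1 hs ε hε] with n hn
  exact hS.norm_simpleIntegral_sub_le h hε.le fun x hx => by
    rw [norm_sub_rev, ← dist_eq_norm]
    exact (hn x hx).le

theorem unique (h : IsIQPVM P L) (hS : IsSliceIntegral P L ψ S) (hR : IsSliceIntegral P L ψ R) :
    S = R := by
  obtain ⟨s, hs, hlim⟩ := hS
  ext u
  exact tendsto_nhds_unique (hlim u) ((hR.opTendsto h hs).tendsto u)

theorem qadjoint (h : IsIQPVM P L) (hS : IsSliceIntegral P L ψ S) :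
    IsSliceIntegral P L (fun x => star (ψ x)) (qadjoint S) := by
  obtain ⟨s, hs, -⟩ := id hS
  refine ⟨fun n => (s n).map star, ?_, ?_⟩
  · refine Metric.tendstoUniformlyOn_iff.2 fun ε hε => ?_
    simpa only [SimpleFunc.map_apply, dist_eq_norm, ← star_sub, Quaternion.norm_star] using
      Metric.tendstoUniformlyOn_iff.1 hs ε hε
  · simp only [← h.qadjoint_simpleIntegral]
    exact (hS.opTendsto h hs).qadjoint.tendsto

theorem inner_eq (h : IsIQPVM P L) (hS : IsSliceIntegral P L ψ S) (u : H) :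
    inner ℝ u (S u) = ∫ x, (ψ x).re ∂P.measure u := by
  obtain ⟨C, hC⟩ := hS.exists_bound
  obtain ⟨s, hs, hlim⟩ := hS
  refine tendsto_nhds_unique (tendsto_const_nhds.inner (hlim u)) ?_
  simp only [h.inner_simpleIntegral]
  refine tendsto_integral_of_tendstoUniformlyOn
    (fun n => ((s n).map fun q : ℍ => q.re).measurable.aestronglyMeasurable)
    (Metric.tendstoUniformlyOn_iff.2 fun ε hε => ?_)
    (fun x hx => (quaternion_norm_re_le _).trans (hC x hx)) (P.ae_mem_supp u)
  filter_upwards [Metric.tendstoUniformlyOn_iff.1 hs ε hε] with n hn x hx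
  have hdist := hn x hx
  rw [dist_eq_norm] at hdist ⊢
  exact (quaternion_norm_re_le (ψ x - s n x)).trans_lt hdist

theorem norm_sq_eq (h : IsIQPVM P L) (hS : IsSliceIntegral P L ψ S) (u : H) :
    ‖S u‖ ^ 2 = ∫ x, ‖ψ x‖ ^ 2 ∂P.measure u := by
  have hstar := ((hS.qadjoint h).mul h hS).inner_eq h u
  rw [mul_apply_eq_comp, real_inner_def, qinner_qadjoint_right, qinner_self,
    Quaternion.re_coe] at hstar
  rw [hstar]
  refine integral_congr_ae (Eventually.of_forall fun x => ?_)
  simp only [Quaternion.star_mul_self, Quaternion.re_coe, Quaternion.normSq_eq_norm_mul_self, sq]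

theorem qinner_eq (h : IsIQPVM P L) {f : sliceHalfPlane ι → ℝ}
    (hS : IsSliceIntegral P L (fun x => (f x : ℍ)) S) (u : H) :
    qinner u (S u) = ((∫ x, f x ∂P.measure u : ℝ) : ℍ) := by
  have hself : _root_.qadjoint S = S :=
    unique h ((hS.qadjoint h).congr fun x _ => Quaternion.star_coe (f x)) hS
  have hstar : star (qinner u (S u)) = qinner u (S u) := by
    rw [star_qinner, ← qinner_qadjoint_right, hself]
  have hre := hS.inner_eq h u
  rw [real_inner_def] at hre
  rw [quaternion_eq_coe_re hstar, hre]
  simp only [Quaternion.re_coe]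

theorem hasIQIntegral (h : IsIQPVM P L) (hS : IsSliceIntegral P L ψ S) (hψ : Measurable ψ) :
    HasIQIntegral P L ψ S := by
  have hmeas := P.isClosed_supp.measurableSet
  refine ⟨hS.exists_bound, hψ.indicator hmeas, ?_, fun s hs => ?_⟩
  · obtain ⟨s, hs, -⟩ := hS
    refine ⟨fun n => (s n).restrict P.supp, Metric.tendstoUniformly_iff.2 fun ε hε => ?_⟩
    filter_upwards [Metric.tendstoUniformlyOn_iff.1 hs ε hε] with n hn x
    rw [SimpleFunc.restrict_apply _ hmeas]
    by_cases hx : x ∈ P.supp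
    · simpa only [Set.indicator_of_mem hx] using hn x hx
    · simpa only [Set.indicator_of_notMem hx, dist_self] using hε
  · exact hS.opTendsto h
      (hs.tendstoUniformlyOn.congr_right fun x hx => Set.indicator_of_mem hx ψ)

end IsSliceIntegral

theorem HasIQIntegral.isSliceIntegral {P : QPVM ι H} {L : ℍ → H →L[ℍᵐᵒᵖ] H}
    {ψ : sliceHalfPlane ι → ℍ} {S : H →L[ℍᵐᵒᵖ] H} (hS : HasIQIntegral P L ψ S) :
    IsSliceIntegral P L ψ S := by
  obtain ⟨s, hs⟩ := hS.exists_approx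
  exact ⟨s, hs.tendstoUniformlyOn.congr_right fun x hx => Set.indicator_of_mem hx ψ,
    (hS.tendsto s hs).tendsto⟩

end SimpleIntegral

section Approximation

theorem tendstoUniformlyOn_nearestPt_denseSeq {Y : Type*} [PseudoMetricSpace Y]
    [TopologicalSpace.SeparableSpace Y] [Nonempty Y] [MeasurableSpace Y] [OpensMeasurableSpace Y]
    {K : Set Y} (hK : IsCompact K) :
    TendstoUniformlyOn (fun N => ⇑(SimpleFunc.nearestPt (TopologicalSpace.denseSeq Y) N)) id
      atTop K := by
  refine Metric.tendstoUniformlyOn_iff.2 fun ε hε => ?_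
  obtain ⟨t, ht⟩ := hK.elim_finite_subcover
    (fun k => Metric.ball (TopologicalSpace.denseSeq Y k) ε) (fun _ => Metric.isOpen_ball)
    fun y _ => by
      obtain ⟨k, hk⟩ := (TopologicalSpace.denseRange_denseSeq Y).exists_dist_lt y hε
      exact Set.mem_iUnion.2 ⟨k, hk⟩
  filter_upwards [eventually_ge_atTop (t.sup id)] with N hN y hy
  obtain ⟨k, hkt, hk⟩ := Set.mem_iUnion₂.1 (ht hy)
  have hle := SimpleFunc.edist_nearestPt_le (TopologicalSpace.denseSeq Y) y
    ((Finset.le_sup (f := id) hkt).trans hN)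
  rw [edist_dist, edist_dist, ENNReal.ofReal_le_ofReal_iff dist_nonneg] at hle
  rw [id, dist_comm]
  exact hle.trans_lt ((dist_comm _ _).trans_lt hk)

theorem exists_seq_simpleFunc_tendstoUniformlyOn {X Y : Type*} [TopologicalSpace X]
    [MeasurableSpace X] [OpensMeasurableSpace X] [PseudoMetricSpace Y]
    [TopologicalSpace.SeparableSpace Y] [Nonempty Y] [MeasurableSpace Y] [BorelSpace Y]
    (f : C(X, Y)) {K : Set X} (hK : IsCompact K) :
    ∃ s : ℕ → SimpleFunc X Y, TendstoUniformlyOn (fun n => ⇑(s n)) f atTop K :=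
  ⟨fun n => (SimpleFunc.nearestPt (TopologicalSpace.denseSeq Y) n).comp f f.continuous.measurable,
    ((tendstoUniformlyOn_nearestPt_denseSeq (hK.image f.continuous)).comp f).mono
      (Set.subset_preimage_image f K)⟩

theorem integral_simpleFunc_mul {X : Type*} [MeasurableSpace X] {μ : Measure X}
    (s : SimpleFunc X ℝ) {f : X → ℝ} (hf : Integrable f μ) :
    ∫ x, s x * f x ∂μ = ∑ a ∈ s.range, a * ∫ x in s ⁻¹' {a}, f x ∂μ := by
  have hsum : ∀ x, s x * f x = ∑ a ∈ s.range, (s ⁻¹' {a}).indicator (fun x => a * f x) x :=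
    fun x => by
      rw [Finset.sum_eq_single_of_mem (s x) (s.mem_range_self x)]
      · rw [Set.indicator_of_mem (by simp)]
      · intro b _ hb
        exact Set.indicator_of_notMem (by simpa using hb.symm) _
  simp only [hsum]
  rw [integral_finsetSum _ fun a _ => (hf.const_mul a).indicator (s.measurableSet_preimage _)]
  refine Finset.sum_congr rfl fun a _ => ?_
  rw [integral_indicator (s.measurableSet_preimage _), integral_const_mul]

/-- Unlike in the versions of Mathlib, the functions of the subalgebra may be unbounded off the
compact set carrying both measures. -/
theorem measure_ext_of_integral_eq_on_subalgebra {X : Type*} [TopologicalSpace X]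
    [MeasurableSpace X] [BorelSpace X] [HasOuterApproxClosed X] {μ ν : Measure X}
    [IsFiniteMeasure μ] [IsFiniteMeasure ν] {A : Subalgebra ℝ C(X, ℝ)} (hA : A.SeparatesPoints)
    {K : Set X} (hK : IsCompact K) (hμ : ∀ᵐ x ∂μ, x ∈ K) (hν : ∀ᵐ x ∂ν, x ∈ K)
    (h : ∀ g ∈ A, ∫ x, g x ∂μ = ∫ x, g x ∂ν) : μ = ν := by
  refine ext_of_forall_integral_eq_of_IsFiniteMeasure fun f => ?_
  choose g hgA hg using fun n : ℕ =>
    ContinuousMap.exists_mem_subalgebra_near_continuous_of_isCompact_of_separatesPoints hA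
      f.toContinuousMap hK (Nat.one_div_pos_of_nat (α := ℝ) (n := n))
  have hgf : TendstoUniformlyOn (fun n => ⇑(g n)) f atTop K :=
    Metric.tendstoUniformlyOn_iff.2 fun ε hε => by
      filter_upwards [tendsto_one_div_add_atTop_nhds_zero_nat.eventually_lt_const hε] with n hn x hx
      rw [dist_comm, dist_eq_norm]
      exact (hg n x hx).trans hn
  have hlim : ∀ (ρ : Measure X) [IsFiniteMeasure ρ], (∀ᵐ x ∂ρ, x ∈ K) →
      Tendsto (fun n => ∫ x, g n x ∂ρ) atTop (𝓝 (∫ x, f x ∂ρ)) := fun ρ _ =>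
    tendsto_integral_of_tendstoUniformlyOn (fun n => (g n).continuous.aestronglyMeasurable) hgf
      fun x _ => f.norm_coe_le_norm x
  exact tendsto_nhds_unique (hlim μ hμ) ((hlim ν hν).congr fun n => (h _ (hgA n)).symm)

end Approximation

section CalculusIntegral

variable {ι : ℍ} {H : Type*} [NormedAddCommGroup H] [Module ℍᵐᵒᵖ H] [QuaternionicInner H]

attribute [local instance] complexInnerSpace InnerProductSpace.complexToReal

namespace SliceCalculus

variable [CompleteSpace H] {T : H →L[ℍᵐᵒᵖ] H} (Φ : SliceCalculus ι T) {L : ℍ → H →L[ℍᵐᵒᵖ] H}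

theorem inner_simpleIntegral_qop (h : IsIQPVM Φ.qpvm L) (f : C(sliceHalfPlane ι, ℝ))
    (s : SimpleFunc (sliceHalfPlane ι) ℝ) (u : H) :
    inner ℝ (simpleIntegral Φ.qpvm L (s.map fun r : ℝ => (r : ℍ)) u) (Φ.qop f u) =
      ∫ x, s x * f x ∂Φ.qpvm.measure u := by
  rw [integral_simpleFunc_mul s (Φ.integrable_measure_qpvm u f), simpleIntegral_map, sum_apply,
    sum_inner]
  refine Finset.sum_congr rfl fun a _ => ?_
  rw [mul_apply_eq_comp, h.leftMul.map_coe, real_inner_smul_left,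
    Φ.inner_qpvm_qop u f (s.measurableSet_preimage _)]

theorem norm_simpleIntegral_sub_qop_sq (h : IsIQPVM Φ.qpvm L) (f : C(sliceHalfPlane ι, ℝ))
    (s : SimpleFunc (sliceHalfPlane ι) ℝ) (u : H) :
    ‖simpleIntegral Φ.qpvm L (s.map fun r : ℝ => (r : ℍ)) u - Φ.qop f u‖ ^ 2 =
      ∫ x, (s x - f x) ^ 2 ∂Φ.qpvm.measure u := by
  have hs : ‖simpleIntegral Φ.qpvm L (s.map fun r : ℝ => (r : ℍ)) u‖ ^ 2 =
      ∫ x, s x * s x ∂Φ.qpvm.measure u := by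
    rw [h.norm_simpleIntegral_sq]
    simp only [SimpleFunc.coe_map, Function.comp_apply, Quaternion.norm_coe, Real.norm_eq_abs,
      sq_abs, ← sq]
  have hf : ‖Φ.qop f u‖ ^ 2 = ∫ x, f x * f x ∂Φ.qpvm.measure u := by
    have hint := Φ.integral_measure_qpvm u (f * f)
    rw [map_mul, mul_apply_eq_comp, ← Φ.inner_qop_symm, real_inner_self_eq_norm_sq] at hint
    exact hint.symm
  have hss : Integrable (fun x => s x * s x) (Φ.qpvm.measure u) :=
    (s.map fun r => r * r).integrable_of_isFiniteMeasure
  have hff : Integrable (fun x => f x * f x) (Φ.qpvm.measure u) :=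
    Φ.integrable_measure_qpvm u (f * f)
  obtain ⟨c, hc⟩ := s.exists_forall_norm_le
  have hsf : Integrable (fun x => s x * f x) (Φ.qpvm.measure u) :=
    (Φ.integrable_measure_qpvm u f).bdd_mul s.measurable.aestronglyMeasurable
      (Eventually.of_forall hc)
  rw [norm_sub_sq_real, hs, hf, Φ.inner_simpleIntegral_qop h, ← integral_const_mul,
    ← integral_sub hss (hsf.const_mul 2),
    ← integral_add (f := fun x => s x * s x - 2 * (s x * f x)) (hss.sub (hsf.const_mul 2)) hff]
  refine integral_congr_ae (Eventually.of_forall fun x => ?_)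
  ring

theorem isSliceIntegral_qop (h : IsIQPVM Φ.qpvm L) (f : C(sliceHalfPlane ι, ℝ)) :
    IsSliceIntegral Φ.qpvm L (fun x => (f x : ℍ)) (Φ.qop f) := by
  obtain ⟨s, hs⟩ := exists_seq_simpleFunc_tendstoUniformlyOn f Φ.isCompact
  have hsf := Metric.tendstoUniformlyOn_iff.1 hs
  refine ⟨fun n => (s n).map fun r : ℝ => (r : ℍ), ?_, fun u => ?_⟩
  · refine Metric.tendstoUniformlyOn_iff.2 fun ε hε => ?_
    filter_upwards [hsf ε hε] with n hn x hx
    rw [SimpleFunc.map_apply, dist_eq_norm, ← Quaternion.coe_sub, Quaternion.norm_coe,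
      ← dist_eq_norm]
    exact hn x (Φ.supp_qpvm_subset hx)
  · have hzero : TendstoUniformlyOn (fun n x => (s n x - f x) ^ 2) 0 atTop Φ.carrier := by
      refine Metric.tendstoUniformlyOn_iff.2 fun ε hε => ?_
      filter_upwards [hsf (√ε) (Real.sqrt_pos.2 hε)] with n hn x hx
      rw [Pi.zero_apply, dist_zero_left, norm_pow, norm_sub_rev, ← dist_eq_norm]
      exact (Real.lt_sqrt dist_nonneg).1 (hn x hx)
    have hlim : Tendsto (fun n => ∫ x, (s n x - f x) ^ 2 ∂Φ.qpvm.measure u) atTop (𝓝 0) := by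
      simpa using tendsto_integral_of_tendstoUniformlyOn (C := 0) (fun n =>
        (((s n).measurable.sub f.continuous.measurable).pow_const 2).aestronglyMeasurable) hzero
        (fun _ _ => norm_zero.le) (Φ.ae_mem_carrier u)
    simp only [← Φ.norm_simpleIntegral_sub_qop_sq h] at hlim
    refine tendsto_iff_norm_sub_tendsto_zero.2 ?_
    simpa only [Real.sqrt_sq (norm_nonneg _), Real.sqrt_zero] using hlim.sqrt

end SliceCalculus

end CalculusIntegral

section HalfPlaneFunctions

variable {ι : ℍ}

theorem coe_add_star (z : sliceHalfPlane ι) :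
    (z : ℍ) + star (z : ℍ) = (twoRe ι z : ℍ) := by
  rw [Quaternion.self_add_star']; rfl

theorem star_coe_eq_hpRe_sub (hι : ι ∈ imUnits) (z : sliceHalfPlane ι) :
    star (z : ℍ) = (hpRe z : ℍ) - ι * (hpIm z : ℍ) := by
  rw [coe_eq_hpRe_add hι z, star_add, star_mul, Quaternion.star_coe, Quaternion.star_coe,
    star_of_mem_imUnits hι, mul_neg, Quaternion.coe_commutes, ← sub_eq_add_neg]

theorem coe_sub_star (hι : ι ∈ imUnits) (z : sliceHalfPlane ι) :
    (z : ℍ) - star (z : ℍ) = ι * (twoIm ι z : ℍ) := by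
  have htwo : twoIm ι z = hpIm z + hpIm z := two_mul (hpIm z)
  rw [htwo, star_coe_eq_hpRe_sub hι, coe_eq_hpRe_add hι z, Quaternion.coe_add, mul_add]
  abel

theorem commute_coe (hι : ι ∈ imUnits) (z : sliceHalfPlane ι) : ι * (z : ℍ) = z * ι := by
  rw [coe_eq_hpRe_add hι z, mul_add, add_mul, ← Quaternion.coe_commutes, mul_assoc,
    Quaternion.coe_commutes (hpIm z)]

theorem anticommute_coe (hι : ι ∈ imUnits) {j : ℍ} (hj : ι * j = -(j * ι))
    (z : sliceHalfPlane ι) : j * (z : ℍ) = star (z : ℍ) * j := by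
  have hj' : j * ι = -(ι * j) := by rw [hj, neg_neg]
  rw [star_coe_eq_hpRe_sub hι, coe_eq_hpRe_add hι z, mul_add, sub_mul, ← mul_assoc, hj', neg_mul,
    mul_assoc ι j, mul_assoc ι _ j, Quaternion.coe_commutes (hpRe z),
    Quaternion.coe_commutes (hpIm z), sub_eq_add_neg]

theorem isClosed_sliceHalfPlane (hι : ι ∈ imUnits) : IsClosed (sliceHalfPlane ι) := by
  have hset : sliceHalfPlane ι = {q : ℍ | q = (q.re : ℍ) + ι * ((‖q.im‖ : ℝ) : ℍ)} :=
    Set.ext fun q => ⟨fun hq => coe_eq_hpRe_add hι ⟨q, hq⟩,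
      fun hq => ⟨q.re, ‖q.im‖, norm_nonneg _, hq⟩⟩
  rw [hset]
  exact isClosed_eq continuous_id
    ((Quaternion.continuous_coe.comp Quaternion.continuous_re).add
      (continuous_const.mul (Quaternion.continuous_coe.comp Quaternion.continuous_im.norm)))

theorem isCompact_setOf_norm_le (hι : ι ∈ imUnits) (R : ℝ) :
    IsCompact {z : sliceHalfPlane ι | ‖(z : ℍ)‖ ≤ R} := by
  have : ProperSpace ℍ := FiniteDimensional.proper_real ℍ
  have hpre := (isClosed_sliceHalfPlane hι).isClosedEmbedding_subtypeVal.isCompact_preimage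
    (isCompact_closedBall (0 : ℍ) R)
  convert hpre using 1
  ext z
  simp

end HalfPlaneFunctions

section Uniqueness

variable {ι : ℍ} {H : Type*} [NormedAddCommGroup H] [Module ℍᵐᵒᵖ H] [QuaternionicInner H]
  [CompleteSpace H] {T : H →L[ℍᵐᵒᵖ] H} {P : QPVM ι H} {L : ℍ → H →L[ℍᵐᵒᵖ] H}

namespace IsSliceIntegral

theorem add_qadjoint (h : IsIQPVM P L) (hT : IsSliceIntegral P L (fun z => (z : ℍ)) T) :
    IsSliceIntegral P L (fun z => (twoRe ι z : ℍ)) (T + _root_.qadjoint T) :=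
  (hT.add h (hT.qadjoint h)).congr fun z _ => coe_add_star z

theorem neg_leftMul_mul (h : IsIQPVM P L) (hι : ι ∈ imUnits)
    (hT : IsSliceIntegral P L (fun z => (z : ℍ)) T) :
    IsSliceIntegral P L (fun z => (twoIm ι z : ℍ)) (-(L ι * (T - _root_.qadjoint T))) :=
  (((IsSliceIntegral.const P L ι).mul h (hT.sub h (hT.qadjoint h))).neg h).congr fun z _ => by
    beta_reduce
    rw [coe_sub_star hι, ← mul_assoc, show ι * ι = -1 from hι, neg_mul, one_mul, neg_neg]

theorem neg_sub_qadjoint_sq (h : IsIQPVM P L) (hι : ι ∈ imUnits)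
    (hT : IsSliceIntegral P L (fun z => (z : ℍ)) T) :
    IsSliceIntegral P L (fun z => ((twoIm ι * twoIm ι) z : ℍ))
      (-((T - _root_.qadjoint T) * (T - _root_.qadjoint T))) := by
  have hD := hT.sub h (hT.qadjoint h)
  refine ((hD.mul h hD).neg h).congr fun z _ => ?_
  beta_reduce
  rw [coe_sub_star hι, mul_assoc ι, ← mul_assoc _ ι, Quaternion.coe_commutes, mul_assoc ι,
    ← mul_assoc ι ι, show ι * ι = -1 from hι, neg_mul, one_mul, neg_neg, ContinuousMap.mul_apply,
    Quaternion.coe_mul]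

theorem qop_of_mem_adjoin (h : IsIQPVM P L) (hι : ι ∈ imUnits) (Φ : SliceCalculus ι T)
    (hT : IsSliceIntegral P L (fun z => (z : ℍ)) T) {g : C(sliceHalfPlane ι, ℝ)}
    (hg : g ∈ Algebra.adjoin ℝ {twoRe ι, twoIm ι * twoIm ι}) :
    IsSliceIntegral P L (fun z => (g z : ℍ)) (Φ.qop g) := by
  induction hg using Algebra.adjoin_induction with
  | mem g hg =>
    rcases hg with rfl | rfl
    · rw [Φ.qop_twoRe]
      exact hT.add_qadjoint h
    · rw [Φ.qop_twoIm_sq]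
      exact hT.neg_sub_qadjoint_sq h hι
  | algebraMap r =>
    have hqop : Φ.qop (algebraMap ℝ _ r) = L (r : ℍ) := by
      ext u
      rw [h.leftMul.map_coe]
      exact DFunLike.congr_fun (AlgHomClass.commutes Φ.toHom r) u
    rw [hqop]
    exact (IsSliceIntegral.const P L (r : ℍ)).congr fun z _ => by
      rw [_root_.algebraMap_apply, smul_eq_mul, mul_one]
  | add f g _ _ hf hg =>
    rw [map_add]
    exact (hf.add h hg).congr fun z _ => by rw [ContinuousMap.add_apply, Quaternion.coe_add]
  | mul f g _ _ hf hg =>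
    rw [map_mul]
    exact (hf.mul h hg).congr fun z _ => by rw [ContinuousMap.mul_apply, Quaternion.coe_mul]

theorem measure_eq (h : IsIQPVM P L) (hι : ι ∈ imUnits) (Φ : SliceCalculus ι T)
    (hT : IsSliceIntegral P L (fun z => (z : ℍ)) T) (u : H) :
    P.measure u = Φ.qpvm.measure u := by
  obtain ⟨R, hR⟩ := hT.exists_bound
  refine measure_ext_of_integral_eq_on_subalgebra (separatesPoints_adjoin_twoRe_twoIm_sq hι)
    (Φ.isCompact.union (isCompact_setOf_norm_le hι R)) ?_ ?_ fun g hg => ?_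
  · exact (P.ae_mem_supp u).mono fun x hx => Or.inr (hR x hx)
  · exact (Φ.ae_mem_carrier u).mono fun x hx => Or.inl hx
  · have hinner := (hT.qop_of_mem_adjoin h hι Φ hg).inner_eq h u
    simp only [Quaternion.re_coe] at hinner
    rw [Φ.integral_measure_qpvm, hinner]

end IsSliceIntegral

end Uniqueness

section ImUnit

variable {ι : ℍ}

theorem mul_self_cancel_imUnits (hι : ι ∈ imUnits) (q : ℍ) : ι * (ι * q) = -q := by
  rw [← mul_assoc, show ι * ι = -1 from hι, neg_mul, one_mul]

theorem mem_slicePlane_of_commute (hι : ι ∈ imUnits) {p : ℍ} (hp : Commute ι p) :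
    p ∈ slicePlane ι := by
  have hstar : star p.im = -p.im := Quaternion.star_im p
  have hcomm : ι * p.im = p.im * ι := by
    rw [← Quaternion.sub_re_self, mul_sub, sub_mul, hp.eq, Quaternion.coe_commutes]
  have hreal : ι * p.im = ((ι * p.im).re : ℍ) := quaternion_eq_coe_re (by
    rw [star_mul, hstar, star_of_mem_imUnits hι, neg_mul_neg, hcomm])
  refine ⟨p.re, -(ι * p.im).re, ?_⟩
  rw [Quaternion.coe_neg, ← hreal, mul_neg, mul_self_cancel_imUnits hι, neg_neg,
    Quaternion.re_add_im]

theorem exists_slicePlane_decomposition (hι : ι ∈ imUnits) {j : ℍ} (hj : j ∈ imUnits)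
    (hιj : ι * j = -(j * ι)) (q : ℍ) :
    ∃ a ∈ slicePlane ι, ∃ b ∈ slicePlane ι, q = a + b * j := by
  have hhalf : ∀ x : ℍ, Commute ι x → Commute ι ((1 / 2 : ℝ) • x) := fun x hx => by
    rw [Commute, SemiconjBy, mul_smul_comm, smul_mul_assoc, hx.eq]
  have hleft : ι * (ι * q * ι) = -(q * ι) := by
    rw [mul_assoc ι q, mul_self_cancel_imUnits hι]
  have hright : ι * q * ι * ι = -(ι * q) := by
    rw [mul_assoc, show ι * ι = -1 from hι, mul_neg_one]
  have hanti : ι * (q + ι * q * ι) = -((q + ι * q * ι) * ι) := by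
    rw [mul_add, add_mul, hleft, hright]
    abel
  refine ⟨(1 / 2 : ℝ) • (q - ι * q * ι), mem_slicePlane_of_commute hι (hhalf _ ?_),
    (1 / 2 : ℝ) • -((q + ι * q * ι) * j), mem_slicePlane_of_commute hι (hhalf _ ?_), ?_⟩
  · rw [Commute, SemiconjBy, mul_sub, sub_mul, hleft, hright]
    abel
  · rw [Commute, SemiconjBy, mul_neg, neg_mul, ← mul_assoc, hanti, neg_mul, mul_assoc _ ι j,
      hιj, mul_neg, mul_assoc _ j ι, neg_neg]
  · rw [smul_mul_assoc, neg_mul, mul_assoc _ j j, show j * j = -1 from hj, mul_neg_one, neg_neg,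
      ← smul_add, sub_add_add_cancel, ← two_smul ℝ, smul_smul, one_div,
      inv_mul_cancel₀ two_ne_zero, one_smul]

theorem exists_mul_ne_mul (hι : ι ∈ imUnits) : ∃ p : ℍ, ι * p ≠ p * ι := by
  by_contra! hcentral
  simp only [Quaternion.ext_iff, Quaternion.re_mul, Quaternion.imI_mul, Quaternion.imJ_mul,
    Quaternion.imK_mul] at hcentral
  obtain ⟨-, -, hJ, hK⟩ := hcentral ⟨0, 1, 0, 0⟩
  obtain ⟨-, -, -, hI⟩ := hcentral ⟨0, 0, 1, 0⟩
  simp only [mul_zero, mul_one, zero_mul, add_zero, zero_add, sub_zero, zero_sub, one_mul]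
    at hI hJ hK
  have hzero : ι = 0 := by
    ext
    · exact re_of_mem_imUnits hι
    all_goals simp only [Quaternion.imI_zero, Quaternion.imJ_zero, Quaternion.imK_zero]; linarith
  have hnorm := norm_of_mem_imUnits hι
  rw [hzero, norm_zero] at hnorm
  exact zero_ne_one hnorm

theorem exists_anticommuting (hι : ι ∈ imUnits) : ∃ j ∈ imUnits, ι * j = -(j * ι) := by
  obtain ⟨p, hp⟩ := exists_mul_ne_mul hι
  set w := ι * p - p * ι with hw
  have hanti : ι * w = -(w * ι) := by
    rw [hw, mul_sub, sub_mul, mul_self_cancel_imUnits hι, mul_assoc p, show ι * ι = -1 from hι,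
      mul_assoc ι p ι, mul_neg_one]
    abel
  have hre : w.re = 0 := by
    rw [hw, Quaternion.re_sub, Quaternion.re_mul, Quaternion.re_mul]
    ring
  have hsq : w * w = ((-(‖w‖ * ‖w‖) : ℝ) : ℍ) := by
    have hnormSq := Quaternion.self_mul_star w
    rw [Quaternion.star_eq_neg.2 hre, mul_neg, Quaternion.normSq_eq_norm_mul_self] at hnormSq
    rw [Quaternion.coe_neg, ← hnormSq, neg_neg]
  have hnorm : ‖w‖ ≠ 0 := norm_ne_zero_iff.2 (sub_ne_zero.2 hp)
  refine ⟨‖w‖⁻¹ • w, ?_, ?_⟩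
  · change ‖w‖⁻¹ • w * ‖w‖⁻¹ • w = -1
    rw [smul_mul_smul_comm, hsq, Quaternion.smul_coe, ← Quaternion.coe_one, ← Quaternion.coe_neg]
    congr 1
    field_simp
  · rw [mul_smul_comm, smul_mul_assoc, hanti, smul_neg]

end ImUnit

section SquareRoot

variable {H : Type*} [NormedAddCommGroup H] [Module ℍᵐᵒᵖ H] [QuaternionicInner H]

attribute [local instance] complexInnerSpace InnerProductSpace.complexToReal

theorem IsPositiveOp.toComplexOp_nonneg {B : H →L[ℍᵐᵒᵖ] H} (hB : IsPositiveOp B) :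
    0 ≤ toComplexOp B := by
  rw [ContinuousLinearMap.nonneg_iff_isPositive, ContinuousLinearMap.isPositive_iff_complex]
  intro u
  obtain ⟨r, hr, hBu⟩ := hB u
  have hinner : inner ℂ (toComplexOp B u) u = (r : ℂ) := by
    rw [complex_inner_def, toComplexOp_apply, ← star_qinner, hBu, Quaternion.star_coe]
    rfl
  rw [hinner]
  exact ⟨rfl, hr⟩

theorem IsPositiveOp.eq_of_mul_self_eq [CompleteSpace H] {A B : H →L[ℍᵐᵒᵖ] H} (hA : IsPositiveOp A)
    (hB : IsPositiveOp B) (h : A * A = B * B) : A = B := by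
  have hcomplex : toComplexOp A = toComplexOp B :=
    (CFC.mul_self_eq_mul_self_iff _ _ hA.toComplexOp_nonneg hB.toComplexOp_nonneg).1
      (congrArg toComplexOp h)
  exact ContinuousLinearMap.ext fun u => DFunLike.congr_fun hcomplex u

end SquareRoot

section RealSubspace

variable {H : Type*} [NormedAddCommGroup H] [Module ℍᵐᵒᵖ H] [QuaternionicInner H]

attribute [local instance] complexInnerSpace InnerProductSpace.complexToReal

theorem exists_isHilbertBasis_subset (V : Submodule ℝ H) [CompleteSpace V]
    (hreal : ∀ u ∈ V, ∀ v ∈ V, qinner u v = ((inner ℝ u v : ℝ) : ℍ))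
    (hperp : qperp (V : Set H) = {0}) : ∃ N ⊆ (V : Set H), IsHilbertBasis N := by
  obtain ⟨w, b, hb⟩ := exists_hilbertBasis ℝ V
  refine ⟨Subtype.val '' w, Subtype.coe_image_subset _ w, ?_, ?_, ?_⟩
  · rintro _ ⟨x, hx, rfl⟩
    have hnorm := b.orthonormal.1 ⟨x, hx⟩
    rw [hb] at hnorm
    exact hnorm
  · rintro _ ⟨x, hx, rfl⟩ _ ⟨y, hy, rfl⟩ hxy
    have horth := b.orthonormal.2 (i := ⟨x, hx⟩) (j := ⟨y, hy⟩) fun h => hxy (by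
      rw [Subtype.mk.inj h])
    rw [hb] at horth
    rw [hreal _ x.2 _ y.2, ← Quaternion.coe_zero]
    exact congrArg _ horth
  · rw [← hperp]
    refine Set.Subset.antisymm (fun u hu z hz => ?_) fun u hu z hz => ?_
    · have hsum := hasSum_qinner_right u ((b.hasSum_repr ⟨z, hz⟩).mapL V.subtypeL)
      refine hsum.unique (hasSum_zero.congr_fun fun i => ?_)
      change qinner u (((b.repr ⟨z, hz⟩ i) • b i : V) : H) = 0
      rw [hb, Submodule.coe_smul, qinner_real_smul_right, hu _ ⟨i, i.2, rfl⟩, mul_zero]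
    · obtain ⟨x, -, rfl⟩ := hz
      exact hu _ x.2

theorem IsHilbertBasis.leftMul_eq_op_smul [CompleteSpace H] {N : Set H} (hN : IsHilbertBasis N)
    {u : H} (hu : ∀ z ∈ N, star (qinner z u) = qinner z u) (q : ℍ) :
    hN.leftMul q u = op q • u :=
  hN.ext_of_qinner fun z hz => by
    rw [hN.qinner_eq_of_hasSum (hN.hasSum_leftMul q u) hz, qinner_smul_right,
      quaternion_eq_coe_re (hu z hz), Quaternion.coe_commutes]

end RealSubspace

section AdaptedVectors

variable {ι : ℍ} {H : Type*} [NormedAddCommGroup H] [Module ℍᵐᵒᵖ H] [QuaternionicInner H]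

attribute [local instance] complexInnerSpace InnerProductSpace.complexToReal

variable [CompleteSpace H] {T : H →L[ℍᵐᵒᵖ] H}

theorem IsNormalOp.commute_sub_add (hT : IsNormalOp T) :
    Commute (T - qadjoint T) (T + qadjoint T) := by
  have hcomm : Commute T (qadjoint T) := hT
  exact ((Commute.refl T).add_right hcomm).sub_left (hcomm.symm.add_right (Commute.refl _))

namespace SliceCalculus

variable (Φ : SliceCalculus ι T)

theorem commute_sub_qop (hι : ι ∈ imUnits) (hT : IsNormalOp T) (f : C(sliceHalfPlane ι, ℝ)) :
    Commute (T - qadjoint T) (Φ.qop f) :=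
  Φ.commute_qop hι hT.commute_sub_add ((Commute.refl _).mul_right (Commute.refl _)) f

/-- `T - T*` acts on `u` as `|T - T*|` followed by right multiplication with `ι`. -/
def IsAdapted (u : H) : Prop := (T - qadjoint T) u = op ι • Φ.qop (twoIm ι) u

variable {Φ}

theorem IsAdapted.add {u v : H} (hu : Φ.IsAdapted u) (hv : Φ.IsAdapted v) :
    Φ.IsAdapted (u + v) := by
  rw [IsAdapted, map_add, map_add, smul_add, hu, hv]

theorem IsAdapted.real_smul (c : ℝ) {u : H} (hu : Φ.IsAdapted u) : Φ.IsAdapted (c • u) := by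
  rw [IsAdapted, qop_map_real_smul, qop_map_real_smul, ← real_smul_op_smul, hu]

theorem IsAdapted.map (hι : ι ∈ imUnits) (hT : IsNormalOp T) (f : C(sliceHalfPlane ι, ℝ)) {u : H}
    (hu : Φ.IsAdapted u) : Φ.IsAdapted (Φ.qop f u) := by
  have hcomm : Commute (Φ.qop (twoIm ι)) (Φ.qop f) := (Commute.all _ f).map Φ.qop
  calc (T - qadjoint T) (Φ.qop f u) = Φ.qop f ((T - qadjoint T) u) :=
        DFunLike.congr_fun (Φ.commute_sub_qop hι hT f) u
    _ = op ι • Φ.qop f (Φ.qop (twoIm ι) u) := by rw [hu, map_smul]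
    _ = op ι • Φ.qop (twoIm ι) (Φ.qop f u) := congrArg _ (DFunLike.congr_fun hcomm u).symm

variable (Φ)

theorem isClosed_isAdapted : IsClosed {u | Φ.IsAdapted u} :=
  isClosed_eq (T - qadjoint T).continuous
    ((continuous_op_smul ι).comp (Φ.qop (twoIm ι)).continuous)

theorem isAdapted_twoIm_sub_smul (hι : ι ∈ imUnits) (hT : IsNormalOp T) (v : H) :
    Φ.IsAdapted (Φ.qop (twoIm ι) v - op ι • (T - qadjoint T) v) := by
  have hcomm : (T - qadjoint T) (Φ.qop (twoIm ι) v) = Φ.qop (twoIm ι) ((T - qadjoint T) v) :=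
    DFunLike.congr_fun (Φ.commute_sub_qop hι hT (twoIm ι)) v
  have hsq : Φ.qop (twoIm ι) (Φ.qop (twoIm ι) v) = -(T - qadjoint T) ((T - qadjoint T) v) :=
    DFunLike.congr_fun ((map_mul Φ.qop (twoIm ι) (twoIm ι)).symm.trans Φ.qop_twoIm_sq) v
  rw [IsAdapted, map_sub, map_sub, map_smul, map_smul, hsq, hcomm, smul_sub, smul_smul, ← op_mul,
    show ι * ι = -1 from hι, op_neg, op_one, neg_one_smul, smul_neg]
  abel

/-- Sets of adapted vectors on which all matrix entries of the calculus are real. -/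
structure IsRealSet (S : Set H) : Prop where
  adapted : ∀ u ∈ S, Φ.IsAdapted u
  real : ∀ u ∈ S, ∀ v ∈ S, ∀ f, star (qinner u (Φ.qop f v)) = qinner u (Φ.qop f v)

theorem exists_maximal_isRealSet : ∃ S : Set H, Maximal Φ.IsRealSet S := by
  refine zorn_subset {S | Φ.IsRealSet S} fun c hc hchain => ⟨⋃₀ c, ⟨?_, ?_⟩, fun s hs =>
    Set.subset_sUnion_of_mem hs⟩
  · rintro u ⟨s, hs, hu⟩
    exact (hc hs).adapted u hu
  · rintro u ⟨s, hs, hu⟩ v ⟨t, ht, hv⟩ f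
    rcases hchain.total hs ht with hst | hts
    · exact (hc ht).real u (hst hu) v hv f
    · exact (hc hs).real u hu v (hts hv) f

section Maximal

variable {Φ} {S : Set H} (hS : Maximal Φ.IsRealSet S)

include hS

theorem mem_of_maximal {w : H} (hw : Φ.IsAdapted w)
    (hreal : ∀ u ∈ S, ∀ f, star (qinner u (Φ.qop f w)) = qinner u (Φ.qop f w)) : w ∈ S := by
  have hinsert : Φ.IsRealSet (insert w S) := by
    refine ⟨?_, ?_⟩
    · rintro u (rfl | hu)
      · exact hw
      · exact hS.prop.adapted u hu
    · rintro u (rfl | hu) v (rfl | hv) f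
      · rw [star_qinner, qinner_qop]
      · rw [qinner_qop, star_qinner, ← hreal v hv f, star_qinner]
      · exact hreal u hu f
      · exact hS.prop.real u hu v hv f
  exact hS.le_of_ge hinsert (Set.subset_insert w S) (Set.mem_insert w S)

theorem map_mem_of_maximal (hι : ι ∈ imUnits) (hT : IsNormalOp T) (f : C(sliceHalfPlane ι, ℝ))
    {u : H} (hu : u ∈ S) : Φ.qop f u ∈ S :=
  mem_of_maximal hS ((hS.prop.adapted u hu).map hι hT f) fun v hv g => by
    have hmul : Φ.qop g (Φ.qop f u) = Φ.qop (g * f) u :=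
      DFunLike.congr_fun (map_mul Φ.qop g f).symm u
    rw [hmul]
    exact hS.prop.real v hv u hu _

omit hS in
/-- A maximal real set is a real subspace. -/
def subspaceOfMaximal (hS : Maximal Φ.IsRealSet S) : Submodule ℝ H where
  carrier := S
  add_mem' {u v} hu hv := mem_of_maximal hS ((hS.prop.adapted u hu).add (hS.prop.adapted v hv))
    fun w hw f => by
      rw [map_add, qinner_add_right, star_add, hS.prop.real w hw u hu, hS.prop.real w hw v hv]
  zero_mem' := mem_of_maximal hS (by rw [IsAdapted, map_zero, map_zero, smul_zero])
    fun w _ f => by rw [map_zero, qinner_zero_right, star_zero]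
  smul_mem' c u hu := mem_of_maximal hS ((hS.prop.adapted u hu).real_smul c) fun w hw f => by
    rw [qop_map_real_smul, qinner_real_smul_right, star_mul, hS.prop.real w hw u hu,
      Quaternion.star_coe, Quaternion.coe_commutes]

theorem isClosed_of_maximal : IsClosed S := by
  rw [← closure_subset_iff_isClosed]
  intro w hw
  refine mem_of_maximal hS (closure_minimal hS.prop.adapted Φ.isClosed_isAdapted hw)
    fun u hu f => ?_
  have hcont : Continuous fun w => qinner u (Φ.qop f w) :=
    (continuous_qinner_right u).comp (Φ.qop f).continuous
  have hclosed : IsClosed {w | star (qinner u (Φ.qop f w)) = qinner u (Φ.qop f w)} :=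
    isClosed_eq (continuous_star.comp hcont) hcont
  exact closure_minimal (fun v hv => hS.prop.real u hu v hv f) hclosed hw

theorem map_mem_qperp_of_maximal (hι : ι ∈ imUnits) (hT : IsNormalOp T)
    (f : C(sliceHalfPlane ι, ℝ)) {w : H} (hw : w ∈ qperp S) : Φ.qop f w ∈ qperp S :=
  fun z hz => by
    rw [← qinner_qop]
    exact hw _ (map_mem_of_maximal hS hι hT f hz)

theorem eq_zero_of_mem_qperp_of_isAdapted (hι : ι ∈ imUnits) (hT : IsNormalOp T) {w : H}
    (hw : w ∈ qperp S) (hwA : Φ.IsAdapted w) : w = 0 := by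
  refine eq_zero_of_qinner_self_eq_zero (hw w (mem_of_maximal hS hwA fun u hu f => ?_))
  rw [← star_qinner, map_mem_qperp_of_maximal hS hι hT f hw u hu, star_zero, star_zero]

theorem sub_qadjoint_mem_qperp_of_maximal (hι : ι ∈ imUnits) (hT : IsNormalOp T) {w : H}
    (hw : w ∈ qperp S) : (T - qadjoint T) w ∈ qperp S := fun z hz => by
  rw [← qinner_qadjoint_right, qadjoint_sub_qadjoint, neg_apply, qinner_neg_right,
    hS.prop.adapted z hz, qinner_smul_right, hw _ (map_mem_of_maximal hS hι hT _ hz), zero_mul,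
    neg_zero]

theorem twoIm_eq_smul_of_mem_qperp (hι : ι ∈ imUnits) (hT : IsNormalOp T) {v : H}
    (hv : v ∈ qperp S) : Φ.qop (twoIm ι) v = op ι • (T - qadjoint T) v := by
  refine sub_eq_zero.1 (eq_zero_of_mem_qperp_of_isAdapted hS hι hT (fun z hz => ?_)
    (Φ.isAdapted_twoIm_sub_smul hι hT v))
  rw [qinner_sub_left, map_mem_qperp_of_maximal hS hι hT _ hv z hz, qinner_smul_left,
    sub_qadjoint_mem_qperp_of_maximal hS hι hT hv z hz, mul_zero, sub_zero]

-- On `qperp S`, a right submodule, `|T - T*| = op ι • (T - T*)`; as the left side commutes with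
-- right multiplications and `ι` is not central, `T - T*` vanishes there.
theorem qperp_of_maximal (hι : ι ∈ imUnits) (hT : IsNormalOp T) : qperp S = {0} := by
  refine Set.eq_singleton_iff_unique_mem.2 ⟨fun z _ => qinner_zero_left z, fun v hv => ?_⟩
  obtain ⟨p, hp⟩ := exists_mul_ne_mul hι
  have hvp : op p • v ∈ qperp S := fun z hz => by rw [qinner_smul_left, hv z hz, mul_zero]
  have hker : (T - qadjoint T) v = 0 := by
    have hsmul := twoIm_eq_smul_of_mem_qperp hS hι hT hvp
    rw [map_smul, map_smul, twoIm_eq_smul_of_mem_qperp hS hι hT hv, smul_smul, smul_smul,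
      ← op_mul, ← op_mul, ← sub_eq_zero, ← sub_smul, ← op_sub, ← norm_eq_zero, norm_op_smul,
      mul_eq_zero, norm_eq_zero, norm_eq_zero] at hsmul
    exact hsmul.resolve_left (sub_ne_zero.2 hp)
  refine eq_zero_of_mem_qperp_of_isAdapted hS hι hT hv ?_
  rw [IsAdapted, twoIm_eq_smul_of_mem_qperp hS hι hT hv, hker, smul_zero, smul_zero]

end Maximal

theorem isIQPVM_of_commute (hι : ι ∈ imUnits) {L : ℍ → H →L[ℍᵐᵒᵖ] H} (hL : IsLeftScalarMul L)
    (hadd : ∀ q, Commute (L q) (T + qadjoint T))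
    (hsub : ∀ q, Commute (L q) ((T - qadjoint T) * (T - qadjoint T))) : IsIQPVM Φ.qpvm L :=
  ⟨hL, fun E _ q => Φ.commute_qpvm hι (hadd q) (hsub q) E⟩

theorem exists_adapted_leftMul (hι : ι ∈ imUnits) (hT : IsNormalOp T) :
    ∃ L : ℍ → H →L[ℍᵐᵒᵖ] H, IsIQPVM Φ.qpvm L ∧ L ι * Φ.qop (twoIm ι) = T - qadjoint T := by
  obtain ⟨S, hS⟩ := Φ.exists_maximal_isRealSet
  have : CompleteSpace (subspaceOfMaximal hS) := (isClosed_of_maximal hS).completeSpace_coe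
  have hreal : ∀ u ∈ S, ∀ v ∈ S, star (qinner u v) = qinner u v := fun u hu v hv => by
    have hone := hS.prop.real u hu v hv 1
    rwa [map_one, one_apply_eq_self] at hone
  obtain ⟨N, hNS, hN⟩ := exists_isHilbertBasis_subset (subspaceOfMaximal hS)
    (fun u hu v hv => quaternion_eq_coe_re (hreal u hu v hv)) (qperp_of_maximal hS hι hT)
  have hmul : ∀ q, ∀ u ∈ S, hN.leftMul q u = op q • u := fun q u hu =>
    hN.leftMul_eq_op_smul (fun z hz => hreal z (hNS hz) u hu) q
  have hmap : ∀ q f, ∀ z ∈ N, hN.leftMul q (Φ.qop f z) = op q • Φ.qop f z := fun q f z hz =>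
    hmul q _ (map_mem_of_maximal hS hι hT f (hNS hz))
  have hcomm : ∀ q f, Commute (hN.leftMul q) (Φ.qop f) := fun q f => hN.eq_of_eqOn fun z hz => by
    rw [mul_apply_eq_comp, mul_apply_eq_comp, hmap q f z hz, hmul q z (hNS hz), map_smul]
  refine ⟨hN.leftMul, Φ.isIQPVM_of_commute hι hN.isLeftScalarMul (fun q => ?_) fun q => ?_, ?_⟩
  · rw [← Φ.qop_twoRe]
    exact hcomm q _
  · rw [← Commute.neg_right_iff, ← Φ.qop_twoIm_sq]
    exact hcomm q _
  · refine hN.eq_of_eqOn fun z hz => ?_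
    rw [mul_apply_eq_comp, hmap ι _ z hz, hS.prop.adapted z (hNS hz)]

end SliceCalculus

end AdaptedVectors

section LeftMultiplication

variable {ι : ℍ} {H : Type*} [NormedAddCommGroup H] [Module ℍᵐᵒᵖ H] [QuaternionicInner H]
  {L : ℍ → H →L[ℍᵐᵒᵖ] H} {T : H →L[ℍᵐᵒᵖ] H}

attribute [local instance] complexInnerSpace InnerProductSpace.complexToReal

namespace IsLeftScalarMul

theorem mul_self_of_mem_imUnits (hL : IsLeftScalarMul L) {k : ℍ} (hk : k ∈ imUnits) :
    L k * L k = -1 := by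
  rw [← hL.map_mul, show k * k = -1 from hk, hL.map_neg, hL.map_one]

theorem commute_of_commute_imUnits (hL : IsLeftScalarMul L) (hι : ι ∈ imUnits) {j : ℍ}
    (hj : j ∈ imUnits) (hιj : ι * j = -(j * ι)) {A : H →L[ℍᵐᵒᵖ] H} (hAι : Commute (L ι) A)
    (hAj : Commute (L j) A) (q : ℍ) : Commute (L q) A := by
  have hreal : ∀ r : ℝ, Commute (L (r : ℍ)) A := fun r => by
    ext u
    simp only [mul_apply_eq_comp, hL.map_coe, qop_map_real_smul]
  have hplane : ∀ a ∈ slicePlane ι, Commute (L a) A := by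
    rintro _ ⟨α, β, rfl⟩
    rw [hL.map_add, hL.map_mul]
    exact (hreal α).add_left (hAι.mul_left (hreal β))
  obtain ⟨a, ha, b, hb, rfl⟩ := exists_slicePlane_decomposition hι hj hιj q
  rw [hL.map_add, hL.map_mul]
  exact (hplane a ha).add_left ((hplane b hb).mul_left hAj)

end IsLeftScalarMul

theorem opKer_neg {E : Type*} [NormedAddCommGroup E] [Module ℍᵐᵒᵖ E] (D : E →L[ℍᵐᵒᵖ] E) :
    opKer (-D) = opKer D :=
  Set.ext fun _ => neg_eq_zero

variable [CompleteSpace H]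

theorem IsAbsOp.eq {S A B : H →L[ℍᵐᵒᵖ] H} (hA : IsAbsOp S A) (hB : IsAbsOp S B) : A = B :=
  hA.1.eq_of_mul_self_eq hB.1 (hA.2.trans hB.2.symm)

theorem apply_eq_zero_of_mul_eq_zero {W D : H →L[ℍᵐᵒᵖ] H} (h : W * D = 0) {u : H}
    (hu : u ∈ qperp (opKer (qadjoint D))) : W u = 0 := by
  have hrange : qadjoint W (W u) ∈ opKer (qadjoint D) := by
    refine eq_zero_of_qinner_self_eq_zero ?_
    have hW : W (D (qadjoint D (qadjoint W (W u)))) = 0 := DFunLike.congr_fun h _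
    rw [qinner_qadjoint, qinner_qadjoint, hW, qinner_zero_right]
  refine eq_zero_of_qinner_self_eq_zero ?_
  rw [← qinner_qadjoint, ← star_qinner, hu _ hrange, star_zero]

namespace IsLeftScalarMul

theorem commute_qadjoint (hL : IsLeftScalarMul L) {k : ℍ} (hk : k ∈ imUnits)
    (h : Commute (L k) T) : Commute (L k) (qadjoint T) := by
  have hadj : qadjoint T * qadjoint (L k) = qadjoint (L k) * qadjoint T := by
    rw [← qadjoint_mul, ← qadjoint_mul, h.eq]
  rw [hL.qadjoint_eq_map_star, star_of_mem_imUnits hk, hL.map_neg,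
    mul_neg (qadjoint T), neg_mul (L k), neg_inj] at hadj
  exact hadj.symm

theorem map_eq_of_mem_qperp {L' : ℍ → H →L[ℍᵐᵒᵖ] H} (hL : IsLeftScalarMul L)
    (hL' : IsLeftScalarMul L') {D : H →L[ℍᵐᵒᵖ] H} (hD : L' ι * D = L ι * D) {q : ℍ}
    (hq : q ∈ slicePlane ι) {u : H} (hu : u ∈ qperp (opKer (qadjoint D))) : L' q u = L q u := by
  have hι : L' ι u = L ι u := by
    rw [← sub_eq_zero, ← sub_mul] at hD
    exact sub_eq_zero.1 (apply_eq_zero_of_mul_eq_zero hD hu)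
  obtain ⟨α, β, rfl⟩ := hq
  simp only [hL.map_add, hL'.map_add, hL.map_mul, hL'.map_mul, add_apply, mul_apply_eq_comp,
    hL.map_coe, hL'.map_coe, qop_map_real_smul, hι]

end IsLeftScalarMul

end LeftMultiplication

section Representation

variable {ι : ℍ} {H : Type*} [NormedAddCommGroup H] [Module ℍᵐᵒᵖ H] [QuaternionicInner H]
  [CompleteSpace H] {P : QPVM ι H} {L : ℍ → H →L[ℍᵐᵒᵖ] H} {T : H →L[ℍᵐᵒᵖ] H}

attribute [local instance] complexInnerSpace InnerProductSpace.complexToReal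

namespace IsSliceIntegral

theorem commute_leftMul (h : IsIQPVM P L) (hι : ι ∈ imUnits)
    (hT : IsSliceIntegral P L (fun z => (z : ℍ)) T) : Commute (L ι) T :=
  unique h ((const P L ι).mul h hT)
    ((hT.mul h (const P L ι)).congr fun z _ => (commute_coe hι z).symm)

theorem leftMul_mul_eq_qadjoint_mul (h : IsIQPVM P L) (hι : ι ∈ imUnits)
    (hT : IsSliceIntegral P L (fun z => (z : ℍ)) T) {j : ℍ} (hj : ι * j = -(j * ι)) :
    L j * T = _root_.qadjoint T * L j :=
  unique h ((const P L j).mul h hT)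
    (((hT.qadjoint h).mul h (const P L j)).congr fun z _ => (anticommute_coe hι hj z).symm)

theorem isPositiveOp_neg_leftMul_mul (h : IsIQPVM P L) (hι : ι ∈ imUnits)
    (hT : IsSliceIntegral P L (fun z => (z : ℍ)) T) :
    IsPositiveOp (-(L ι * (T - _root_.qadjoint T))) := fun u =>
  ⟨_, integral_nonneg fun z => mul_nonneg zero_le_two (hpIm_nonneg z),
    (hT.neg_leftMul_mul h hι).qinner_eq h u⟩

theorem isAbsOp_neg_leftMul_mul (h : IsIQPVM P L) (hι : ι ∈ imUnits)
    (hT : IsSliceIntegral P L (fun z => (z : ℍ)) T) :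
    IsAbsOp (T - _root_.qadjoint T) (-(L ι * (T - _root_.qadjoint T))) := by
  have habs := hT.neg_leftMul_mul h hι
  refine ⟨hT.isPositiveOp_neg_leftMul_mul h hι, ?_⟩
  rw [qadjoint_sub_qadjoint, neg_mul (T - _root_.qadjoint T)]
  exact unique h ((habs.mul h habs).congr fun z _ => (Quaternion.coe_mul _ _).symm)
    (hT.neg_sub_qadjoint_sq h hι)

end IsSliceIntegral

namespace SliceCalculus

variable (Φ : SliceCalculus ι T)

theorem isSliceIntegral_id (hι : ι ∈ imUnits) (h : IsIQPVM Φ.qpvm L)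
    (hL : L ι * Φ.qop (twoIm ι) = T - qadjoint T) :
    IsSliceIntegral Φ.qpvm L (fun z => (z : ℍ)) T := by
  have hre := Φ.isSliceIntegral_qop h (twoRe ι)
  have him := (IsSliceIntegral.const _ L ι).mul h (Φ.isSliceIntegral_qop h (twoIm ι))
  rw [hL] at him
  rw [Φ.qop_twoRe] at hre
  have hhalf := (IsSliceIntegral.const Φ.qpvm L ((2⁻¹ : ℝ) : ℍ)).mul h (hre.add h him)
  have hop : L ((2⁻¹ : ℝ) : ℍ) * (T + qadjoint T + (T - qadjoint T)) = T := by
    ext u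
    rw [add_add_sub_cancel, mul_apply_eq_comp, h.leftMul.map_coe, add_apply, ← two_smul ℝ,
      inv_smul_smul₀ two_ne_zero]
  rw [hop] at hhalf
  refine hhalf.congr fun z _ => ?_
  beta_reduce
  rw [← coe_add_star, ← coe_sub_star hι, add_add_sub_cancel, Quaternion.coe_mul_eq_smul,
    ← two_smul ℝ, inv_smul_smul₀ two_ne_zero]

theorem isPositiveOp_qop_twoIm : IsPositiveOp (Φ.qop (twoIm ι)) := fun u => by
  have hself : star (qinner u (Φ.qop (twoIm ι) u)) = qinner u (Φ.qop (twoIm ι) u) := by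
    rw [star_qinner, qinner_qop]
  refine ⟨_, ?_, quaternion_eq_coe_re hself⟩
  rw [← real_inner_def, ← Φ.integral_measure_qpvm]
  exact integral_nonneg fun z => mul_nonneg zero_le_two (hpIm_nonneg z)

theorem qop_twoIm_eq (hL : IsLeftScalarMul L) (hι : ι ∈ imUnits) (hιT : Commute (L ι) T)
    (hpos : IsPositiveOp (-(L ι * (T - qadjoint T)))) :
    Φ.qop (twoIm ι) = -(L ι * (T - qadjoint T)) := by
  have hcomm : Commute (L ι) (T - qadjoint T) := hιT.sub_right (hL.commute_qadjoint hι hιT)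
  refine Φ.isPositiveOp_qop_twoIm.eq_of_mul_self_eq hpos ?_
  rw [← map_mul, Φ.qop_twoIm_sq, neg_mul_neg (L ι * (T - qadjoint T)), mul_assoc,
    ← mul_assoc (T - qadjoint T), ← hcomm.eq, mul_assoc, ← mul_assoc (L ι),
    hL.mul_self_of_mem_imUnits hι, neg_one_mul ((T - qadjoint T) * (T - qadjoint T))]

theorem isIQPVM_of_commute_leftMul (hL : IsLeftScalarMul L) (hι : ι ∈ imUnits)
    (hιT : Commute (L ι) T) {j : ℍ} (hj : j ∈ imUnits) (hιj : ι * j = -(j * ι))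
    (hjT : L j * T = qadjoint T * L j) : IsIQPVM Φ.qpvm L := by
  have hιT' := hL.commute_qadjoint hι hιT
  have hjT' : L j * qadjoint T = T * L j := by
    have hconj : L j * L j * (T * L j) = L j * qadjoint T * (L j * L j) := by
      rw [mul_assoc, ← mul_assoc (L j) T, hjT, mul_assoc, mul_assoc]
    rw [hL.mul_self_of_mem_imUnits hj, neg_one_mul (T * L j), mul_neg_one (L j * qadjoint T),
      neg_inj] at hconj
    exact hconj.symm
  have hιD : Commute (L ι) (T - qadjoint T) := hιT.sub_right hιT'
  have hjA : Commute (L j) (T + qadjoint T) := by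
    rw [Commute, SemiconjBy, mul_add, add_mul, hjT, hjT', add_comm]
  have hjD : L j * (T - qadjoint T) = -((T - qadjoint T) * L j) := by
    rw [mul_sub, sub_mul, hjT, hjT', neg_sub]
  have hjDD : Commute (L j) ((T - qadjoint T) * (T - qadjoint T)) := by
    rw [Commute, SemiconjBy, ← mul_assoc, hjD, neg_mul ((T - qadjoint T) * L j), mul_assoc, hjD,
      mul_neg (T - qadjoint T), neg_neg, mul_assoc]
  exact Φ.isIQPVM_of_commute hι hL
    (hL.commute_of_commute_imUnits hι hj hιj (hιT.add_right hιT') hjA)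
    (hL.commute_of_commute_imUnits hι hj hιj (hιD.mul_right hιD) hjDD)

theorem isSliceIntegral_id_of_isPositiveOp (hι : ι ∈ imUnits) (h : IsIQPVM Φ.qpvm L)
    (hιT : Commute (L ι) T) (hpos : IsPositiveOp (-(L ι * (T - qadjoint T)))) :
    IsSliceIntegral Φ.qpvm L (fun z => (z : ℍ)) T := by
  refine Φ.isSliceIntegral_id hι h ?_
  rw [Φ.qop_twoIm_eq h.leftMul hι hιT hpos, mul_neg (L ι), ← mul_assoc,
    h.leftMul.mul_self_of_mem_imUnits hι, neg_one_mul (T - qadjoint T), neg_neg]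

theorem isIQPVM_and_hasIQIntegral_iff (hι : ι ∈ imUnits) (hL : IsLeftScalarMul L) :
    (IsIQPVM Φ.qpvm L ∧ HasIQIntegral Φ.qpvm L (fun z => (z : ℍ)) T) ↔
      (L ι * T = T * L ι ∧
        (∃ j ∈ imUnits, ι * j = -(j * ι) ∧ L j * T = qadjoint T * L j) ∧
        IsPositiveOp (-(L ι * (T - qadjoint T)))) := by
  constructor
  · rintro ⟨h, hT⟩
    have hT := hT.isSliceIntegral
    obtain ⟨j, hj, hιj⟩ := exists_anticommuting hι
    exact ⟨hT.commute_leftMul h hι, ⟨j, hj, hιj, hT.leftMul_mul_eq_qadjoint_mul h hι hιj⟩,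
      hT.isPositiveOp_neg_leftMul_mul h hι⟩
  · rintro ⟨hιT, ⟨j, hj, hιj, hjT⟩, hpos⟩
    have h := Φ.isIQPVM_of_commute_leftMul hL hι hιT hj hιj hjT
    exact ⟨h, (Φ.isSliceIntegral_id_of_isPositiveOp hι h hιT hpos).hasIQIntegral h
      measurable_subtype_coe⟩

end SliceCalculus

namespace IsSliceIntegral

theorem leftMul_eq_of_mem_qperp (h : IsIQPVM P L) (hT : IsSliceIntegral P L (fun z => (z : ℍ)) T)
    {P' : QPVM ι H} {L' : ℍ → H →L[ℍᵐᵒᵖ] H} (h' : IsIQPVM P' L')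
    (hT' : IsSliceIntegral P' L' (fun z => (z : ℍ)) T) (hι : ι ∈ imUnits) {q : ℍ}
    (hq : q ∈ slicePlane ι) {u : H} (hu : u ∈ qperp (opKer (T - _root_.qadjoint T))) :
    L' q u = L q u := by
  have hneg : -(L' ι * (T - _root_.qadjoint T)) = -(L ι * (T - _root_.qadjoint T)) :=
    (hT'.isAbsOp_neg_leftMul_mul h' hι).eq (hT.isAbsOp_neg_leftMul_mul h hι)
  refine h.leftMul.map_eq_of_mem_qperp h'.leftMul (neg_injective hneg) hq ?_
  rwa [qadjoint_sub_qadjoint, opKer_neg]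

theorem map_eq (h : IsIQPVM P L) (hT : IsSliceIntegral P L (fun z => (z : ℍ)) T)
    {P' : QPVM ι H} {L' : ℍ → H →L[ℍᵐᵒᵖ] H} (h' : IsIQPVM P' L')
    (hT' : IsSliceIntegral P' L' (fun z => (z : ℍ)) T) (hι : ι ∈ imUnits) (hn : IsNormalOp T)
    {E : Set (sliceHalfPlane ι)} (hE : MeasurableSet E) : P' E = P E := by
  obtain ⟨Φ⟩ := exists_sliceCalculus hι hn
  exact QPVM.ext_of_measure
    (fun u => (hT'.measure_eq h' hι Φ u).trans (hT.measure_eq h hι Φ u).symm) hE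

end IsSliceIntegral

end Representation

section Sphere

variable {ι : ℍ}

variable (ι) in
/-- The point `α + ι β`, `β ≥ 0`, of the slice half-plane on the sphere `𝕊_q` of `q = α + j β`. -/
def slicePoint (q : ℍ) : sliceHalfPlane ι := hpMk ι q.re ‖q.im‖

theorem slicePoint_coe (hι : ι ∈ imUnits) (z : sliceHalfPlane ι) : slicePoint ι (z : ℍ) = z :=
  hpMk_hpRe_hpIm hι z

theorem hpRe_slicePoint (hι : ι ∈ imUnits) (q : ℍ) : hpRe (slicePoint ι q) = q.re :=
  hpRe_hpMk hι _ _

theorem hpIm_slicePoint (hι : ι ∈ imUnits) (q : ℍ) : hpIm (slicePoint ι q) = ‖q.im‖ :=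
  (hpIm_hpMk hι _ _).trans (abs_of_nonneg (norm_nonneg _))

theorem coe_slicePoint (hι : ι ∈ imUnits) (q : ℍ) :
    (slicePoint ι q : ℍ) = (q.re : ℍ) + ι * (‖q.im‖ : ℍ) := by
  rw [coe_eq_hpRe_add hι, hpRe_slicePoint hι, hpIm_slicePoint hι]

theorem im_mul_im (q : ℍ) : q.im * q.im = ((-(‖q.im‖ * ‖q.im‖) : ℝ) : ℍ) := by
  rw [Quaternion.coe_neg, ← Quaternion.normSq_eq_norm_mul_self, ← Quaternion.self_mul_star,
    Quaternion.star_im, mul_neg, neg_neg]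

theorem exists_imUnits_eq_re_add_mul (hι : ι ∈ imUnits) (q : ℍ) :
    ∃ j ∈ imUnits, q = (q.re : ℍ) + j * (‖q.im‖ : ℍ) := by
  by_cases h : ‖q.im‖ = 0
  · refine ⟨ι, hι, ?_⟩
    rw [h, Quaternion.coe_zero, mul_zero, ← norm_eq_zero.1 h, Quaternion.re_add_im]
  · refine ⟨q.im * ((‖q.im‖⁻¹ : ℝ) : ℍ), ?_, ?_⟩
    · change q.im * ((‖q.im‖⁻¹ : ℝ) : ℍ) * (q.im * ((‖q.im‖⁻¹ : ℝ) : ℍ)) = -1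
      rw [mul_assoc, Quaternion.coe_commutes, ← mul_assoc, ← mul_assoc, im_mul_im,
        ← Quaternion.coe_mul, ← Quaternion.coe_mul, ← Quaternion.coe_one, ← Quaternion.coe_neg]
      congr 1
      field_simp
    · rw [mul_assoc, ← Quaternion.coe_mul, inv_mul_cancel₀ h, Quaternion.coe_one, mul_one,
        Quaternion.re_add_im]

theorem setOf_mem_qSphere (hι : ι ∈ imUnits) (q : ℍ) :
    {z : sliceHalfPlane ι | (z : ℍ) ∈ qSphere q} = {slicePoint ι q} := by
  ext z
  rw [Set.mem_ofPred_eq, Set.mem_singleton_iff]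
  constructor
  · rintro ⟨α, β, j, hj, κ, hκ, hq, hz⟩
    refine hp_ext hι ?_ ?_
    · rw [hpRe_slicePoint hι, hq, re_coe_add_mul hj, hpRe, hz, re_coe_add_mul hκ]
    · rw [hpIm_slicePoint hι, hq, norm_im_coe_add_mul hj, hpIm, hz, norm_im_coe_add_mul hκ]
  · rintro rfl
    obtain ⟨j, hj, hq⟩ := exists_imUnits_eq_re_add_mul hι q
    exact ⟨q.re, ‖q.im‖, j, hj, ι, hι, hq, coe_slicePoint hι q⟩

theorem exists_norm_one_mul_eq_mul_of_mem_imUnits {j : ℍ} (hι : ι ∈ imUnits) (hj : j ∈ imUnits) :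
    ∃ p : ℍ, ‖p‖ = 1 ∧ ι * p = p * j := by
  suffices h : ∃ p : ℍ, p ≠ 0 ∧ ι * p = p * j by
    obtain ⟨p, hp, h⟩ := h
    refine ⟨((‖p‖⁻¹ : ℝ) : ℍ) * p, ?_, ?_⟩
    · rw [norm_mul, Quaternion.norm_coe, norm_inv, norm_norm,
        inv_mul_cancel₀ (norm_ne_zero_iff.2 hp)]
    · rw [← mul_assoc, ← Quaternion.coe_commutes, mul_assoc, h, mul_assoc]
  have hιι : ι * ι = -1 := hι
  have hjj : j * j = -1 := hj
  by_cases hp : ι * j - 1 = 0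
  · have hjι : j = -ι := by
      rw [← neg_one_mul, ← hjj, mul_assoc, mul_eq_one_comm.1 (sub_eq_zero.1 hp), mul_one]
    obtain ⟨κ, hκ, hικ⟩ := exists_anticommuting hι
    refine ⟨κ, norm_ne_zero_iff.1 ?_, by rw [hικ, hjι, mul_neg]⟩
    rw [norm_of_mem_imUnits hκ]
    exact one_ne_zero
  · refine ⟨ι * j - 1, hp, ?_⟩
    rw [mul_sub, sub_mul, ← mul_assoc, hιι, mul_assoc, hjj, neg_one_mul, mul_neg_one, mul_one,
      one_mul]
    abel

theorem exists_norm_one_slicePoint_mul_eq_mul (hι : ι ∈ imUnits) (q : ℍ) :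
    ∃ p : ℍ, ‖p‖ = 1 ∧ (slicePoint ι q : ℍ) * p = p * q := by
  obtain ⟨j, hj, hq⟩ := exists_imUnits_eq_re_add_mul hι q
  obtain ⟨p, hp, hιp⟩ := exists_norm_one_mul_eq_mul_of_mem_imUnits hι hj
  refine ⟨p, hp, ?_⟩
  conv_rhs => rw [hq]
  rw [coe_slicePoint hι, add_mul, mul_add, Quaternion.coe_commutes, mul_assoc,
    Quaternion.coe_commutes ‖q.im‖, ← mul_assoc, hιp, mul_assoc]

theorem norm_slicePoint (hι : ι ∈ imUnits) (q : ℍ) : ‖(slicePoint ι q : ℍ)‖ = ‖q‖ := by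
  obtain ⟨p, hp, h⟩ := exists_norm_one_slicePoint_mul_eq_mul hι q
  have hnorm := congrArg norm h
  rwa [norm_mul, norm_mul, hp, mul_one, one_mul] at hnorm

/-- The quadratic polynomial `z² - 2 Re(q) z + |q|²` with zero set `𝕊_q`; its integral against an
iqPVM representing `T` is `Δ_q(T)`. -/
def sphPoly (q z : ℍ) : ℍ := z * z - ((2 * q.re : ℝ) : ℍ) * z + ((‖q‖ ^ 2 : ℝ) : ℍ)

theorem continuous_sphPoly (q : ℍ) :
    Continuous fun z : sliceHalfPlane ι => sphPoly q z := by
  unfold sphPoly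
  fun_prop

theorem sphPoly_eq (hι : ι ∈ imUnits) (q : ℍ) (z : sliceHalfPlane ι) :
    sphPoly q z = (z - slicePoint ι q) * (z - star (slicePoint ι q : ℍ)) := by
  have htrace : ((2 * q.re : ℝ) : ℍ) = slicePoint ι q + star (slicePoint ι q : ℍ) := by
    rw [coe_add_star, ← hpRe_slicePoint hι q]
    rfl
  have hnorm : ((‖q‖ ^ 2 : ℝ) : ℍ) = slicePoint ι q * star (slicePoint ι q : ℍ) := by
    rw [Quaternion.self_mul_star, Quaternion.normSq_eq_norm_mul_self, ← sq, norm_slicePoint hι]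
  have hcomm : ((2 * q.re : ℝ) : ℍ) * z = z * ((2 * q.re : ℝ) : ℍ) := Quaternion.coe_commutes _ _
  have hw : (slicePoint ι q : ℍ) * z = z * slicePoint ι q := by
    rw [coe_slicePoint hι, add_mul, mul_add, Quaternion.coe_commutes, mul_assoc,
      Quaternion.coe_commutes ‖q.im‖, ← mul_assoc, (commute_coe hι z : ι * z = z * ι), mul_assoc]
  rw [sphPoly, hcomm, htrace, hnorm, mul_add, sub_mul, mul_sub, mul_sub, hw]
  abel

theorem sphPoly_eq_zero_iff (hι : ι ∈ imUnits) (q : ℍ) (z : sliceHalfPlane ι) :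
    sphPoly q z = 0 ↔ z = slicePoint ι q := by
  rw [sphPoly_eq hι, mul_eq_zero, sub_eq_zero, sub_eq_zero]
  constructor
  · rintro (h | h)
    · exact Subtype.ext h
    · refine hp_ext hι ?_ ?_
      · rw [hpRe, h, Quaternion.re_star]; rfl
      · rw [hpIm, h, Quaternion.im_star, norm_neg]; rfl
  · rintro rfl
    exact Or.inl rfl

theorem setOf_eq_coe_real : {z : sliceHalfPlane ι | ∃ r : ℝ, (z : ℍ) = (r : ℍ)} =
    {z : sliceHalfPlane ι | (z : ℍ) - star (z : ℍ) = 0} := by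
  ext z
  rw [Set.mem_ofPred_eq, Set.mem_ofPred_eq, sub_eq_zero]
  constructor
  · rintro ⟨r, hr⟩
    rw [hr, Quaternion.star_coe]
  · exact fun hz => ⟨_, quaternion_eq_coe_re hz.symm⟩

theorem measurableSet_coe_real :
    MeasurableSet {z : sliceHalfPlane ι | ∃ r : ℝ, (z : ℍ) = (r : ℍ)} := by
  rw [setOf_eq_coe_real]
  exact (isClosed_eq (by fun_prop) continuous_const).measurableSet

end Sphere

section Spectrum

variable {ι : ℍ} {H : Type*} [NormedAddCommGroup H] [Module ℍᵐᵒᵖ H] [QuaternionicInner H]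
  {P : QPVM ι H} {L : ℍ → H →L[ℍᵐᵒᵖ] H} {T S : H →L[ℍᵐᵒᵖ] H}

attribute [local instance] complexInnerSpace InnerProductSpace.complexToReal

namespace QPVM

variable {E : Set (sliceHalfPlane ι)}

theorem map_compl_apply_eq_zero_iff (hE : MeasurableSet E) (u : H) :
    P Eᶜ u = 0 ↔ P E u = u := by
  rw [P.map_compl hE, sub_apply, one_apply_eq_self, sub_eq_zero, eq_comm]

theorem mem_range_iff (hE : MeasurableSet E) (u : H) : u ∈ Set.range (P E) ↔ P E u = u :=
  ⟨fun ⟨v, hv⟩ => by rw [← hv, P.map_idem hE], fun h => ⟨u, h⟩⟩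

theorem mem_supp_iff {z : sliceHalfPlane ι} :
    z ∈ P.supp ↔ ∀ U : Set (sliceHalfPlane ι), IsOpen U → z ∈ U → P U ≠ 0 :=
  ⟨fun h U hU hz h0 => h ⟨U, ⟨hU, h0⟩, hz⟩, fun h ⟨U, ⟨hU, h0⟩, hz⟩ => h U hU hz h0⟩

variable [CompleteSpace H]

theorem ae_mem (hE : MeasurableSet E) {u : H} (hu : P E u = u) : ∀ᵐ x ∂P.measure u, x ∈ E := by
  rw [ae_iff]
  exact (P.measure_eq_zero_iff hE.compl u).2 ((map_compl_apply_eq_zero_iff hE u).2 hu)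

theorem range_compl (hE : MeasurableSet E) : Set.range (P Eᶜ) = qperp (Set.range (P E)) := by
  ext u
  rw [mem_range_iff hE.compl, ← map_compl_apply_eq_zero_iff hE.compl, compl_compl]
  constructor
  · rintro h _ ⟨v, rfl⟩
    rw [← P.symm hE, h, qinner_zero_left]
  · intro h
    have horth := h _ ⟨u, rfl⟩
    rw [P.qinner_apply_self hE, ← qinner_self] at horth
    exact eq_zero_of_qinner_self_eq_zero horth

end QPVM

theorem IsIQPVM.exists_leftMul_eq_op_smul [CompleteSpace H] (h : IsIQPVM P L)
    {E : Set (sliceHalfPlane ι)} (hE : MeasurableSet E) (hPE : P E ≠ 0) (q : ℍ) :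
    ∃ v ≠ 0, P E v = v ∧ L q v = op q • v := by
  obtain ⟨N, hN, -, hLN⟩ := h.leftMul.exists_basis
  obtain ⟨x, hx, hPx⟩ : ∃ x ∈ N, P E x ≠ 0 := by
    by_contra! hzero
    exact hPE (hN.eq_of_eqOn hzero)
  refine ⟨P E x, hPx, P.map_idem hE x, ?_⟩
  rw [← mul_apply_eq_comp, ← h.commute E hE, mul_apply_eq_comp, hLN x hx, map_smul]

namespace IsSliceIntegral

variable {ψ : sliceHalfPlane ι → ℍ}

theorem isCompact_supp (hι : ι ∈ imUnits) (hT : IsSliceIntegral P L (fun z => (z : ℍ)) T) :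
    IsCompact P.supp := by
  obtain ⟨C, hC⟩ := hT.exists_bound
  exact (isCompact_setOf_norm_le hι C).of_isClosed_subset P.isClosed_supp hC

variable [CompleteSpace H]

theorem exists_sphDelta_eq (h : IsIQPVM P L) (hT : IsSliceIntegral P L (fun z => (z : ℍ)) T)
    (q : ℍ) : ∃ D : H →L[ℍᵐᵒᵖ] H, IsSliceIntegral P L (fun z => sphPoly q z) D ∧
      sphDelta T q = D := by
  refine ⟨_, ((hT.mul h hT).sub h ((const P L ((2 * q.re : ℝ) : ℍ)).mul h hT)).add h
    (const P L ((‖q‖ ^ 2 : ℝ) : ℍ)), funext fun u => ?_⟩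
  rw [add_apply, sub_apply, mul_apply_eq_comp, mul_apply_eq_comp, h.leftMul.map_coe,
    h.leftMul.map_coe, real_smul_def, real_smul_def, sphDelta]

theorem integrable_norm_sq (hS : IsSliceIntegral P L ψ S) (hψ : Measurable ψ) (u : H) :
    Integrable (fun x => ‖ψ x‖ ^ 2) (P.measure u) := by
  obtain ⟨C, hC⟩ := hS.exists_bound
  refine Integrable.of_bound (hψ.norm.pow_const 2).aestronglyMeasurable (C ^ 2) ?_
  filter_upwards [P.ae_mem_supp u] with x hx
  rw [Real.norm_eq_abs, abs_of_nonneg (sq_nonneg _)]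
  exact pow_le_pow_left₀ (norm_nonneg _) (hC x hx) 2

theorem apply_eq_zero_iff (h : IsIQPVM P L) (hS : IsSliceIntegral P L ψ S) (hψ : Measurable ψ)
    (u : H) : S u = 0 ↔ P {x | ψ x = 0} u = u := by
  have hE : MeasurableSet {x | ψ x = 0} := hψ (measurableSet_singleton 0)
  rw [← QPVM.map_compl_apply_eq_zero_iff hE, ← P.measure_eq_zero_iff hE.compl, ← norm_eq_zero,
    ← pow_eq_zero_iff two_ne_zero, hS.norm_sq_eq h,
    integral_eq_zero_iff_of_nonneg (fun x => sq_nonneg _) (hS.integrable_norm_sq hψ u),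
    EventuallyEq, ae_iff]
  simp only [Pi.zero_apply, pow_eq_zero_iff two_ne_zero, norm_eq_zero]
  rfl

theorem norm_apply_le (h : IsIQPVM P L) (hS : IsSliceIntegral P L ψ S) (hψ : Measurable ψ)
    {E : Set (sliceHalfPlane ι)} (hE : MeasurableSet E) {c : ℝ} (hc : 0 ≤ c)
    (hψE : ∀ x ∈ E, ‖ψ x‖ ≤ c) {u : H} (hu : P E u = u) : ‖S u‖ ≤ c * ‖u‖ := by
  refine (sq_le_sq₀ (norm_nonneg _) (by positivity)).1 ?_
  rw [hS.norm_sq_eq h, mul_pow, ← P.measureReal_univ, mul_comm, ← smul_eq_mul, ← integral_const]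
  refine integral_mono_ae (hS.integrable_norm_sq hψ u) (integrable_const _) ?_
  filter_upwards [QPVM.ae_mem hE hu] with x hx
  exact pow_le_pow_left₀ (norm_nonneg _) (hψE x hx) 2

theorem le_norm_apply (h : IsIQPVM P L) (hS : IsSliceIntegral P L ψ S) (hψ : Measurable ψ)
    {c : ℝ} (hc : 0 ≤ c) (hψc : ∀ x ∈ P.supp, c ≤ ‖ψ x‖) (u : H) : c * ‖u‖ ≤ ‖S u‖ := by
  refine (sq_le_sq₀ (by positivity) (norm_nonneg _)).1 ?_
  rw [hS.norm_sq_eq h, mul_pow, ← P.measureReal_univ, mul_comm, ← smul_eq_mul, ← integral_const]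
  refine integral_mono_ae (integrable_const _) (hS.integrable_norm_sq hψ u) ?_
  filter_upwards [P.ae_mem_supp u] with x hx
  exact pow_le_pow_left₀ hc (hψc x hx) 2

theorem norm_qadjoint_apply (h : IsIQPVM P L) (hS : IsSliceIntegral P L ψ S) (u : H) :
    ‖_root_.qadjoint S u‖ = ‖S u‖ := by
  refine (pow_left_inj₀ (norm_nonneg _) (norm_nonneg _) two_ne_zero).1 ?_
  rw [hS.norm_sq_eq h, (hS.qadjoint h).norm_sq_eq h]
  simp only [norm_star]

theorem closure_range_eq_univ (h : IsIQPVM P L) (hS : IsSliceIntegral P L ψ S)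
    (hinj : ∀ u, S u = 0 → u = 0) : closure (Set.range S) = Set.univ := by
  have hdense : (toRealOp S).range.topologicalClosure = ⊤ := by
    rw [Submodule.topologicalClosure_eq_top_iff, Submodule.eq_bot_iff]
    intro v hv
    refine hinj v ?_
    rw [← norm_eq_zero, ← hS.norm_qadjoint_apply h, norm_eq_zero, ← inner_self_eq_zero (𝕜 := ℝ),
      real_inner_def, qinner_qadjoint, ← star_qinner, Quaternion.re_star]
    exact (Submodule.mem_orthogonal _ _).1 hv _ ⟨_root_.qadjoint S v, rfl⟩
  exact congrArg (fun V : Submodule ℝ H => (V : Set H)) hdense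

theorem sphDelta_eq_zero_iff (h : IsIQPVM P L) (hι : ι ∈ imUnits)
    (hT : IsSliceIntegral P L (fun z => (z : ℍ)) T) (q : ℍ) (u : H) :
    sphDelta T q u = 0 ↔ P {slicePoint ι q} u = u := by
  obtain ⟨D, hD, hDelta⟩ := hT.exists_sphDelta_eq h q
  rw [hDelta, hD.apply_eq_zero_iff h (continuous_sphPoly q).measurable]
  simp only [sphPoly_eq_zero_iff hι]
  rfl

theorem ker_sphDelta_eq_iff (h : IsIQPVM P L) (hι : ι ∈ imUnits)
    (hT : IsSliceIntegral P L (fun z => (z : ℍ)) T) (q : ℍ) :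
    {u | sphDelta T q u = 0} = {0} ↔ P {slicePoint ι q} = 0 := by
  constructor
  · intro hker
    ext u
    have hu : P {slicePoint ι q} u ∈ {u | sphDelta T q u = 0} :=
      (hT.sphDelta_eq_zero_iff h hι q _).2 (P.map_idem (measurableSet_singleton _) u)
    rwa [hker] at hu
  · intro hP
    ext u
    rw [Set.mem_ofPred_eq, hT.sphDelta_eq_zero_iff h hι, hP, zero_apply, Set.mem_singleton_iff,
      eq_comm]

theorem closure_range_sphDelta (h : IsIQPVM P L)
    (hT : IsSliceIntegral P L (fun z => (z : ℍ)) T) {q : ℍ}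
    (hq : {u | sphDelta T q u = 0} = {0}) : closure (Set.range (sphDelta T q)) = Set.univ := by
  obtain ⟨D, hD, hDelta⟩ := hT.exists_sphDelta_eq h q
  rw [hDelta] at hq ⊢
  exact hD.closure_range_eq_univ h fun u hu => hq.subset hu

theorem slicePoint_notMem_supp (h : IsIQPVM P L) (hι : ι ∈ imUnits)
    (hT : IsSliceIntegral P L (fun z => (z : ℍ)) T) {q : ℍ} (hb : sphInvBounded T q) :
    slicePoint ι q ∉ P.supp := by
  obtain ⟨D, hD, hDelta⟩ := hT.exists_sphDelta_eq h q
  obtain ⟨C, hC⟩ := hb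
  obtain ⟨ε, hε, hCε⟩ := exists_pos_mul_lt one_pos |C|
  have hc := continuous_sphPoly (ι := ι) q
  have hU : IsOpen {z : sliceHalfPlane ι | ‖sphPoly q z‖ < ε} :=
    isOpen_lt hc.norm continuous_const
  refine fun hmem => QPVM.mem_supp_iff.1 hmem _ hU ?_ (ContinuousLinearMap.ext fun v => ?_)
  · rwa [Set.mem_ofPred_eq, (sphPoly_eq_zero_iff hι q _).2 rfl, norm_zero]
  · set u := P {z : sliceHalfPlane ι | ‖sphPoly q z‖ < ε} v
    have hDu : ‖D u‖ ≤ ε * ‖u‖ := hD.norm_apply_le h hc.measurable hU.measurableSet hε.le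
      (fun x hx => le_of_lt hx) (P.map_idem hU.measurableSet v)
    have hu : ‖u‖ ≤ |C| * ε * ‖u‖ := calc
      ‖u‖ ≤ C * ‖D u‖ := hDelta ▸ hC u
      _ ≤ |C| * (ε * ‖u‖) := by gcongr; exact le_abs_self C
      _ = |C| * ε * ‖u‖ := (mul_assoc _ _ _).symm
    exact norm_le_zero_iff.1 (by nlinarith [norm_nonneg u])

theorem sphInvBounded_of_slicePoint_notMem_supp (h : IsIQPVM P L) (hι : ι ∈ imUnits)
    (hT : IsSliceIntegral P L (fun z => (z : ℍ)) T) {q : ℍ} (hq : slicePoint ι q ∉ P.supp) :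
    sphInvBounded T q := by
  obtain ⟨D, hD, hDelta⟩ := hT.exists_sphDelta_eq h q
  have hc := continuous_sphPoly (ι := ι) q
  obtain ⟨c, hc0, hcK⟩ := (hT.isCompact_supp hι).exists_forall_le' (a := 0)
    hc.norm.continuousOn fun z hz => norm_pos_iff.2 fun h0 =>
      hq ((sphPoly_eq_zero_iff hι q z).1 h0 ▸ hz)
  refine ⟨c⁻¹, fun u => ?_⟩
  rw [hDelta, inv_mul_eq_div, le_div_iff₀' hc0]
  exact hD.le_norm_apply h hc.measurable hc0.le hcK u

theorem sphInvBounded_iff (h : IsIQPVM P L) (hι : ι ∈ imUnits)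
    (hT : IsSliceIntegral P L (fun z => (z : ℍ)) T) (q : ℍ) :
    sphInvBounded T q ↔ slicePoint ι q ∉ P.supp :=
  ⟨hT.slicePoint_notMem_supp h hι, hT.sphInvBounded_of_slicePoint_notMem_supp h hι⟩

theorem ker_sphDelta_eq_of_sphInvBounded (h : IsIQPVM P L)
    (hT : IsSliceIntegral P L (fun z => (z : ℍ)) T) {q : ℍ} (hb : sphInvBounded T q) :
    {u | sphDelta T q u = 0} = {0} := by
  obtain ⟨D, -, hDelta⟩ := hT.exists_sphDelta_eq h q
  obtain ⟨C, hC⟩ := hb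
  rw [hDelta] at hC ⊢
  refine Set.Subset.antisymm (fun u (hu : D u = 0) => ?_) (Set.singleton_subset_iff.2 (map_zero D))
  exact norm_le_zero_iff.1 (by simpa only [hu, norm_zero, mul_zero] using hC u)

theorem mem_sphSpectrum_iff (h : IsIQPVM P L) (hι : ι ∈ imUnits)
    (hT : IsSliceIntegral P L (fun z => (z : ℍ)) T) (q : ℍ) :
    q ∈ sphSpectrum T ↔ slicePoint ι q ∈ P.supp := by
  rw [sphSpectrum, Set.mem_compl_iff, sphResolvent, Set.mem_ofPred_eq, not_iff_comm,
    ← hT.sphInvBounded_iff h hι]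
  refine ⟨fun hb => ?_, fun hq => hq.2.2⟩
  have hker := hT.ker_sphDelta_eq_of_sphInvBounded h hb
  exact ⟨hker, dense_iff_closure_eq.2 (hT.closure_range_sphDelta h hker), hb⟩

theorem coe_mem_sphSpectrum_iff (h : IsIQPVM P L) (hι : ι ∈ imUnits)
    (hT : IsSliceIntegral P L (fun z => (z : ℍ)) T) (z : sliceHalfPlane ι) :
    (z : ℍ) ∈ sphSpectrum T ↔ z ∈ P.supp := by
  rw [hT.mem_sphSpectrum_iff h hι, slicePoint_coe hι]

theorem image_supp_eq (h : IsIQPVM P L) (hι : ι ∈ imUnits)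
    (hT : IsSliceIntegral P L (fun z => (z : ℍ)) T) :
    Subtype.val '' P.supp = sphSpectrum T ∩ sliceHalfPlane ι := by
  have hsupp : P.supp = Subtype.val ⁻¹' sphSpectrum T :=
    Set.ext fun z => (hT.coe_mem_sphSpectrum_iff h hι z).symm
  rw [hsupp, Subtype.image_preimage_val, Set.inter_comm]

theorem mem_sphPointSpectrum_iff (h : IsIQPVM P L) (hι : ι ∈ imUnits)
    (hT : IsSliceIntegral P L (fun z => (z : ℍ)) T) (q : ℍ) :
    q ∈ sphPointSpectrum T ↔ P {z : sliceHalfPlane ι | (z : ℍ) ∈ qSphere q} ≠ 0 := by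
  rw [setOf_mem_qSphere hι]
  exact (hT.ker_sphDelta_eq_iff h hι q).not

theorem coe_mem_sphPointSpectrum_iff (h : IsIQPVM P L) (hι : ι ∈ imUnits)
    (hT : IsSliceIntegral P L (fun z => (z : ℍ)) T) (z : sliceHalfPlane ι) :
    (z : ℍ) ∈ sphPointSpectrum T ↔ P {z} ≠ 0 := by
  rw [hT.mem_sphPointSpectrum_iff h hι, setOf_mem_qSphere hι, slicePoint_coe hι]

theorem coe_mem_sphPointSpectrum_of_isolated (h : IsIQPVM P L) (hι : ι ∈ imUnits)
    (hT : IsSliceIntegral P L (fun z => (z : ℍ)) T) {z : sliceHalfPlane ι}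
    {U : Set (sliceHalfPlane ι)} (hU : IsOpen U)
    (hUz : U ∩ {w : sliceHalfPlane ι | (w : ℍ) ∈ sphSpectrum T} = {z}) :
    (z : ℍ) ∈ sphPointSpectrum T := by
  simp only [hT.coe_mem_sphSpectrum_iff h hι, Set.ofPred_mem_eq] at hUz
  have hz : z ∈ U ∩ P.supp := hUz ▸ Set.mem_singleton z
  rw [hT.coe_mem_sphPointSpectrum_iff h hι, ← hUz, P.map_inter_supp hU.measurableSet]
  exact QPVM.mem_supp_iff.1 hz.2 U hU hz.1

theorem sphResidualSpectrum_eq_empty (h : IsIQPVM P L)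
    (hT : IsSliceIntegral P L (fun z => (z : ℍ)) T) : sphResidualSpectrum T = ∅ :=
  Set.eq_empty_of_forall_notMem fun _ hq => hq.2 (hT.closure_range_sphDelta h hq.1)

theorem mem_sphContinuousSpectrum_iff_mem_supp (h : IsIQPVM P L) (hι : ι ∈ imUnits)
    (hT : IsSliceIntegral P L (fun z => (z : ℍ)) T) (q : ℍ) :
    q ∈ sphContinuousSpectrum T ↔ P {slicePoint ι q} = 0 ∧ slicePoint ι q ∈ P.supp := by
  rw [sphContinuousSpectrum, Set.mem_ofPred_eq, hT.sphInvBounded_iff h hι, not_not,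
    ← hT.ker_sphDelta_eq_iff h hι]
  exact ⟨fun hq => ⟨hq.1, hq.2.2⟩, fun hq => ⟨hq.1, hT.closure_range_sphDelta h hq.1, hq.2⟩⟩

theorem mem_sphContinuousSpectrum_iff (h : IsIQPVM P L) (hι : ι ∈ imUnits)
    (hT : IsSliceIntegral P L (fun z => (z : ℍ)) T) (q : ℍ) :
    q ∈ sphContinuousSpectrum T ↔ P {z : sliceHalfPlane ι | (z : ℍ) ∈ qSphere q} = 0 ∧
      ∀ U : Set (sliceHalfPlane ι), IsOpen U →
        {z : sliceHalfPlane ι | (z : ℍ) ∈ qSphere q} ⊆ U → P U ≠ 0 := by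
  simp only [hT.mem_sphContinuousSpectrum_iff_mem_supp h hι, setOf_mem_qSphere hι,
    QPVM.mem_supp_iff, Set.singleton_subset_iff]

theorem coe_mem_sphContinuousSpectrum_iff (h : IsIQPVM P L) (hι : ι ∈ imUnits)
    (hT : IsSliceIntegral P L (fun z => (z : ℍ)) T) (z : sliceHalfPlane ι) :
    (z : ℍ) ∈ sphContinuousSpectrum T ↔
      P {z} = 0 ∧ ∀ U : Set (sliceHalfPlane ι), IsOpen U → z ∈ U → P U ≠ 0 := by
  rw [hT.mem_sphContinuousSpectrum_iff_mem_supp h hι, slicePoint_coe hι, QPVM.mem_supp_iff]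

theorem range_map_real (h : IsIQPVM P L) (hT : IsSliceIntegral P L (fun z => (z : ℍ)) T) :
    Set.range (P {z : sliceHalfPlane ι | ∃ r : ℝ, (z : ℍ) = (r : ℍ)}) =
      opKer (T - _root_.qadjoint T) := by
  have hψ : Measurable fun z : sliceHalfPlane ι => (z : ℍ) - star (z : ℍ) :=
    (continuous_subtype_val.sub (continuous_star.comp continuous_subtype_val)).measurable
  ext u
  rw [QPVM.mem_range_iff measurableSet_coe_real, setOf_eq_coe_real,
    ← (hT.sub h (hT.qadjoint h)).apply_eq_zero_iff h hψ]
  rfl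

theorem range_map_compl_real (h : IsIQPVM P L)
    (hT : IsSliceIntegral P L (fun z => (z : ℍ)) T) :
    Set.range (P {z : sliceHalfPlane ι | ∃ r : ℝ, (z : ℍ) = (r : ℍ)}ᶜ) =
      qperp (opKer (T - _root_.qadjoint T)) := by
  rw [QPVM.range_compl measurableSet_coe_real, hT.range_map_real h]

theorem exists_norm_apply_sub_op_smul_le (h : IsIQPVM P L)
    (hT : IsSliceIntegral P L (fun z => (z : ℍ)) T) {w : sliceHalfPlane ι} (hw : w ∈ P.supp)
    {ε : ℝ} (hε : 0 < ε) : ∃ v ≠ 0, ‖T v - op (w : ℍ) • v‖ ≤ ε * ‖v‖ := by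
  have hcont : Continuous fun z : sliceHalfPlane ι => (z : ℍ) - w :=
    continuous_subtype_val.sub continuous_const
  have hE : IsOpen {z : sliceHalfPlane ι | ‖(z : ℍ) - w‖ < ε} :=
    isOpen_lt hcont.norm continuous_const
  have hPE := QPVM.mem_supp_iff.1 hw _ hE (by rwa [Set.mem_ofPred_eq, sub_self, norm_zero])
  obtain ⟨v, hv, hPv, hLv⟩ := h.exists_leftMul_eq_op_smul hE.measurableSet hPE (w : ℍ)
  refine ⟨v, hv, ?_⟩
  rw [← hLv]
  exact (hT.sub h (const P L (w : ℍ))).norm_apply_le h hcont.measurable hE.measurableSet hε.le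
    (fun z hz => le_of_lt hz) hPv

theorem exists_norm_one_norm_apply_sub_op_smul_lt (h : IsIQPVM P L) (hι : ι ∈ imUnits)
    (hT : IsSliceIntegral P L (fun z => (z : ℍ)) T) {q : ℍ} (hq : q ∈ sphContinuousSpectrum T)
    {ε : ℝ} (hε : 0 < ε) : ∃ u : H, ‖u‖ = 1 ∧ ‖T u - op q • u‖ < ε := by
  obtain ⟨v, hv, hTv⟩ := hT.exists_norm_apply_sub_op_smul_le h
    ((hT.mem_sphContinuousSpectrum_iff_mem_supp h hι q).1 hq).2 (half_pos hε)
  obtain ⟨p, hp, hpq⟩ := exists_norm_one_slicePoint_mul_eq_mul hι q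
  have hv0 : 0 < ‖v‖ := norm_pos_iff.2 hv
  refine ⟨(‖v‖⁻¹ : ℝ) • op p • v, ?_, ?_⟩
  · rw [norm_smul, norm_op_smul, hp, one_mul, norm_inv, norm_norm, inv_mul_cancel₀ hv0.ne']
  · have hconj : T ((‖v‖⁻¹ : ℝ) • op p • v) - op q • (‖v‖⁻¹ : ℝ) • op p • v =
        (‖v‖⁻¹ : ℝ) • op p • (T v - op (slicePoint ι q : ℍ) • v) := by
      rw [qop_map_real_smul, map_smul, ← real_smul_op_smul, smul_sub, smul_sub, smul_smul (op q),
        smul_smul (op p), ← op_mul, ← op_mul, hpq]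
    rw [hconj, norm_smul, norm_op_smul, hp, one_mul, norm_inv, norm_norm, inv_mul_eq_div,
      div_lt_iff₀ hv0]
    exact hTv.trans_lt (mul_lt_mul_of_pos_right (half_lt_self hε) hv0)

end IsSliceIntegral

end Spectrum

end

theorem theoremA {H : Type*} [NormedAddCommGroup H] [Module ℍᵐᵒᵖ H] [QuaternionicInner H]
    [CompleteSpace H] [Nontrivial H] (ι : ℍ) (hι : ι ∈ imUnits)
    (T : H →L[ℍᵐᵒᵖ] H) (hT : IsNormalOp T) :
    ∃ (P : QPVM ι H) (L : ℍ → H →L[ℍᵐᵒᵖ] H),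
      -- existence of a bounded iqPVM representing `T`
      IsIQPVM P L ∧ Bornology.IsBounded P.supp ∧ HasIQIntegral P L (fun z => (z : ℍ)) T ∧
      -- uniqueness, and properties of every representing iqPVM
      (∀ (P' : QPVM ι H) (L' : ℍ → H →L[ℍᵐᵒᵖ] H), IsIQPVM P' L' →
        HasIQIntegral P' L' (fun z => (z : ℍ)) T →
          (∀ E, MeasurableSet E → P' E = P E) ∧
          (∀ q ∈ slicePlane ι, ∀ u ∈ qperp (opKer (T - qadjoint T)), L' q u = L q u) ∧
          (L' ι * T = T * L' ι ∧ L' ι * qadjoint T = qadjoint T * L' ι) ∧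
          (∀ j ∈ imUnits, ι * j = -(j * ι) → L' j * T = qadjoint T * L' j) ∧
          IsAbsOp (T - qadjoint T) (-(L' ι * (T - qadjoint T))) ∧
          -- on `ℂ⁺_ι` the coordinate `β` of `α + ι β` is the norm of the imaginary part
          HasIQIntegral P' L' (fun z => ((2 * ‖(z : ℍ).im‖ : ℝ) : ℍ))
            (-(L' ι * (T - qadjoint T)))) ∧
      -- characterisation of the admissible left scalar multiplications
      (∀ L' : ℍ → H →L[ℍᵐᵒᵖ] H, IsLeftScalarMul L' →
        ((IsIQPVM P L' ∧ HasIQIntegral P L' (fun z => (z : ℍ)) T) ↔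
          (L' ι * T = T * L' ι ∧
            (∃ j ∈ imUnits, ι * j = -(j * ι) ∧ L' j * T = qadjoint T * L' j) ∧
            IsPositiveOp (-(L' ι * (T - qadjoint T)))))) ∧
      -- support
      Subtype.val '' P.supp = sphSpectrum T ∩ sliceHalfPlane ι ∧
      -- kernel of `T - T*`
      Set.range (P {z : sliceHalfPlane ι | ∃ r : ℝ, (z : ℍ) = (r : ℍ)}) =
        opKer (T - qadjoint T) ∧
      Set.range (P {z : sliceHalfPlane ι | ∃ r : ℝ, (z : ℍ) = (r : ℍ)}ᶜ) =
        qperp (opKer (T - qadjoint T)) ∧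
      -- spherical point spectrum
      (∀ q : ℍ, q ∈ sphPointSpectrum T ↔ P {z : sliceHalfPlane ι | (z : ℍ) ∈ qSphere q} ≠ 0) ∧
      (∀ z : sliceHalfPlane ι, (z : ℍ) ∈ sphPointSpectrum T ↔ P {z} ≠ 0) ∧
      (∀ z : sliceHalfPlane ι,
        (∃ U : Set (sliceHalfPlane ι), IsOpen U ∧
          U ∩ {w : sliceHalfPlane ι | (w : ℍ) ∈ sphSpectrum T} = {z}) →
          (z : ℍ) ∈ sphPointSpectrum T) ∧
      -- residual spherical spectrum
      sphResidualSpectrum T = ∅ ∧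
      -- continuous spherical spectrum
      (∀ q : ℍ, q ∈ sphContinuousSpectrum T ↔
        P {z : sliceHalfPlane ι | (z : ℍ) ∈ qSphere q} = 0 ∧
          ∀ U : Set (sliceHalfPlane ι), IsOpen U →
            {z : sliceHalfPlane ι | (z : ℍ) ∈ qSphere q} ⊆ U → P U ≠ 0) ∧
      (∀ z : sliceHalfPlane ι, (z : ℍ) ∈ sphContinuousSpectrum T ↔
        P {z} = 0 ∧ ∀ U : Set (sliceHalfPlane ι), IsOpen U → z ∈ U → P U ≠ 0) ∧
      (∀ q ∈ sphContinuousSpectrum T, ∀ ε : ℝ, 0 < ε →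
        ∃ u : H, ‖u‖ = 1 ∧ ‖T u - op q • u‖ < ε) := by
  obtain ⟨Φ⟩ := exists_sliceCalculus hι hT
  obtain ⟨L, h, hL⟩ := Φ.exists_adapted_leftMul hι hT
  have hid := Φ.isSliceIntegral_id hι h hL
  refine ⟨Φ.qpvm, L, h, (hid.isCompact_supp hι).isBounded,
    hid.hasIQIntegral h measurable_subtype_coe, fun P' L' h' hT' => ?_,
    fun _ hL' => Φ.isIQPVM_and_hasIQIntegral_iff hι hL', hid.image_supp_eq h hι,
    hid.range_map_real h, hid.range_map_compl_real h, hid.mem_sphPointSpectrum_iff h hι,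
    hid.coe_mem_sphPointSpectrum_iff h hι,
    fun _ ⟨_, hU, hUz⟩ => hid.coe_mem_sphPointSpectrum_of_isolated h hι hU hUz,
    hid.sphResidualSpectrum_eq_empty h, hid.mem_sphContinuousSpectrum_iff h hι,
    hid.coe_mem_sphContinuousSpectrum_iff h hι,
    fun _ hq _ hε => hid.exists_norm_one_norm_apply_sub_op_smul_lt h hι hq hε⟩
  have hT' := hT'.isSliceIntegral
  have hιT := hT'.commute_leftMul h' hι
  exact ⟨fun _ hE => hid.map_eq h h' hT' hι hT hE,
    fun _ hq _ hu => hid.leftMul_eq_of_mem_qperp h h' hT' hι hq hu,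
    ⟨hιT, h'.leftMul.commute_qadjoint hι hιT⟩,
    fun _ _ hj => hT'.leftMul_mul_eq_qadjoint_mul h' hι hj,
    hT'.isAbsOp_neg_leftMul_mul h' hι,
    (hT'.neg_leftMul_mul h' hι).hasIQIntegral h'
      (Quaternion.continuous_coe.comp (twoIm ι).continuous).measurable⟩
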